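/- Let $m\ge 1$ be an integer. Write points of $\mathbb R^3=\mathbb C\times\mathbb R$ as $(z,t)$ with $z=(x,y)$, and let $$X=\partial_x+|z|^{2m}y\,\partial_t,\qquad Y=\partial_y-|z|^{2m}x\,\partial_t .$$ Let $d(p,q)$ be the Carnot–Carathéodory distance, i.e. the infimum of $\int_0^1|(\alpha(s),\beta(s))|\,ds$ over all absolutely continuous curves $\gamma:[0,1]\to\mathbb R^3$ from $p$ to $q$ with $\dot\gamma=\alpha X(\gamma)+\beta Y(\gamma)$ a.e. on $[0,1]$; let $B(p,r)=\{q: d(p,q)<r\}$, and let $|\cdot|$ denote Lebesgue measure on $\mathbb R^3$ (when applied to sets). For an open set $A\subset\mathbb R^2$ and $\phi\in C^\infty(A)$, the graph $\{(z,\phi(z)):z\in A\}$ is called $m$-admissible if there is a constant $C>0$ such that for all $z\in A$ $$|D^3\phi(z)|\le C|z|^{2m-1},\qquad |D^2\phi(z)|\le C|z|^{2m},\qquad |D\phi(z)|\le C|z|^{2m+1},$$ where $|D^k\phi(z)|$ is the largest absolute value of a $k$-th order partial derivative of $\phi$ at $z$. Let $\Omega\subset\mathbb R^3$ be an $m$-admissible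 domain, i.e. a bounded nonempty connected open set with $C^\infty$ boundary (locally $\Omega=\{F<0\}$ and $\partial\Omega=\{F=0\}$ with $F\in C^\infty$ and $\nabla F\neq0$) such that every characteristic point $p\in\partial\Omega$ (a point at which both $X$ and $Y$ are tangent to $\partial\Omega$) has a neighborhood $U_p$ in $\mathbb R^3$ for which $\partial\Omega\cap U_p$ is an $m$-admissible graph. Let $N$ be the Euclidean unit normal to $\partial\Omega$ and let $$\mu=\sqrt{\langle N,X\rangle^2+\langle N,Y\rangle^2}\;\mathcal H^2\llcorner\partial\Omega ,$$ where $\mathcal H^2\llcorner\partial\Omega$ is the standard surface measure. Then there exist constants $C>0$ and $r_0>0$ such that for all $p\in\partial\Omega$ and all $0<r\le r_0$ $$C^{-1}\,\frac{|B(p,r)|}{r}\;\le\;\mu(B(p,r))\;\le\; C\,\frac{|B(p,r)|}{r}.$$ -/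

import Mathlib

open Set Filter Topology MeasureTheory
open scoped ENNReal ContDiff

noncomputable section

/-! Points of `ℝ³ = ℂ × ℝ` are `p = (x, y, t)` with `x = p 0`, `y = p 1`, `t = p 2`, and `z = (x, y)`.
Both `ℝ²` and `ℝ³` carry their Euclidean structure. -/

/-- The vector field `X = ∂ₓ + |z|^{2m} y ∂ₜ`, where `|z|^{2m} = (x² + y²)^m`. -/
def fieldX (m : ℕ) (p : EuclideanSpace ℝ (Fin 3)) : EuclideanSpace ℝ (Fin 3) :=
  !₂[1, 0, (p 0 ^ 2 + p 1 ^ 2) ^ m * p 1]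

/-- The vector field `Y = ∂_y - |z|^{2m} x ∂ₜ`. -/
def fieldY (m : ℕ) (p : EuclideanSpace ℝ (Fin 3)) : EuclideanSpace ℝ (Fin 3) :=
  !₂[0, 1, -((p 0 ^ 2 + p 1 ^ 2) ^ m * p 0)]

/-- `γ : [0,1] → ℝ³` is an absolutely continuous horizontal curve from `p` to `q`, with
`γ' = α X(γ) + β Y(γ)` almost everywhere on `[0,1]`. -/
structure IsHorizontalCurve (m : ℕ) (p q : EuclideanSpace ℝ (Fin 3))
    (γ : ℝ → EuclideanSpace ℝ (Fin 3)) (α β : ℝ → ℝ) : Prop where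
  absCont : AbsolutelyContinuousOnInterval γ 0 1
  start : γ 0 = p
  finish : γ 1 = q
  velocity : ∀ᵐ s ∂(volume.restrict (Icc (0 : ℝ) 1)),
    HasDerivAt γ (α s • fieldX m (γ s) + β s • fieldY m (γ s)) s

/-- The Carnot-Carathéodory distance: the infimum of the lengths `∫₀¹ |(α, β)| ds` of the
horizontal curves from `p` to `q` (as an extended nonnegative real). -/
def ccDist (m : ℕ) (p q : EuclideanSpace ℝ (Fin 3)) : ℝ≥0∞ :=
  ⨅ (γ : ℝ → EuclideanSpace ℝ (Fin 3)) (α : ℝ → ℝ) (β : ℝ → ℝ)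
    (_ : IsHorizontalCurve m p q γ α β),
    ∫⁻ s in Icc (0 : ℝ) 1, ENNReal.ofReal (√(α s ^ 2 + β s ^ 2))

/-- The Carnot-Carathéodory ball `B(p, r)`. -/
def ccBall (m : ℕ) (p : EuclideanSpace ℝ (Fin 3)) (r : ℝ) : Set (EuclideanSpace ℝ (Fin 3)) :=
  {q | ccDist m p q < ENNReal.ofReal r}

/-- `F` is a `C^∞` local defining function for `Ω` on the open neighbourhood `U` of the boundary
point `p`: there `Ω = {F < 0}`, `∂Ω = {F = 0}` and `∇F ≠ 0`. -/
structure IsLocalDefiningFunction (Ω : Set (EuclideanSpace ℝ (Fin 3)))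
    (p : EuclideanSpace ℝ (Fin 3)) (U : Set (EuclideanSpace ℝ (Fin 3)))
    (F : EuclideanSpace ℝ (Fin 3) → ℝ) : Prop where
  mem_frontier : p ∈ frontier Ω
  isOpen : IsOpen U
  mem : p ∈ U
  smooth : ContDiffOn ℝ ∞ F U
  gradient_ne_zero : ∀ q ∈ U, gradient F q ≠ 0
  inside : ∀ q ∈ U, (q ∈ Ω ↔ F q < 0)
  boundary : ∀ q ∈ U, (q ∈ frontier Ω ↔ F q = 0)

/-- `Ω` has `C^∞` boundary. -/
def HasSmoothBoundary (Ω : Set (EuclideanSpace ℝ (Fin 3))) : Prop :=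
  ∀ p ∈ frontier Ω, ∃ U F, IsLocalDefiningFunction Ω p U F

/-- `ν` is the outer Euclidean unit normal to `∂Ω` at `p`. -/
def IsOuterUnitNormal (Ω : Set (EuclideanSpace ℝ (Fin 3)))
    (p ν : EuclideanSpace ℝ (Fin 3)) : Prop :=
  ∃ U F, IsLocalDefiningFunction Ω p U F ∧ ν = ‖gradient F p‖⁻¹ • gradient F p

/-- The outer unit normal does not depend on the local defining function. -/
theorem IsOuterUnitNormal.unique {Ω : Set (EuclideanSpace ℝ (Fin 3))}
    {p ν₁ ν₂ : EuclideanSpace ℝ (Fin 3)} (h₁ : IsOuterUnitNormal Ω p ν₁)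
    (h₂ : IsOuterUnitNormal Ω p ν₂) : ν₁ = ν₂ := by
  obtain ⟨U₁, F₁, hF₁, rfl⟩ := h₁
  obtain ⟨U₂, F₂, hF₂, rfl⟩ := h₂
  have key : ∀ {U : Set (EuclideanSpace ℝ (Fin 3))} {F : EuclideanSpace ℝ (Fin 3) → ℝ},
      IsLocalDefiningFunction Ω p U F → ∀ v : EuclideanSpace ℝ (Fin 3),
      HasDerivAt (fun s : ℝ => F (p + s • v)) (inner ℝ (gradient F p) v) 0 := by
    intro U F hF v
    have hd : DifferentiableAt ℝ F p :=
      (hF.smooth.contDiffAt (hF.isOpen.mem_nhds hF.mem)).differentiableAt (by simp)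
    have h1 : HasFDerivAt F (fderiv ℝ F p) (p + (0 : ℝ) • v) := by simpa using hd.hasFDerivAt
    have h2 : HasDerivAt (fun s : ℝ => p + s • v) v 0 := by
      simpa using ((hasDerivAt_id (0 : ℝ)).smul_const v).const_add p
    have h3 := h1.comp_hasDerivAt (0 : ℝ) h2
    have h4 : inner ℝ (gradient F p) v = fderiv ℝ F p v := by
      simp [gradient]
    rw [h4]
    exact h3
  have hne₁ := hF₁.gradient_ne_zero p hF₁.mem
  have hne₂ := hF₂.gradient_ne_zero p hF₂.mem
  have hn₁ : 0 < ‖gradient F₁ p‖ := norm_pos_iff.mpr hne₁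
  have hn₂ : 0 < ‖gradient F₂ p‖ := norm_pos_iff.mpr hne₂
  set ν₁ := ‖gradient F₁ p‖⁻¹ • gradient F₁ p with hν₁
  set ν₂ := ‖gradient F₂ p‖⁻¹ • gradient F₂ p with hν₂
  have hu₁ : ‖ν₁‖ = 1 := by rw [hν₁, norm_smul]; simp [hn₁.ne']
  have hu₂ : ‖ν₂‖ = 1 := by rw [hν₂, norm_smul]; simp [hn₂.ne']
  by_contra hne
  have hlt : inner ℝ ν₁ ν₂ < 1 := (inner_lt_one_iff_real_of_norm_eq_one hu₁ hu₂).mpr hne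
  have e₁ : gradient F₁ p = ‖gradient F₁ p‖ • ν₁ := by
    rw [hν₁, smul_smul, mul_inv_cancel₀ hn₁.ne', one_smul]
  have e₂ : gradient F₂ p = ‖gradient F₂ p‖ • ν₂ := by
    rw [hν₂, smul_smul, mul_inv_cancel₀ hn₂.ne', one_smul]
  have d₁ : inner ℝ (gradient F₁ p) (ν₂ - ν₁) < 0 := by
    rw [e₁, real_inner_smul_left, inner_sub_right, real_inner_self_eq_norm_sq, hu₁]
    nlinarith
  have d₂ : 0 < inner ℝ (gradient F₂ p) (ν₂ - ν₁) := by
    rw [e₂, real_inner_smul_left, inner_sub_right, real_inner_self_eq_norm_sq, hu₂,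
      real_inner_comm]
    nlinarith
  have z₁ : F₁ p = 0 := (hF₁.boundary p hF₁.mem).mp hF₁.mem_frontier
  have z₂ : F₂ p = 0 := (hF₂.boundary p hF₂.mem).mp hF₂.mem_frontier
  have hc : Tendsto (fun s : ℝ => p + s • (ν₂ - ν₁)) (𝓝[>] 0) (𝓝 p) := by
    have : Continuous (fun s : ℝ => p + s • (ν₂ - ν₁)) := by fun_prop
    simpa using (this.tendsto 0).mono_left nhdsWithin_le_nhds
  have w₁ := hc.eventually (hF₁.isOpen.mem_nhds hF₁.mem)
  have w₂ := hc.eventually (hF₂.isOpen.mem_nhds hF₂.mem)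
  have t₁ := ((key hF₁ (ν₂ - ν₁)).tendsto_slope.mono_left
    (nhdsWithin_mono 0 (fun s (hs : 0 < s) => ne_of_gt hs))).eventually (gt_mem_nhds d₁)
  have t₂ := ((key hF₂ (ν₂ - ν₁)).tendsto_slope.mono_left
    (nhdsWithin_mono 0 (fun s (hs : 0 < s) => ne_of_gt hs))).eventually (lt_mem_nhds d₂)
  obtain ⟨s, hs1, hs2, hs3, hs4, hs5⟩ :=
    (w₁.and (w₂.and (t₁.and (t₂.and self_mem_nhdsWithin)))).exists
  have hs : (0 : ℝ) < s := hs5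
  simp only [slope_def_field, zero_smul, add_zero, sub_zero, z₁, z₂] at hs3 hs4
  have n1 : F₁ (p + s • (ν₂ - ν₁)) < 0 := by
    by_contra hcon
    exact absurd hs3 (not_lt.mpr (div_nonneg (not_lt.mp hcon) hs.le))
  have n2 : 0 < F₂ (p + s • (ν₂ - ν₁)) := by
    by_contra hcon
    exact absurd hs4 (not_lt.mpr (div_nonpos_of_nonpos_of_nonneg (not_lt.mp hcon) hs.le))
  have := (hF₂.inside _ hs2).mp ((hF₁.inside _ hs1).mpr n1)
  linarith

open Classical in
/-- The outer Euclidean unit normal `N` to `∂Ω` (with value `0` where there is none). -/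
def unitNormal (Ω : Set (EuclideanSpace ℝ (Fin 3))) (p : EuclideanSpace ℝ (Fin 3)) :
    EuclideanSpace ℝ (Fin 3) :=
  if h : ∃ ν, IsOuterUnitNormal Ω p ν then h.choose else 0

/-- The defining property of `unitNormal`. -/
theorem IsLocalDefiningFunction.unitNormal_eq {Ω U : Set (EuclideanSpace ℝ (Fin 3))}
    {p : EuclideanSpace ℝ (Fin 3)} {F : EuclideanSpace ℝ (Fin 3) → ℝ}
    (h : IsLocalDefiningFunction Ω p U F) :
    unitNormal Ω p = ‖gradient F p‖⁻¹ • gradient F p := by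
  have hν : IsOuterUnitNormal Ω p (‖gradient F p‖⁻¹ • gradient F p) := ⟨U, F, h, rfl⟩
  have hex : ∃ ν, IsOuterUnitNormal Ω p ν := ⟨_, hν⟩
  rw [unitNormal, dif_pos hex]
  exact hex.choose_spec.unique hν

/-- A boundary point at which both `X` and `Y` are tangent to `∂Ω`. -/
def IsCharacteristicPoint (m : ℕ) (Ω : Set (EuclideanSpace ℝ (Fin 3)))
    (p : EuclideanSpace ℝ (Fin 3)) : Prop :=
  p ∈ frontier Ω ∧ inner ℝ (unitNormal Ω p) (fieldX m p) = 0 ∧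
    inner ℝ (unitNormal Ω p) (fieldY m p) = 0

/-- The graph `{(z, φ(z)) : z ∈ A}`. -/
def graphOver (A : Set (EuclideanSpace ℝ (Fin 2))) (φ : EuclideanSpace ℝ (Fin 2) → ℝ) :
    Set (EuclideanSpace ℝ (Fin 3)) :=
  (fun z => !₂[z 0, z 1, φ z]) '' A

/-- `|D^k φ(z)| ≤ M`: all partial derivatives of order `k` of `φ` at `z` are at most `M` in
absolute value. -/
def PartialsBoundedBy (k : ℕ) (φ : EuclideanSpace ℝ (Fin 2) → ℝ) (z : EuclideanSpace ℝ (Fin 2))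
    (M : ℝ) : Prop :=
  ∀ j : Fin k → Fin 2,
    |iteratedFDeriv ℝ k φ z (fun i => EuclideanSpace.single (j i) (1 : ℝ))| ≤ M

/-- `S ⊆ ℝ³` is an `m`-admissible graph (`m ≥ 1`). -/
def IsAdmissibleGraph (m : ℕ) (S : Set (EuclideanSpace ℝ (Fin 3))) : Prop :=
  ∃ (A : Set (EuclideanSpace ℝ (Fin 2))) (φ : EuclideanSpace ℝ (Fin 2) → ℝ),
    IsOpen A ∧ ContDiffOn ℝ ∞ φ A ∧ S = graphOver A φ ∧
    ∃ C : ℝ, 0 < C ∧ ∀ z ∈ A,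
      PartialsBoundedBy 3 φ z (C * ‖z‖ ^ (2 * m - 1)) ∧
      PartialsBoundedBy 2 φ z (C * ‖z‖ ^ (2 * m)) ∧
      PartialsBoundedBy 1 φ z (C * ‖z‖ ^ (2 * m + 1))

/-- `Ω ⊆ ℝ³` is an `m`-admissible domain (`m ≥ 1`): a bounded (nonempty, connected, open) domain
with smooth boundary that is an `m`-admissible graph near each of its characteristic points. -/
structure IsAdmissibleDomain (m : ℕ) (Ω : Set (EuclideanSpace ℝ (Fin 3))) : Prop where
  isOpen : IsOpen Ω
  isConnected : IsConnected Ω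
  isBounded : Bornology.IsBounded Ω
  smoothBoundary : HasSmoothBoundary Ω
  admissible : ∀ p, IsCharacteristicPoint m Ω p →
    ∃ U ∈ 𝓝 p, IsAdmissibleGraph m (frontier Ω ∩ U)

/-- The horizontal perimeter measure `μ = √(⟨N,X⟩² + ⟨N,Y⟩²) H² ⌞ ∂Ω`; `μHE[2]` is the
two-dimensional Hausdorff measure normalized to give surface area. -/
def horizontalPerimeter (m : ℕ) (Ω : Set (EuclideanSpace ℝ (Fin 3))) :
    Measure (EuclideanSpace ℝ (Fin 3)) :=
  ((μHE[2] : Measure (EuclideanSpace ℝ (Fin 3))).restrict (frontier Ω)).withDensity fun p =>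
    ENNReal.ofReal (√(inner ℝ (unitNormal Ω p) (fieldX m p) ^ 2 +
      inner ℝ (unitNormal Ω p) (fieldY m p) ^ 2))

end

/-!
Write `p = (z₀, t₀)` and `R = |z₀|`. The proof replaces both sides by explicit quantities. The
model box of radius `r` at `p` consists of the points within `r` of `p` in the horizontal
coordinates whose height over the plane spanned by `X(p)` and `Y(p)` is at most
`κ = r² (R + r)^{2m}`; its volume is `8 r² κ`.

*Balls and boxes are comparable* (`exists_ccBall_subset_modelBox`,
`exists_modelBox_subset_ccBall`). The height reached by a horizontal curve is the integral along it
of the `1`-form `|z|^{2m} (y dx - x dy)` minus its value frozen at `z₀`, and on the disc of radius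
`r` the two differ by `O(r (R + r)^{2m})`. Conversely a lifted segment followed by a loop around a
polar rectangle reaches any point of a small box, the vertical displacement of such a loop being
linear in its angle. So it has to be shown that `μ` of a box is comparable to `r κ`, locally
uniformly in the boundary point; compactness of `∂Ω` then gives uniform constants.

*Near a non-characteristic point* (`IsTransverse.perimeterEstimateNear`) the density of `μ` is
bounded above and below, and some horizontal direction `α X + β Y` is transverse to `∂Ω`. Projecting
along that direction, frozen at the centre of the box, is bi-Lipschitz on `∂Ω` and carries the part
of `∂Ω` in the box onto a set comparable to a rectangle of sides `r` and `κ`.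

*Near a characteristic point* (`PerimeterEstimateNear.of_isAdmissibleGraph`) `∂Ω` is the graph of
`φ`, and `μ` has density comparable to `|V|` over the plane, with
`V = (φ_x - |z|^{2m} y, φ_y + |z|^{2m} x)`. The bound on `D²φ` makes `V` Lipschitz with constant
`O((R + r)^{2m})` at scale `r`, and the part of the graph in the box lies over the strip
`|V(z₀) · (z - z₀)| ≲ κ` of the disc of radius `r`. If `|V(z₀)| ≥ r (R + r)^{2m}`, then `|V|` is
nearly constant on a smaller disc and the strip has area of order `r κ / |V(z₀)|`. Otherwise the
strip contains a whole disc of comparable radius, the upper bound is immediate, and the lower bound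
comes from the fact that `V` has curl `(2m + 2) |z|^{2m}` for every `φ`: integrating by parts
against a cut-off function bounds the mean of `|V|` from below (`exists_le_lintegral_graph`).

The Hausdorff measure is only ever compared, through Lipschitz maps, with planar Lebesgue measure,
so no area formula is needed.
-/

/-! ### Hausdorff measure and linear boxes -/

theorem LipschitzOnWith.euclideanHausdorffMeasure_image_le {X Y : Type*} [EMetricSpace X]
    [MeasurableSpace X] [BorelSpace X] [EMetricSpace Y] [MeasurableSpace Y] [BorelSpace Y]
    {K : NNReal} {f : X → Y} {s : Set X} (h : LipschitzOnWith K f s) :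
    μHE[2] (f '' s) ≤ (K : ℝ≥0∞) ^ 2 * μHE[2] s := by
  have h1 := h.hausdorffMeasure_image_le (d := 2) (by norm_num)
  simp only [Measure.euclideanHausdorffMeasure_def, Measure.smul_apply, ENNReal.smul_def,
    smul_eq_mul]
  calc _ ≤ _ * ((K : ℝ≥0∞) ^ (2 : ℝ) * μH[2] s) := by
        gcongr
        exact h1
    _ = _ := by
        rw [ENNReal.rpow_ofNat]
        push_cast
        ring

/-- The volume of a parallelotope centred at `z₀`, cut out by linear inequalities. -/
theorem volume_setOf_abs_mulVec_lt {n : ℕ} (M : Matrix (Fin n) (Fin n) ℝ) (hM : M.det ≠ 0)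
    (z₀ : EuclideanSpace ℝ (Fin n)) (a : Fin n → ℝ) (ha : ∀ i, 0 ≤ a i) :
    volume {z : EuclideanSpace ℝ (Fin n) | ∀ i, |M.mulVec (z - z₀).ofLp i| < a i} =
      ENNReal.ofReal (|M.det|⁻¹ * ∏ i, (2 * a i)) := by
  have h0 : {z : EuclideanSpace ℝ (Fin n) | ∀ i, |M.mulVec (z - z₀).ofLp i| < a i} =
      (fun z => z - z₀) ⁻¹' {z : EuclideanSpace ℝ (Fin n) | ∀ i, |M.mulVec z.ofLp i| < a i} := rfl
  have h1 : {z : EuclideanSpace ℝ (Fin n) | ∀ i, |M.mulVec z.ofLp i| < a i} =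
      (fun z : EuclideanSpace ℝ (Fin n) => z.ofLp) ⁻¹'
        ((Matrix.toLin' M) ⁻¹' (Set.pi univ fun i => Ioo (-a i) (a i))) := by
    ext z
    simp [abs_lt, Set.mem_pi]
  have hdet : LinearMap.det (Matrix.toLin' M) ≠ 0 := by simpa using hM
  have hmeas : MeasurableSet (Set.pi univ fun i => Ioo (-a i) (a i)) :=
    MeasurableSet.univ_pi fun i => measurableSet_Ioo
  have hm2 : NullMeasurableSet ((Matrix.toLin' M) ⁻¹' (Set.pi univ fun i => Ioo (-a i) (a i))) :=
    (hmeas.preimage (LinearMap.continuous_of_finiteDimensional _).measurable).nullMeasurableSet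
  rw [h0, (measurePreserving_sub_right volume z₀).measure_preimage (by
      rw [h1]
      exact hm2.preimage (PiLp.volume_preserving_ofLp (Fin n)).quasiMeasurePreserving), h1,
    (PiLp.volume_preserving_ofLp (Fin n)).measure_preimage hm2,
    Measure.addHaar_preimage_linearMap _ hdet, Real.volume_pi_Ioo, LinearMap.det_toLin',
    ← ENNReal.ofReal_prod_of_nonneg (fun i _ => by linarith [ha i]),
    ← ENNReal.ofReal_mul (abs_nonneg _), abs_inv]
  congr 3
  ext i
  ring

/-- The area of the rectangle with half-widths `a / |v|`, `b / |v|` in the directions of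
`v = (v₀, v₁)` and of `(-v₁, v₀)`. -/
theorem volume_rotated_rectangle (v₀ v₁ : ℝ) (hv : 0 < v₀ ^ 2 + v₁ ^ 2)
    (z₀ : EuclideanSpace ℝ (Fin 2)) {a b : ℝ} (ha : 0 ≤ a) (hb : 0 ≤ b) :
    volume {z : EuclideanSpace ℝ (Fin 2) |
        |v₀ * (z 0 - z₀ 0) + v₁ * (z 1 - z₀ 1)| < a ∧
        |-v₁ * (z 0 - z₀ 0) + v₀ * (z 1 - z₀ 1)| < b} =
      ENNReal.ofReal (4 * a * b / (v₀ ^ 2 + v₁ ^ 2)) := by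
  have hdet : (!![v₀, v₁; -v₁, v₀] : Matrix (Fin 2) (Fin 2) ℝ).det = v₀ ^ 2 + v₁ ^ 2 := by
    rw [Matrix.det_fin_two_of]
    ring
  have h := volume_setOf_abs_mulVec_lt !![v₀, v₁; -v₁, v₀] (by rw [hdet]; exact hv.ne') z₀
    ![a, b] (by intro i; fin_cases i <;> simpa)
  rw [hdet] at h
  simp only [Fin.forall_fin_two, Matrix.mulVec, dotProduct, Fin.sum_univ_two, Fin.prod_univ_two,
    Matrix.of_apply, Matrix.cons_val', Matrix.cons_val_zero, Matrix.cons_val_one,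
    Matrix.cons_val_fin_one, PiLp.sub_apply, abs_of_pos hv] at h
  rw [h]
  congr 1
  field_simp
  ring

theorem volume_rectangle (z₀ : EuclideanSpace ℝ (Fin 2)) {a b : ℝ} (ha : 0 ≤ a) (hb : 0 ≤ b) :
    volume {z : EuclideanSpace ℝ (Fin 2) | |z 0 - z₀ 0| < a ∧ |z 1 - z₀ 1| < b} =
      ENNReal.ofReal (4 * a * b) := by
  simpa using volume_rotated_rectangle 1 0 (by norm_num) z₀ ha hb

/-! ### Model boxes -/

/-- The distance `|z|` of `p = (z, t)` to the `t`-axis. -/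
noncomputable def axisDist (p : EuclideanSpace ℝ (Fin 3)) : ℝ := √(p 0 ^ 2 + p 1 ^ 2)

/-- The height of `q` above the plane through `p` spanned by `X(p)` and `Y(p)`. -/
noncomputable def heightAbove (m : ℕ) (p q : EuclideanSpace ℝ (Fin 3)) : ℝ :=
  q 2 - p 2 - (p 0 ^ 2 + p 1 ^ 2) ^ m * (p 1 * (q 0 - p 0) - p 0 * (q 1 - p 1))

/-- The half-height `r² (|z| + r)^{2m}` of the model box of radius `r` at `p = (z, t)`. -/
noncomputable def boxHeight (m : ℕ) (p : EuclideanSpace ℝ (Fin 3)) (r : ℝ) : ℝ :=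
  r ^ 2 * (axisDist p + r) ^ (2 * m)

/-- The model box of radius `r` at `p`, comparable to the Carnot-Carathéodory ball. -/
def modelBox (m : ℕ) (p : EuclideanSpace ℝ (Fin 3)) (r : ℝ) : Set (EuclideanSpace ℝ (Fin 3)) :=
  {q | |q 0 - p 0| < r ∧ |q 1 - p 1| < r ∧ |heightAbove m p q| < boxHeight m p r}

theorem axisDist_nonneg (p : EuclideanSpace ℝ (Fin 3)) : 0 ≤ axisDist p := Real.sqrt_nonneg _

theorem axisDist_sq (p : EuclideanSpace ℝ (Fin 3)) : axisDist p ^ 2 = p 0 ^ 2 + p 1 ^ 2 :=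
  Real.sq_sqrt (by positivity)

theorem boxHeight_pos (m : ℕ) (p : EuclideanSpace ℝ (Fin 3)) {r : ℝ} (hr : 0 < r) :
    0 < boxHeight m p r := by
  have := axisDist_nonneg p
  unfold boxHeight
  positivity

theorem boxHeight_mono (m : ℕ) (p : EuclideanSpace ℝ (Fin 3)) {r s : ℝ} (hr : 0 < r)
    (hrs : r ≤ s) : boxHeight m p r ≤ boxHeight m p s := by
  have := axisDist_nonneg p
  unfold boxHeight
  gcongr

theorem volume_modelBox (m : ℕ) (p : EuclideanSpace ℝ (Fin 3)) {r : ℝ} (hr : 0 < r) :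
    volume (modelBox m p r) = ENNReal.ofReal (8 * r ^ 2 * boxHeight m p r) := by
  set l := (p 0 ^ 2 + p 1 ^ 2) ^ m with hl
  have hdet : (!![1, 0, 0; 0, 1, 0; -(l * p 1), l * p 0, 1] : Matrix (Fin 3) (Fin 3) ℝ).det = 1 := by
    simp [Matrix.det_fin_three]
  have h := volume_setOf_abs_mulVec_lt !![1, 0, 0; 0, 1, 0; -(l * p 1), l * p 0, 1]
    (by rw [hdet]; exact one_ne_zero) p ![r, r, boxHeight m p r]
    (by
      have := (boxHeight_pos m p hr).le
      intro i
      fin_cases i <;> simp [hr.le, this])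
  rw [hdet] at h
  convert h using 2
  · ext q
    simp [modelBox, heightAbove, Fin.forall_fin_succ, Matrix.mulVec, dotProduct, Fin.sum_univ_succ,
      ← hl]
    intro _ _
    have : q 2 - p 2 - l * (p 1 * (q 0 - p 0) - p 0 * (q 1 - p 1)) =
      -(l * p 1 * (q 0 - p 0)) + (l * p 0 * (q 1 - p 1) + (q 2 - p 2)) := by ring
    rw [this]
  · simp [Fin.prod_univ_succ]
    ring

/-- The coefficients `|z|^{2m} y`, `|z|^{2m} x` vary by `O(r (|z₀| + r)^{2m})` on the square of
half-width `r` at `z₀`. -/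
theorem abs_pow_mul_sub_pow_mul_le (m : ℕ) {R r a a₀ b b₀ : ℝ} (hr : 0 ≤ r) (hR : 0 ≤ R)
    (ha₀ : 0 ≤ a₀) (ha : 0 ≤ a) (h0 : a₀ ≤ R ^ 2)
    (h2 : |a - a₀| ≤ 4 * r * (R + 2 * r)) (h3 : |b - b₀| ≤ r) (h4 : |b₀| ≤ R)
    (h5 : a ≤ (R + 2 * r) ^ 2) :
    |a ^ m * b - a₀ ^ m * b₀| ≤ (4 * m + 1) * 4 ^ m * r * (R + r) ^ (2 * m) := by
  set ρ := R + 2 * r with hρ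
  have hρ0 : 0 ≤ ρ := by positivity
  have hle : a₀ ≤ ρ ^ 2 := h0.trans (by gcongr; linarith)
  have e1 : a ^ m * b - a₀ ^ m * b₀ = a ^ m * (b - b₀) + (a ^ m - a₀ ^ m) * b₀ := by ring
  have k1 : a ^ m ≤ ρ ^ (2 * m) := by
    rw [pow_mul]
    gcongr
  have k2 : |a ^ m - a₀ ^ m| * |b₀| ≤ 4 * m * r * ρ ^ (2 * m) := by
    rcases Nat.eq_zero_or_pos m with rfl | hm
    · simp
    · have := abs_pow_sub_pow_le a a₀ m
      have hmax : max |a| |a₀| ≤ ρ ^ 2 := by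
        rw [abs_of_nonneg ha, abs_of_nonneg ha₀]
        exact max_le h5 hle
      calc |a ^ m - a₀ ^ m| * |b₀| ≤ (|a - a₀| * m * max |a| |a₀| ^ (m - 1)) * |b₀| := by gcongr
        _ ≤ (4 * r * ρ * m * (ρ ^ 2) ^ (m - 1)) * ρ := by
            gcongr
            linarith
        _ = 4 * m * r * ((ρ ^ 2) ^ (m - 1) * ρ ^ 2) := by ring
        _ = 4 * m * r * ρ ^ (2 * m) := by
            rw [← pow_succ, Nat.sub_add_cancel hm, pow_mul]
  have k3 : ρ ^ (2 * m) ≤ 4 ^ m * (R + r) ^ (2 * m) := by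
    calc ρ ^ (2 * m) ≤ (2 * (R + r)) ^ (2 * m) := by
          gcongr
          linarith
      _ = 4 ^ m * (R + r) ^ (2 * m) := by
          rw [mul_pow, pow_mul 2 2 m]
          norm_num
  calc |a ^ m * b - a₀ ^ m * b₀| ≤ |a ^ m * (b - b₀)| + |(a ^ m - a₀ ^ m) * b₀| := by
        rw [e1]
        exact abs_add_le _ _
    _ = a ^ m * |b - b₀| + |a ^ m - a₀ ^ m| * |b₀| := by
        rw [abs_mul, abs_mul, abs_of_nonneg (pow_nonneg ha m)]
    _ ≤ ρ ^ (2 * m) * r + 4 * m * r * ρ ^ (2 * m) := by gcongr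
    _ = (4 * m + 1) * r * ρ ^ (2 * m) := by ring
    _ ≤ (4 * m + 1) * r * (4 ^ m * (R + r) ^ (2 * m)) := by gcongr
    _ = _ := by ring

theorem abs_sq_add_sq_sub_le {x y x₀ y₀ r R : ℝ} (hr : 0 ≤ r) (hR : 0 ≤ R)
    (h : x₀ ^ 2 + y₀ ^ 2 = R ^ 2) (hx : |x - x₀| ≤ r) (hy : |y - y₀| ≤ r) :
    |x₀| ≤ R ∧ |y₀| ≤ R ∧ |x ^ 2 + y ^ 2 - (x₀ ^ 2 + y₀ ^ 2)| ≤ 4 * r * (R + 2 * r) ∧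
      x ^ 2 + y ^ 2 ≤ (R + 2 * r) ^ 2 := by
  have h1 : |x₀| ≤ R := abs_le_of_sq_le_sq (by nlinarith [sq_nonneg y₀]) hR
  have h2 : |y₀| ≤ R := abs_le_of_sq_le_sq (by nlinarith [sq_nonneg x₀]) hR
  rw [abs_le] at hx hy
  have h1' := abs_le.1 h1
  have h2' := abs_le.1 h2
  have e : x ^ 2 + y ^ 2 - (x₀ ^ 2 + y₀ ^ 2) = (x - x₀) * (x + x₀) + (y - y₀) * (y + y₀) := by ring
  have b1 : |(x - x₀) * (x + x₀)| ≤ r * (2 * R + r) := by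
    rw [abs_mul]
    gcongr <;> rw [abs_le] <;> constructor <;> linarith
  have b2 : |(y - y₀) * (y + y₀)| ≤ r * (2 * R + r) := by
    rw [abs_mul]
    gcongr <;> rw [abs_le] <;> constructor <;> linarith
  rw [abs_le] at b1 b2
  have h3 := mul_nonneg hr hr
  refine ⟨h1, h2, ?_, ?_⟩
  · rw [e, abs_le]
    constructor <;> nlinarith
  · nlinarith [mul_nonneg hr hR]

/-! ### Carnot-Carathéodory balls lie in model boxes -/

theorem AbsolutelyContinuousOnInterval.euclideanSpace_apply {n : ℕ}
    {γ : ℝ → EuclideanSpace ℝ (Fin n)} {a b : ℝ} (h : AbsolutelyContinuousOnInterval γ a b)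
    (i : Fin n) : AbsolutelyContinuousOnInterval (fun s => γ s i) a b := by
  apply squeeze_zero (fun t ↦ ?_) (fun t ↦ ?_) h
  · exact Finset.sum_nonneg (fun i hi ↦ by positivity)
  · refine Finset.sum_le_sum fun k _ => ?_
    simp only [dist_eq_norm]
    exact PiLp.norm_apply_le (γ (t.2 k).1 - γ (t.2 k).2) i

/-- A horizontal curve of length less than `r` ends within `r` of its start in the horizontal
coordinates. Its final height over the horizontal plane at `p` is `∫ α (a - a(p)) - β (b - b(p))`
with `a = |z|^{2m} y`, `b = |z|^{2m} x`, which the length times the oscillation of `a` and `b` controls. -/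
theorem IsHorizontalCurve.endpoint_bounds {m : ℕ} {p q : EuclideanSpace ℝ (Fin 3)}
    {γ : ℝ → EuclideanSpace ℝ (Fin 3)} {α β : ℝ → ℝ} (h : IsHorizontalCurve m p q γ α β)
    {r : ℝ}
    (hlen : ∫⁻ s in Icc (0 : ℝ) 1, ENNReal.ofReal (√(α s ^ 2 + β s ^ 2)) < ENNReal.ofReal r) :
    |q 0 - p 0| < r ∧ |q 1 - p 1| < r ∧
      |heightAbove m p q| ≤ 2 * ((4 * m + 1) * 4 ^ m) * boxHeight m p r := by
  have hr : 0 < r := by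
    by_contra hcon
    rw [ENNReal.ofReal_of_nonpos (not_lt.1 hcon)] at hlen
    exact absurd hlen not_lt_zero
  have ax := h.absCont.euclideanSpace_apply 0
  have ay := h.absCont.euclideanSpace_apply 1
  have at' := h.absCont.euclideanSpace_apply 2
  set x := fun s => γ s 0 with hx
  set y := fun s => γ s 1 with hy
  set t := fun s => γ s 2 with ht
  have hder : ∀ᵐ s ∂(volume.restrict (Icc (0 : ℝ) 1)), deriv x s = α s ∧ deriv y s = β s ∧
      deriv t s = deriv x s * ((x s ^ 2 + y s ^ 2) ^ m * y s) -
        deriv y s * ((x s ^ 2 + y s ^ 2) ^ m * x s) := by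
    filter_upwards [h.velocity] with s hs
    have hc : ∀ i, HasDerivAt (fun s => γ s i)
        ((α s • fieldX m (γ s) + β s • fieldY m (γ s)) i) s := fun i =>
      ((EuclideanSpace.proj i : EuclideanSpace ℝ (Fin 3) →L[ℝ] ℝ).hasFDerivAt.comp_hasDerivAt s hs)
    have h0 := (hc 0).deriv
    have h1 := (hc 1).deriv
    have h2 := (hc 2).deriv
    simp [fieldX, fieldY] at h0 h1 h2
    refine ⟨h0, h1, ?_⟩
    rw [show deriv x s = α s from h0, show deriv y s = β s from h1, show deriv t s = _ from h2]
    ring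
  set g := fun s => √(deriv x s ^ 2 + deriv y s ^ 2) with hg
  have ix : IntegrableOn (deriv x) (Icc 0 1) := by
    rw [integrableOn_Icc_iff_integrableOn_Ioc]
    exact (intervalIntegrable_iff_integrableOn_Ioc_of_le zero_le_one).1 ax.intervalIntegrable_deriv
  have iy : IntegrableOn (deriv y) (Icc 0 1) := by
    rw [integrableOn_Icc_iff_integrableOn_Ioc]
    exact (intervalIntegrable_iff_integrableOn_Ioc_of_le zero_le_one).1 ay.intervalIntegrable_deriv
  have hgx : ∀ s, |deriv x s| ≤ g s := fun s => Real.abs_le_sqrt (by nlinarith [sq_nonneg (deriv y s)])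
  have hgy : ∀ s, |deriv y s| ≤ g s := fun s => Real.abs_le_sqrt (by nlinarith [sq_nonneg (deriv x s)])
  have hg0 : ∀ s, 0 ≤ g s := fun s => Real.sqrt_nonneg _
  have ig : IntegrableOn g (Icc 0 1) := by
    refine Integrable.mono' (ix.abs.add iy.abs) ?_ ?_
    · exact (((measurable_deriv x).pow_const 2).add
        ((measurable_deriv y).pow_const 2)).sqrt.aestronglyMeasurable
    · refine Eventually.of_forall fun s => ?_
      rw [Real.norm_of_nonneg (hg0 s)]
      refine Real.sqrt_le_iff.2 ⟨by simp only [Pi.add_apply]; positivity, ?_⟩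
      simp only [Pi.add_apply]
      nlinarith [sq_abs (deriv x s), sq_abs (deriv y s), abs_nonneg (deriv x s),
        abs_nonneg (deriv y s), mul_nonneg (abs_nonneg (deriv x s)) (abs_nonneg (deriv y s))]
  have hint : ∫ s in Icc (0 : ℝ) 1, g s < r := by
    rw [← ENNReal.ofReal_lt_ofReal_iff hr,
      ofReal_integral_eq_lintegral_ofReal ig (Eventually.of_forall hg0)]
    refine lt_of_eq_of_lt (lintegral_congr_ae ?_) hlen
    filter_upwards [hder] with s hs
    simp only [hg]
    rw [hs.1, hs.2.1]
  have bound : ∀ (f : ℝ → ℝ), AbsolutelyContinuousOnInterval f 0 1 → (∀ s, |deriv f s| ≤ g s) →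
      ∀ s ∈ Icc (0 : ℝ) 1, |f s - f 0| < r := by
    intro f hf hfg s hs
    have hf' : AbsolutelyContinuousOnInterval f 0 s := hf.mono (by
      rw [uIcc_of_le hs.1, uIcc_of_le zero_le_one]
      exact Icc_subset_Icc_right hs.2)
    rw [← hf'.integral_deriv_eq_sub, intervalIntegral.integral_of_le hs.1]
    refine lt_of_le_of_lt ?_ hint
    rw [← Real.norm_eq_abs]
    have hsub : Ioc 0 s ⊆ Icc (0 : ℝ) 1 := fun u hu => ⟨hu.1.le, hu.2.trans hs.2⟩
    refine (norm_integral_le_of_norm_le (ig.mono_set hsub)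
      (Eventually.of_forall fun u => hfg u)).trans ?_
    exact setIntegral_mono_set ig (Eventually.of_forall hg0) hsub.eventuallyLE
  have bx := bound x ax hgx
  have bY := bound y ay hgy
  have x0 : x 0 = p 0 := by simp [hx, h.start]
  have y0 : y 0 = p 1 := by simp [hy, h.start]
  have t0 : t 0 = p 2 := by simp [ht, h.start]
  have x1 : x 1 = q 0 := by simp [hx, h.finish]
  have y1 : y 1 = q 1 := by simp [hy, h.finish]
  have t1 : t 1 = q 2 := by simp [ht, h.finish]
  refine ⟨by simpa [x0, x1] using bx 1 (by simp), by simpa [y0, y1] using bY 1 (by simp), ?_⟩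
  set l := (p 0 ^ 2 + p 1 ^ 2) ^ m with hl
  set K : ℝ := (4 * m + 1) * 4 ^ m with hK
  have hR := axisDist_nonneg p
  have hK0 : 0 ≤ K * r * (axisDist p + r) ^ (2 * m) := by positivity
  have e1 : heightAbove m p q = ∫ s in (0 : ℝ)..1,
      (deriv t s - (l * p 1 * deriv x s - l * p 0 * deriv y s)) := by
    have jx := ax.intervalIntegrable_deriv
    have jy := ay.intervalIntegrable_deriv
    rw [intervalIntegral.integral_sub at'.intervalIntegrable_deriv
        ((jx.const_mul _).sub (jy.const_mul _)),
      intervalIntegral.integral_sub (jx.const_mul _) (jy.const_mul _),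
      intervalIntegral.integral_const_mul, intervalIntegral.integral_const_mul,
      ax.integral_deriv_eq_sub, ay.integral_deriv_eq_sub, at'.integral_deriv_eq_sub,
      x0, x1, y0, y1, t0, t1, heightAbove]
    ring
  have e2 : |heightAbove m p q| ≤ ∫ s in (0 : ℝ)..1,
      2 * (K * r * (axisDist p + r) ^ (2 * m)) * g s := by
    rw [e1, ← Real.norm_eq_abs]
    refine intervalIntegral.norm_integral_le_of_norm_le zero_le_one ?_ ?_
    · have := (ae_restrict_iff' measurableSet_Icc).1 hder
      filter_upwards [this] with s hs hs'
      have hsI : s ∈ Icc (0 : ℝ) 1 := ⟨hs'.1.le, hs'.2⟩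
      obtain ⟨-, -, ht'⟩ := hs hsI
      have b1 := (bx s hsI).le
      have b2 := (bY s hsI).le
      rw [x0] at b1
      rw [y0] at b2
      obtain ⟨c1, c2, c3, c4⟩ := abs_sq_add_sq_sub_le hr.le hR (axisDist_sq p).symm b1 b2
      have d1 := abs_pow_mul_sub_pow_mul_le m hr.le hR (by positivity) (by positivity)
        (axisDist_sq p).ge c3 b2 c2 c4
      have d2 := abs_pow_mul_sub_pow_mul_le m hr.le hR (by positivity) (by positivity)
        (axisDist_sq p).ge c3 b1 c1 c4
      rw [ht', Real.norm_eq_abs]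
      have e3 : deriv x s * ((x s ^ 2 + y s ^ 2) ^ m * y s) -
          deriv y s * ((x s ^ 2 + y s ^ 2) ^ m * x s) -
          (l * p 1 * deriv x s - l * p 0 * deriv y s) =
          deriv x s * ((x s ^ 2 + y s ^ 2) ^ m * y s - l * p 1) -
          deriv y s * ((x s ^ 2 + y s ^ 2) ^ m * x s - l * p 0) := by ring
      rw [e3]
      refine (abs_sub _ _).trans ?_
      rw [abs_mul, abs_mul]
      have f1 := mul_le_mul (hgx s) d1 (abs_nonneg _) (hg0 s)
      have f2 := mul_le_mul (hgy s) d2 (abs_nonneg _) (hg0 s)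
      linarith
    · exact ((intervalIntegrable_iff_integrableOn_Icc_of_le zero_le_one).2 ig).const_mul _
  refine e2.trans ?_
  rw [intervalIntegral.integral_const_mul, intervalIntegral.integral_of_le zero_le_one,
    ← integral_Icc_eq_integral_Ioc, boxHeight]
  calc _ ≤ 2 * (K * r * (axisDist p + r) ^ (2 * m)) * r := by gcongr
    _ = _ := by ring

theorem exists_ccBall_subset_modelBox (m : ℕ) : ∃ C : ℝ, 1 ≤ C ∧ ∀ p r, 0 < r →
    ccBall m p r ⊆ modelBox m p (C * r) := by
  set K : ℝ := 2 * ((4 * m + 1) * 4 ^ m) with hK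
  have hK0 : 0 ≤ K := by positivity
  refine ⟨K + 1, by linarith, fun p r hr q hq => ?_⟩
  simp only [ccBall, ccDist, mem_ofPred_eq, iInf_lt_iff] at hq
  obtain ⟨γ, α, β, hγ, hlen⟩ := hq
  obtain ⟨h1, h2, h3⟩ := hγ.endpoint_bounds hlen
  have hCr : r ≤ (K + 1) * r := by nlinarith
  refine ⟨h1.trans_le hCr, h2.trans_le hCr, h3.trans_lt ?_⟩
  have hR := axisDist_nonneg p
  have hpos := boxHeight_pos m p hr
  calc K * boxHeight m p r < (K + 1) ^ 2 * boxHeight m p r := by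
        gcongr
        nlinarith
    _ = ((K + 1) * r) ^ 2 * (axisDist p + r) ^ (2 * m) := by
        rw [boxHeight]
        ring
    _ ≤ _ := by
        rw [boxHeight]
        gcongr

/-! ### Model boxes lie in Carnot-Carathéodory balls -/

/-- `q` is joined to `p` by a Lipschitz horizontal curve on `[0, 1]` whose horizontal speed is at
most `ℓ` off a countable set. -/
def HorizontallyReachable (m : ℕ) (p q : EuclideanSpace ℝ (Fin 3)) (ℓ : ℝ) : Prop :=
  ∃ (γ : ℝ → EuclideanSpace ℝ (Fin 3)) (α β : ℝ → ℝ) (N : Set ℝ) (K : NNReal),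
    LipschitzOnWith K γ (Icc 0 1) ∧ γ 0 = p ∧ γ 1 = q ∧ N.Countable ∧
    ∀ s ∈ Icc (0 : ℝ) 1 \ N, HasDerivAt γ (α s • fieldX m (γ s) + β s • fieldY m (γ s)) s ∧
      √(α s ^ 2 + β s ^ 2) ≤ ℓ

theorem HorizontallyReachable.mono {m : ℕ} {p q : EuclideanSpace ℝ (Fin 3)} {ℓ ℓ' : ℝ}
    (h : HorizontallyReachable m p q ℓ) (hl : ℓ ≤ ℓ') : HorizontallyReachable m p q ℓ' := by
  obtain ⟨γ, α, β, N, K, h1, h2, h3, h4, h5⟩ := h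
  exact ⟨γ, α, β, N, K, h1, h2, h3, h4, fun s hs => ⟨(h5 s hs).1, (h5 s hs).2.trans hl⟩⟩

theorem HorizontallyReachable.ccDist_le {m : ℕ} {p q : EuclideanSpace ℝ (Fin 3)} {ℓ : ℝ}
    (h : HorizontallyReachable m p q ℓ) : ccDist m p q ≤ ENNReal.ofReal ℓ := by
  obtain ⟨γ, α, β, N, K, h1, h2, h3, h4, h5⟩ := h
  have hae : ∀ᵐ s ∂(volume.restrict (Icc (0 : ℝ) 1)), s ∈ Icc (0 : ℝ) 1 \ N := by
    filter_upwards [ae_restrict_mem measurableSet_Icc,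
      ae_restrict_of_ae (h4.ae_notMem volume)] with s hs hs' using ⟨hs, hs'⟩
  have hγ : IsHorizontalCurve m p q γ α β :=
    ⟨LipschitzOnWith.absolutelyContinuousOnInterval (K := K) (by
      rwa [uIcc_of_le zero_le_one]), h2, h3, hae.mono fun s hs => (h5 s hs).1⟩
  unfold ccDist
  refine iInf_le_of_le γ <| iInf_le_of_le α <| iInf_le_of_le β <| iInf_le_of_le hγ ?_
  calc ∫⁻ s in Icc (0 : ℝ) 1, ENNReal.ofReal (√(α s ^ 2 + β s ^ 2))
      ≤ ∫⁻ s in Icc (0 : ℝ) 1, ENNReal.ofReal ℓ :=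
        lintegral_mono_ae (hae.mono fun s hs => ENNReal.ofReal_le_ofReal (h5 s hs).2)
    _ = ENNReal.ofReal ℓ := by simp

/-- Two curves on `[0, 1]` run through one after the other. -/
theorem LipschitzOnWith.ite_half {E : Type*} [PseudoMetricSpace E] {f g : ℝ → E} {K : NNReal}
    (hf : LipschitzOnWith K f (Icc 0 1)) (hg : LipschitzOnWith K g (Icc 0 1)) (h : f 1 = g 0) :
    LipschitzOnWith (2 * K) (fun s => if s ≤ 1 / 2 then f (2 * s) else g (2 * s - 1))
      (Icc 0 1) := by
  rw [lipschitzOnWith_iff_dist_le_mul] at *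
  have key : ∀ s ∈ Icc (0 : ℝ) 1, ∀ u ∈ Icc (0 : ℝ) 1, s ≤ u →
      dist (if s ≤ 1 / 2 then f (2 * s) else g (2 * s - 1))
        (if u ≤ 1 / 2 then f (2 * u) else g (2 * u - 1)) ≤ K * (2 * (u - s)) := by
    intro s hs u hu hsu
    by_cases h1 : s ≤ 1 / 2 <;> by_cases h2 : u ≤ 1 / 2 <;> simp only [h1, h2, if_true, if_false]
    · refine (hf _ ⟨by linarith [hs.1], by linarith⟩ _ ⟨by linarith [hu.1], by linarith⟩).trans
        (le_of_eq ?_)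
      rw [dist_comm, Real.dist_eq, abs_of_nonneg (by linarith)]
      ring
    · refine (dist_triangle _ (f 1) _).trans ?_
      have k1 := hf (2 * s) ⟨by linarith [hs.1], by linarith⟩ 1 ⟨zero_le_one, le_rfl⟩
      have k2 := hg 0 ⟨le_rfl, zero_le_one⟩ (2 * u - 1) ⟨by linarith, by linarith [hu.2]⟩
      rw [dist_comm (2 * s), Real.dist_eq, abs_of_nonneg (by linarith)] at k1
      rw [dist_comm (0 : ℝ), Real.dist_eq, abs_of_nonneg (by linarith), ← h] at k2
      linarith
    · linarith
    · refine (hg _ ⟨by linarith, by linarith [hs.2]⟩ _ ⟨by linarith, by linarith [hu.2]⟩).trans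
        (le_of_eq ?_)
      rw [dist_comm, Real.dist_eq, abs_of_nonneg (by linarith)]
      ring
  intro s hs u hu
  push_cast
  rcases le_total s u with hsu | hsu
  · refine (key s hs u hu hsu).trans (le_of_eq ?_)
    rw [dist_comm, Real.dist_eq, abs_of_nonneg (by linarith)]
    ring
  · rw [dist_comm]
    refine (key u hu s hs hsu).trans (le_of_eq ?_)
    rw [Real.dist_eq, abs_of_nonneg (by linarith)]
    ring

/-- Concatenation of curves, each run through at double speed. -/
theorem HorizontallyReachable.trans {m : ℕ} {p q q' : EuclideanSpace ℝ (Fin 3)} {ℓ : ℝ}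
    (h : HorizontallyReachable m p q ℓ) (h' : HorizontallyReachable m q q' ℓ) :
    HorizontallyReachable m p q' (2 * ℓ) := by
  obtain ⟨γ, α, β, N, K, h1, h2, h3, h4, h5⟩ := h
  obtain ⟨γ', α', β', N', K', h1', h2', h3', h4', h5'⟩ := h'
  refine ⟨fun s => if s ≤ 1 / 2 then γ (2 * s) else γ' (2 * s - 1),
    fun s => if s ≤ 1 / 2 then 2 * α (2 * s) else 2 * α' (2 * s - 1),
    fun s => if s ≤ 1 / 2 then 2 * β (2 * s) else 2 * β' (2 * s - 1),
    {1 / 2} ∪ ((fun s : ℝ => 2 * s) ⁻¹' N ∪ (fun s : ℝ => 2 * s - 1) ⁻¹' N'), 2 * max K K',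
    (h1.weaken (le_max_left _ _)).ite_half (h1'.weaken (le_max_right _ _)) (by rw [h3, h2']),
    by simp [h2], by norm_num [h3'],
    (countable_singleton _).union ((h4.preimage fun a b hab => by simpa using hab).union
      (h4'.preimage fun a b hab => by simpa using hab)), ?_⟩
  rintro s ⟨⟨hs0, hs1⟩, hs⟩
  simp only [mem_union, mem_singleton_iff, mem_preimage, not_or] at hs
  obtain ⟨hne, hN, hN'⟩ := hs
  have hsqrt : ∀ a b : ℝ, √((2 * a) ^ 2 + (2 * b) ^ 2) = 2 * √(a ^ 2 + b ^ 2) := by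
    intro a b
    rw [show (2 * a) ^ 2 + (2 * b) ^ 2 = 2 ^ 2 * (a ^ 2 + b ^ 2) by ring,
      Real.sqrt_mul (by norm_num), Real.sqrt_sq (by norm_num)]
  rcases lt_or_gt_of_ne hne with hlt | hgt
  · obtain ⟨k1, k2⟩ := h5 (2 * s) ⟨⟨by linarith, by linarith⟩, hN⟩
    simp only [hlt.le, if_true, hsqrt]
    refine ⟨?_, by linarith⟩
    have hd : HasDerivAt (fun s : ℝ => 2 * s) 2 s := by simpa using (hasDerivAt_id s).const_mul 2
    have := k1.scomp s hd
    refine (this.congr_of_eventuallyEq ?_).congr_deriv ?_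
    · filter_upwards [gt_mem_nhds hlt] with u hu
      simp only [hu.le, if_true, Function.comp]
    · simp only [smul_add, smul_smul]
  · obtain ⟨k1, k2⟩ := h5' (2 * s - 1) ⟨⟨by linarith, by linarith⟩, hN'⟩
    simp only [not_le.2 hgt, if_false, hsqrt]
    refine ⟨?_, by linarith⟩
    have hd : HasDerivAt (fun s : ℝ => 2 * s - 1) 2 s := by
      simpa using ((hasDerivAt_id s).const_mul 2).sub_const 1
    have := k1.scomp s hd
    refine (this.congr_of_eventuallyEq ?_).congr_deriv ?_
    · filter_upwards [lt_mem_nhds hgt] with u hu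
      simp only [not_le.2 hu, if_false, Function.comp]
    · simp only [smul_add, smul_smul]

/-- The horizontal lift of a `C¹` plane curve. -/
theorem horizontallyReachable_lift (m : ℕ) {x y a b : ℝ → ℝ} (hx : ∀ s, HasDerivAt x (a s) s)
    (hy : ∀ s, HasDerivAt y (b s) s) (ha : Continuous a) (hb : Continuous b) (t₀ : ℝ) {ℓ : ℝ}
    (hl : ∀ s ∈ Icc (0 : ℝ) 1, √(a s ^ 2 + b s ^ 2) ≤ ℓ) :
    HorizontallyReachable m !₂[x 0, y 0, t₀]
      !₂[x 1, y 1, t₀ + ∫ s in (0 : ℝ)..1, (x s ^ 2 + y s ^ 2) ^ m * (y s * a s - x s * b s)]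
      ℓ := by
  have cx : Continuous x := continuous_iff_continuousAt.2 fun s => (hx s).continuousAt
  have cy : Continuous y := continuous_iff_continuousAt.2 fun s => (hy s).continuousAt
  set c : ℝ → ℝ := fun s => (x s ^ 2 + y s ^ 2) ^ m * (y s * a s - x s * b s) with hc
  have cc : Continuous c := by fun_prop
  set t : ℝ → ℝ := fun s => t₀ + ∫ u in (0 : ℝ)..s, c u with ht
  have hd : ∀ s, HasDerivAt t (c s) s := fun s =>
    (intervalIntegral.integral_hasDerivAt_right (cc.intervalIntegrable _ _)
      cc.stronglyMeasurable.stronglyMeasurableAtFilter cc.continuousAt).const_add t₀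
  set γ : ℝ → EuclideanSpace ℝ (Fin 3) := fun s => !₂[x s, y s, t s] with hγ
  have hγd : ∀ s, HasDerivAt γ (!₂[a s, b s, c s]) s := by
    intro s
    have : HasDerivAt (fun s => (![x s, y s, t s] : Fin 3 → ℝ)) ![a s, b s, c s] s := by
      rw [hasDerivAt_pi]
      intro i
      fin_cases i
      · exact hx s
      · exact hy s
      · exact hd s
    exact (PiLp.continuousLinearEquiv 2 ℝ
      (fun _ : Fin 3 => ℝ)).symm.toContinuousLinearMap.hasFDerivAt.comp_hasDerivAt s this
  have hγc : Continuous fun s => (!₂[a s, b s, c s] : EuclideanSpace ℝ (Fin 3)) := by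
    refine (PiLp.continuous_toLp 2 (fun _ : Fin 3 => ℝ)).comp (continuous_pi fun i => ?_)
    fin_cases i
    · exact ha
    · exact hb
    · exact cc
  obtain ⟨B, hB⟩ := isCompact_Icc.exists_bound_of_continuousOn (hγc.continuousOn (s := Icc (0:ℝ) 1))
  refine ⟨γ, a, b, ∅, B.toNNReal, ?_, by simp [hγ, ht], rfl, countable_empty, ?_⟩
  · refine (convex_Icc 0 1).lipschitzOnWith_of_nnnorm_hasDerivWithin_le
      (fun s _ => (hγd s).hasDerivWithinAt) fun s hs => ?_
    rw [← NNReal.coe_le_coe, coe_nnnorm, Real.coe_toNNReal']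
    exact (hB s hs).trans (le_max_left _ _)
  · rintro s ⟨hs, -⟩
    refine ⟨(hγd s).congr_deriv ?_, hl s hs⟩
    ext i
    fin_cases i
    · simp [fieldX, fieldY]
    · simp [fieldX, fieldY]
    · simp [fieldX, fieldY, hγ, hc]
      ring

/-- On a circle about the `t`-axis the lift descends by `ρ^{2m+2}` times the angle. -/
theorem horizontallyReachable_arc (m : ℕ) {ρ u v : ℝ} (hρ : 0 ≤ ρ) (huv : u ^ 2 + v ^ 2 = 1)
    (θ t : ℝ) : HorizontallyReachable m !₂[ρ * u, ρ * v, t]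
      !₂[ρ * (u * Real.cos θ - v * Real.sin θ), ρ * (u * Real.sin θ + v * Real.cos θ),
        t - ρ ^ (2 * m + 2) * θ] (ρ * |θ|) := by
  have h := horizontallyReachable_lift m
    (x := fun s => ρ * (u * Real.cos (s * θ) - v * Real.sin (s * θ)))
    (y := fun s => ρ * (u * Real.sin (s * θ) + v * Real.cos (s * θ)))
    (a := fun s => ρ * (u * (-Real.sin (s * θ) * (1 * θ)) - v * (Real.cos (s * θ) * (1 * θ))))
    (b := fun s => ρ * (u * (Real.cos (s * θ) * (1 * θ)) + v * (-Real.sin (s * θ) * (1 * θ))))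
    (fun s => ((((hasDerivAt_id s).mul_const θ).cos.const_mul u).sub
      (((hasDerivAt_id s).mul_const θ).sin.const_mul v)).const_mul ρ)
    (fun s => ((((hasDerivAt_id s).mul_const θ).sin.const_mul u).add
      (((hasDerivAt_id s).mul_const θ).cos.const_mul v)).const_mul ρ)
    (by fun_prop) (by fun_prop) t (ℓ := ρ * |θ|) (by
      intro s _
      refine le_of_eq ?_
      rw [show ρ * |θ| = |ρ * θ| by rw [abs_mul, abs_of_nonneg hρ], ← Real.sqrt_sq_eq_abs]
      congr 1
      have hcs := Real.sin_sq_add_cos_sq (s * θ)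
      linear_combination (ρ * θ) ^ 2 * hcs * (u ^ 2 + v ^ 2) + (ρ * θ) ^ 2 * huv)
  have e : ∀ s : ℝ, ((ρ * (u * Real.cos (s * θ) - v * Real.sin (s * θ))) ^ 2 +
      (ρ * (u * Real.sin (s * θ) + v * Real.cos (s * θ))) ^ 2) ^ m *
      (ρ * (u * Real.sin (s * θ) + v * Real.cos (s * θ)) *
        (ρ * (u * (-Real.sin (s * θ) * (1 * θ)) - v * (Real.cos (s * θ) * (1 * θ)))) -
      ρ * (u * Real.cos (s * θ) - v * Real.sin (s * θ)) *
        (ρ * (u * (Real.cos (s * θ) * (1 * θ)) + v * (-Real.sin (s * θ) * (1 * θ))))) =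
      -(ρ ^ (2 * m + 2) * θ) := by
    intro s
    have hcs := Real.sin_sq_add_cos_sq (s * θ)
    have e1 : (ρ * (u * Real.cos (s * θ) - v * Real.sin (s * θ))) ^ 2 +
      (ρ * (u * Real.sin (s * θ) + v * Real.cos (s * θ))) ^ 2 = ρ ^ 2 := by
      linear_combination ρ ^ 2 * hcs * (u ^ 2 + v ^ 2) + ρ ^ 2 * huv
    rw [e1, ← pow_mul, pow_add]
    linear_combination -ρ ^ (2 * m) * ρ ^ 2 * θ * (hcs * (u ^ 2 + v ^ 2) + huv)
  simp only [e] at h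
  simpa [← sub_eq_add_neg] using h

/-- Lifts of radial segments are horizontal lines. -/
theorem horizontallyReachable_radial (m : ℕ) {u v : ℝ} (huv : u ^ 2 + v ^ 2 = 1)
    (ρ ρ' t : ℝ) : HorizontallyReachable m !₂[ρ * u, ρ * v, t] !₂[ρ' * u, ρ' * v, t]
      |ρ' - ρ| := by
  have h := horizontallyReachable_lift m
    (x := fun s => (ρ + s * (ρ' - ρ)) * u) (y := fun s => (ρ + s * (ρ' - ρ)) * v)
    (a := fun _ => (1 * (ρ' - ρ)) * u) (b := fun _ => (1 * (ρ' - ρ)) * v)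
    (fun s => (((hasDerivAt_id s).mul_const (ρ' - ρ)).const_add ρ).mul_const u)
    (fun s => (((hasDerivAt_id s).mul_const (ρ' - ρ)).const_add ρ).mul_const v)
    (by fun_prop) (by fun_prop) t (ℓ := |ρ' - ρ|) (by
      intro s _
      refine le_of_eq ?_
      rw [← Real.sqrt_sq_eq_abs]
      congr 1
      linear_combination (ρ' - ρ) ^ 2 * huv)
  have e : ∀ s : ℝ, (ρ + s * (ρ' - ρ)) * v * (1 * (ρ' - ρ) * u) -
      (ρ + s * (ρ' - ρ)) * u * (1 * (ρ' - ρ) * v) = 0 := fun s => by ring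
  simp only [e] at h
  simpa using h

theorem exists_horizontallyReachable_segment (m : ℕ) (p : EuclideanSpace ℝ (Fin 3)) (x y : ℝ) :
    ∃ t, HorizontallyReachable m p !₂[x, y, t] √((x - p 0) ^ 2 + (y - p 1) ^ 2) := by
  have h := horizontallyReachable_lift m
    (x := fun s => p 0 + s * (x - p 0)) (y := fun s => p 1 + s * (y - p 1))
    (a := fun _ => 1 * (x - p 0)) (b := fun _ => 1 * (y - p 1))
    (fun s => ((hasDerivAt_id s).mul_const _).const_add _)
    (fun s => ((hasDerivAt_id s).mul_const _).const_add _)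
    (by fun_prop) (by fun_prop) (p 2) (ℓ := √((x - p 0) ^ 2 + (y - p 1) ^ 2)) (by simp)
  have hp : (!₂[p 0, p 1, p 2] : EuclideanSpace ℝ (Fin 3)) = p := by
    ext i
    fin_cases i <;> rfl
  simp only [zero_mul, add_zero, one_mul, hp, add_sub_cancel] at h
  exact ⟨_, h⟩

/-- Vertical displacement by `e`: the loop bounding a polar rectangle of radial width `h`, whose
angular width is proportional to `e`. -/
theorem horizontallyReachable_vertical (m : ℕ) {ρ u v h L : ℝ} (hρ : 0 ≤ ρ)
    (huv : u ^ 2 + v ^ 2 = 1) (hh : 0 < h) (t e : ℝ) (hL : h ≤ L)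
    (he : |e| ≤ L * (h * (ρ + h) ^ (2 * m))) :
    HorizontallyReachable m !₂[ρ * u, ρ * v, t] !₂[ρ * u, ρ * v, t + e] (4 * L) := by
  set D := (ρ + h) ^ (2 * m + 2) - ρ ^ (2 * m + 2) with hD
  have hρh : 0 < ρ + h := by positivity
  have hDge : h * (ρ + h) ^ (2 * m + 1) ≤ D := by
    have : ρ ^ (2 * m + 1) * ρ ≤ (ρ + h) ^ (2 * m + 1) * ρ := by
      gcongr
      linarith
    rw [hD, pow_succ _ (2 * m + 1), pow_succ _ (2 * m + 1)]
    linarith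
  have hD0 : 0 < D := lt_of_lt_of_le (by positivity) hDge
  set θ := e / D with hθ
  have hθD : θ * D = e := div_mul_cancel₀ e hD0.ne'
  have hθL : (ρ + h) * |θ| ≤ L := by
    rw [hθ, abs_div, abs_of_pos hD0, ← mul_div_assoc, div_le_iff₀ hD0]
    calc (ρ + h) * |e| ≤ (ρ + h) * (L * (h * (ρ + h) ^ (2 * m))) := by gcongr
      _ = L * (h * (ρ + h) ^ (2 * m + 1)) := by ring
      _ ≤ L * D := by gcongr; linarith
  set u' := u * Real.cos θ - v * Real.sin θ with hu'
  set v' := u * Real.sin θ + v * Real.cos θ with hv'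
  have hcs := Real.sin_sq_add_cos_sq θ
  have huv' : u' ^ 2 + v' ^ 2 = 1 := by
    linear_combination hcs * (u ^ 2 + v ^ 2) + huv
  have s1 := (horizontallyReachable_arc m hρ huv θ t).mono (ℓ' := L)
    (le_trans (by gcongr; linarith) hθL)
  have s2 := (horizontallyReachable_radial m huv' ρ (ρ + h) (t - ρ ^ (2 * m + 2) * θ)).mono
    (ℓ' := L) (by rw [add_sub_cancel_left, abs_of_pos hh]; exact hL)
  have s3 := (horizontallyReachable_arc m hρh.le huv' (-θ) (t - ρ ^ (2 * m + 2) * θ)).mono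
    (ℓ' := L) (by rw [abs_neg]; exact hθL)
  have s4 := (horizontallyReachable_radial m huv (ρ + h) ρ (t + e)).mono
    (ℓ' := L) (by rw [sub_add_cancel_left, abs_neg, abs_of_pos hh]; exact hL)
  have e1 : u' * Real.cos (-θ) - v' * Real.sin (-θ) = u := by
    rw [Real.cos_neg, Real.sin_neg]
    linear_combination u * hcs
  have e2 : u' * Real.sin (-θ) + v' * Real.cos (-θ) = v := by
    rw [Real.cos_neg, Real.sin_neg]
    linear_combination v * hcs
  have e3 : t - ρ ^ (2 * m + 2) * θ - (ρ + h) ^ (2 * m + 2) * -θ = t + e := by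
    rw [← hθD, hD]
    ring
  rw [e1, e2, e3] at s3
  have := (s1.trans s2).trans (s3.trans s4)
  rwa [← mul_assoc, show (2 : ℝ) * 2 = 4 by norm_num] at this

theorem exists_modelBox_subset_ccBall (m : ℕ) : ∃ c : ℝ, 0 < c ∧ c ≤ 1 ∧ ∀ p r, 0 < r →
    modelBox m p (c * r) ⊆ ccBall m p r := by
  obtain ⟨C, hC1, hC⟩ := exists_ccBall_subset_modelBox m
  have hC0 : 0 < C := by linarith
  have hc0 : 0 < 1 / (96 * C) := by positivity
  have hcC : 1 / (96 * C) ≤ 1 / 96 := by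
    apply one_div_le_one_div_of_le <;> linarith
  -- With `C * 3 c = 1 / 32` the lifted segment ends in the box of radius `r / 32`, whose height a
  -- loop of size `r / 16` can make up for.
  refine ⟨1 / (96 * C), hc0, by linarith, fun p r hr q hq => ?_⟩
  set c := 1 / (96 * C) with hc
  have hCc : C * (3 * c) = 1 / 32 := by
    rw [hc]
    field_simp
    norm_num
  obtain ⟨h1, h2, h3⟩ := hq
  obtain ⟨t, ht⟩ := exists_horizontallyReachable_segment m p (q 0) (q 1)
  have hcr : 0 < c * r := by positivity
  have hcr' : c * r ≤ r / 96 := by nlinarith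
  have hlen : √((q 0 - p 0) ^ 2 + (q 1 - p 1) ^ 2) ≤ 2 * (c * r) := by
    rw [Real.sqrt_le_left (by positivity)]
    have k1 := sq_lt_sq' (abs_lt.1 h1).1 (abs_lt.1 h1).2
    have k2 := sq_lt_sq' (abs_lt.1 h2).1 (abs_lt.1 h2).2
    nlinarith
  replace ht := ht.mono hlen
  -- The endpoint of the lifted segment lies in a model box, so its height is under control.
  have hbox : (!₂[q 0, q 1, t] : EuclideanSpace ℝ (Fin 3)) ∈ modelBox m p (r / 32) := by
    have : (!₂[q 0, q 1, t] : EuclideanSpace ℝ (Fin 3)) ∈ ccBall m p (3 * c * r) :=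
      lt_of_le_of_lt ht.ccDist_le ((ENNReal.ofReal_lt_ofReal_iff (by positivity)).2 (by linarith))
    have := hC p (3 * c * r) (by positivity) this
    rwa [← mul_assoc, hCc, one_div_mul_eq_div] at this
  have hR := axisDist_nonneg p
  have hmono := boxHeight_mono m p hcr (by linarith : c * r ≤ r / 32)
  have he : |q 2 - t| ≤ 2 * boxHeight m p (r / 32) := by
    have e1 : q 2 - t = heightAbove m p q - heightAbove m p !₂[q 0, q 1, t] := by
      simp [heightAbove]
    rw [e1]
    refine (abs_sub _ _).trans ?_
    linarith [hbox.2.2]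
  set ρ := √(q 0 ^ 2 + q 1 ^ 2) with hρ
  have hρ0 : 0 ≤ ρ := Real.sqrt_nonneg _
  obtain ⟨u, v, huv, hqu, hqv⟩ : ∃ u v : ℝ, u ^ 2 + v ^ 2 = 1 ∧ q 0 = ρ * u ∧ q 1 = ρ * v := by
    rcases hρ0.eq_or_lt with h0 | h0
    · have : q 0 ^ 2 + q 1 ^ 2 = 0 := by
        rwa [eq_comm, Real.sqrt_eq_zero (by positivity)] at h0
      refine ⟨1, 0, by norm_num, ?_, ?_⟩ <;> rw [← h0] <;> nlinarith [sq_nonneg (q 0), sq_nonneg (q 1)]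
    · refine ⟨q 0 / ρ, q 1 / ρ, ?_, by field_simp, by field_simp⟩
      rw [div_pow, div_pow, ← add_div, hρ, Real.sq_sqrt (by positivity), div_self]
      rw [hρ, Real.sqrt_pos] at h0
      exact h0.ne'
  have hRρ : axisDist p ≤ ρ + 2 * (c * r) := by
    rw [axisDist, Real.sqrt_le_left (by positivity)]
    have hsq : ρ ^ 2 = q 0 ^ 2 + q 1 ^ 2 := Real.sq_sqrt (by positivity)
    have k0 : |q 0| ≤ ρ := Real.abs_le_sqrt (by nlinarith [sq_nonneg (q 1)])
    have k1 : |q 1| ≤ ρ := Real.abs_le_sqrt (by nlinarith [sq_nonneg (q 0)])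
    have b0 : |q 0 * (q 0 - p 0)| ≤ ρ * (c * r) := by
      rw [abs_mul]
      gcongr
    have b1 : |q 1 * (q 1 - p 1)| ≤ ρ * (c * r) := by
      rw [abs_mul]
      gcongr
    have d0 := sq_lt_sq' (abs_lt.1 h1).1 (abs_lt.1 h1).2
    have d1 := sq_lt_sq' (abs_lt.1 h2).1 (abs_lt.1 h2).2
    rw [abs_le] at b0 b1
    nlinarith
  have hloop := horizontallyReachable_vertical m hρ0 huv (h := r / 16) (L := r / 16)
    (by positivity) t (q 2 - t) le_rfl (by
      refine he.trans ?_
      have : axisDist p + r / 32 ≤ ρ + r / 16 := by linarith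
      rw [boxHeight]
      calc 2 * ((r / 32) ^ 2 * (axisDist p + r / 32) ^ (2 * m))
          ≤ 2 * ((r / 32) ^ 2 * (ρ + r / 16) ^ (2 * m)) := by gcongr
        _ = r / 16 * (r / 16 * (ρ + r / 16) ^ (2 * m)) / 2 := by ring
        _ ≤ _ := half_le_self (by positivity))
  rw [← hqu, ← hqv, add_sub_cancel] at hloop
  have hq : (!₂[q 0, q 1, q 2] : EuclideanSpace ℝ (Fin 3)) = q := by
    ext i
    fin_cases i <;> rfl
  rw [hq] at hloop
  have := ((ht.mono (by linarith : _ ≤ 4 * (r / 16))).trans hloop).ccDist_le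
  exact lt_of_le_of_lt this ((ENNReal.ofReal_lt_ofReal_iff hr).2 (by linarith))

/-! ### The horizontal gradient along a graph -/

/-- `X` applied to the defining function `φ(z) - t` of the graph of `φ`. -/
noncomputable def graphX (m : ℕ) (φ : EuclideanSpace ℝ (Fin 2) → ℝ)
    (z : EuclideanSpace ℝ (Fin 2)) : ℝ :=
  fderiv ℝ φ z (EuclideanSpace.single 0 1) - (z 0 ^ 2 + z 1 ^ 2) ^ m * z 1

/-- `Y` applied to the defining function `φ(z) - t` of the graph of `φ`. -/
noncomputable def graphY (m : ℕ) (φ : EuclideanSpace ℝ (Fin 2) → ℝ)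
    (z : EuclideanSpace ℝ (Fin 2)) : ℝ :=
  fderiv ℝ φ z (EuclideanSpace.single 1 1) + (z 0 ^ 2 + z 1 ^ 2) ^ m * z 0

/-- The point of the graph of `φ` above `z`. -/
def graphPoint (φ : EuclideanSpace ℝ (Fin 2) → ℝ) (z : EuclideanSpace ℝ (Fin 2)) :
    EuclideanSpace ℝ (Fin 3) := !₂[z 0, z 1, φ z]

theorem plane_eq (v : EuclideanSpace ℝ (Fin 2)) :
    v = v 0 • EuclideanSpace.single 0 (1 : ℝ) + v 1 • EuclideanSpace.single 1 (1 : ℝ) := by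
  ext i
  fin_cases i <;> simp

theorem norm_sq_plane (v : EuclideanSpace ℝ (Fin 2)) : ‖v‖ ^ 2 = v 0 ^ 2 + v 1 ^ 2 := by
  simp [EuclideanSpace.norm_sq_eq]

theorem abs_apply_le_norm {n : ℕ} (v : EuclideanSpace ℝ (Fin n)) (i : Fin n) : |v i| ≤ ‖v‖ :=
  PiLp.norm_apply_le v i

theorem norm_plane_le (v : EuclideanSpace ℝ (Fin 2)) : ‖v‖ ≤ |v 0| + |v 1| := by
  refine abs_le_of_sq_le_sq' ?_ (by positivity) |>.2
  rw [norm_sq_plane]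
  nlinarith [sq_abs (v 0), sq_abs (v 1), mul_nonneg (abs_nonneg (v 0)) (abs_nonneg (v 1))]

/-- A linear functional on the plane is bounded through its values on the coordinate vectors. -/
theorem norm_planeFunctional_le {L : EuclideanSpace ℝ (Fin 2) →L[ℝ] ℝ} {M : ℝ}
    (h : ∀ i, |L (EuclideanSpace.single i 1)| ≤ M) : ‖L‖ ≤ 2 * M := by
  have hM : 0 ≤ M := (abs_nonneg _).trans (h 0)
  refine L.opNorm_le_bound (by positivity) fun v => ?_
  rw [plane_eq v, map_add, map_smul, map_smul, ← plane_eq v]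
  refine (abs_add_le _ _).trans ?_
  simp only [smul_eq_mul, abs_mul]
  have := mul_le_mul (abs_apply_le_norm v 0) (h 0) (abs_nonneg _) (norm_nonneg _)
  have := mul_le_mul (abs_apply_le_norm v 1) (h 1) (abs_nonneg _) (norm_nonneg _)
  linarith

theorem abs_sub_le_of_partials_le {g : EuclideanSpace ℝ (Fin 2) → ℝ}
    {s : Set (EuclideanSpace ℝ (Fin 2))} (hs : Convex ℝ s) (hg : ∀ z ∈ s, DifferentiableAt ℝ g z)
    {M : ℝ} (hM : ∀ z ∈ s, ∀ i, |fderiv ℝ g z (EuclideanSpace.single i 1)| ≤ M)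
    {z w : EuclideanSpace ℝ (Fin 2)} (hz : z ∈ s) (hw : w ∈ s) :
    |g w - g z| ≤ 2 * M * ‖w - z‖ :=
  hs.norm_image_sub_le_of_norm_fderiv_le hg (fun z hz => norm_planeFunctional_le (hM z hz)) hz hw

theorem hasFDerivAt_pow_mul (m : ℕ) (i : Fin 2) (z : EuclideanSpace ℝ (Fin 2)) :
    HasFDerivAt (fun z : EuclideanSpace ℝ (Fin 2) => (z 0 ^ 2 + z 1 ^ 2) ^ m * z i)
      ((z 0 ^ 2 + z 1 ^ 2) ^ m • (EuclideanSpace.proj i : EuclideanSpace ℝ (Fin 2) →L[ℝ] ℝ) +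
        z i • ((m * (z 0 ^ 2 + z 1 ^ 2) ^ (m - 1)) •
          ((2 * z 0) • (EuclideanSpace.proj 0 : EuclideanSpace ℝ (Fin 2) →L[ℝ] ℝ) +
            (2 * z 1) • (EuclideanSpace.proj 1 : EuclideanSpace ℝ (Fin 2) →L[ℝ] ℝ)))) z := by
  have h : ∀ j : Fin 2, HasFDerivAt (fun z : EuclideanSpace ℝ (Fin 2) => z j)
      (EuclideanSpace.proj j : EuclideanSpace ℝ (Fin 2) →L[ℝ] ℝ) z := fun j =>
    (EuclideanSpace.proj j : EuclideanSpace ℝ (Fin 2) →L[ℝ] ℝ).hasFDerivAt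
  refine HasFDerivAt.congr_fderiv ((((h 0).pow 2).add ((h 1).pow 2)).pow m |>.mul (h i)) ?_
  ext v
  simp

section

variable {m : ℕ} {φ : EuclideanSpace ℝ (Fin 2) → ℝ} {z₀ : EuclideanSpace ℝ (Fin 2)}

theorem hasFDerivAt_partial {z : EuclideanSpace ℝ (Fin 2)} (hφ : ContDiffAt ℝ ∞ φ z)
    (v : EuclideanSpace ℝ (Fin 2)) :
    HasFDerivAt (fun z => fderiv ℝ φ z v) ((fderiv ℝ (fderiv ℝ φ) z).flip v) z := by
  have : DifferentiableAt ℝ (fderiv ℝ φ) z :=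
    (hφ.fderiv_right (m := 1) (by norm_cast)).differentiableAt one_ne_zero
  have := this.hasFDerivAt.clm_apply (hasFDerivAt_const v z)
  refine this.congr_fderiv ?_
  ext w
  simp

/-- The horizontal gradient along a graph has curl `(2m + 2) |z|^{2m}`, whatever the graph. -/
theorem fderiv_graphY_sub_fderiv_graphX {z : EuclideanSpace ℝ (Fin 2)}
    (hφ : ContDiffAt ℝ ∞ φ z) :
    fderiv ℝ (graphY m φ) z (EuclideanSpace.single 0 1) -
      fderiv ℝ (graphX m φ) z (EuclideanSpace.single 1 1) =
      (2 * m + 2) * (z 0 ^ 2 + z 1 ^ 2) ^ m := by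
  have h1 := ((hasFDerivAt_partial hφ (EuclideanSpace.single 1 1)).add
    (hasFDerivAt_pow_mul m 0 z)).fderiv
  have h0 := ((hasFDerivAt_partial hφ (EuclideanSpace.single 0 1)).sub
    (hasFDerivAt_pow_mul m 1 z)).fderiv
  have hsymm : IsSymmSndFDerivAt ℝ φ z := hφ.isSymmSndFDerivAt (by simp; norm_cast)
  have e1 : fderiv ℝ (graphY m φ) z = _ := h1
  have e0 : fderiv ℝ (graphX m φ) z = _ := h0
  rw [e1, e0]
  have hs := hsymm.eq (EuclideanSpace.single 0 1) (EuclideanSpace.single 1 1)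
  simp only [add_apply, sub_apply,
    ContinuousLinearMap.flip_apply, hs]
  simp
  rcases Nat.eq_zero_or_pos m with rfl | hm
  · simp
    norm_num
  · obtain ⟨k, rfl⟩ := Nat.exists_eq_add_of_le' hm
    simp
    ring

theorem differentiableAt_graphX {z : EuclideanSpace ℝ (Fin 2)} (hφ : ContDiffAt ℝ ∞ φ z) :
    DifferentiableAt ℝ (graphX m φ) z :=
  ((hasFDerivAt_partial hφ _).sub (hasFDerivAt_pow_mul m 1 z)).differentiableAt

theorem differentiableAt_graphY {z : EuclideanSpace ℝ (Fin 2)} (hφ : ContDiffAt ℝ ∞ φ z) :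
    DifferentiableAt ℝ (graphY m φ) z :=
  ((hasFDerivAt_partial hφ _).add (hasFDerivAt_pow_mul m 0 z)).differentiableAt

/-- The horizontal gradient along the graph of `φ` is Lipschitz with constant
`O((|z₀| + r)^{2m})` near `z₀`, and the graph is its first-order model up to the height of the
model box. -/
theorem graph_estimates {r M : ℝ} (hr : 0 < r)
    (hφ : ∀ z ∈ Metric.ball z₀ (2 * r), ContDiffAt ℝ ∞ φ z)
    (hM : ∀ z ∈ Metric.ball z₀ (2 * r), ∀ i j : Fin 2,
      |fderiv ℝ (fderiv ℝ φ) z (EuclideanSpace.single i 1) (EuclideanSpace.single j 1)| ≤ M)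
    {z : EuclideanSpace ℝ (Fin 2)} (hz : z ∈ Metric.ball z₀ (2 * r)) :
    |graphX m φ z - graphX m φ z₀| ≤
        (2 * M + (4 * m + 1) * 4 ^ m * (‖z₀‖ + 2 * r) ^ (2 * m)) * ‖z - z₀‖ ∧
      |graphY m φ z - graphY m φ z₀| ≤
        (2 * M + (4 * m + 1) * 4 ^ m * (‖z₀‖ + 2 * r) ^ (2 * m)) * ‖z - z₀‖ ∧
      |heightAbove m (graphPoint φ z₀) (graphPoint φ z) -
        (graphX m φ z₀ * (z 0 - z₀ 0) + graphY m φ z₀ * (z 1 - z₀ 1))| ≤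
          4 * M * ‖z - z₀‖ ^ 2 := by
  have hz₀ : z₀ ∈ Metric.ball z₀ (2 * r) := Metric.mem_ball_self (by positivity)
  have hpart : ∀ w ∈ Metric.ball z₀ (2 * r), ∀ j : Fin 2,
      |fderiv ℝ φ w (EuclideanSpace.single j 1) - fderiv ℝ φ z₀ (EuclideanSpace.single j 1)| ≤
        2 * M * ‖w - z₀‖ := by
    intro w hw j
    refine abs_sub_le_of_partials_le (g := fun z => fderiv ℝ φ z (EuclideanSpace.single j 1))
      (convex_ball z₀ (2 * r))
      (fun u hu => (hasFDerivAt_partial (hφ u hu) _).differentiableAt) (fun u hu i => ?_) hz₀ hw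
    rw [(hasFDerivAt_partial (hφ u hu) _).fderiv]
    exact hM u hu i j
  have hd0 : |z 0 - z₀ 0| ≤ ‖z - z₀‖ := abs_apply_le_norm (z - z₀) 0
  have hd1 : |z 1 - z₀ 1| ≤ ‖z - z₀‖ := abs_apply_le_norm (z - z₀) 1
  have hn := norm_nonneg (z - z₀)
  have hn' : ‖z - z₀‖ ≤ 2 * r := by
    rw [← dist_eq_norm]
    exact (Metric.mem_ball.1 hz).le
  have hR := norm_nonneg z₀
  obtain ⟨-, -, c3, c4⟩ := abs_sq_add_sq_sub_le hn hR (norm_sq_plane z₀).symm hd0 hd1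
  have hpoly : ∀ j : Fin 2, |(z 0 ^ 2 + z 1 ^ 2) ^ m * z j - (z₀ 0 ^ 2 + z₀ 1 ^ 2) ^ m * z₀ j| ≤
      (4 * m + 1) * 4 ^ m * (‖z₀‖ + 2 * r) ^ (2 * m) * ‖z - z₀‖ := by
    intro j
    have := abs_pow_mul_sub_pow_mul_le m hn hR (by positivity) (by positivity)
      (norm_sq_plane z₀).ge c3 (abs_apply_le_norm (z - z₀) j) (abs_apply_le_norm z₀ j) c4
    refine this.trans ?_
    rw [mul_right_comm]
    gcongr
  refine ⟨?_, ?_, ?_⟩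
  · have e : graphX m φ z - graphX m φ z₀ =
        (fderiv ℝ φ z (EuclideanSpace.single 0 1) - fderiv ℝ φ z₀ (EuclideanSpace.single 0 1)) -
        ((z 0 ^ 2 + z 1 ^ 2) ^ m * z 1 - (z₀ 0 ^ 2 + z₀ 1 ^ 2) ^ m * z₀ 1) := by
      simp only [graphX]
      ring
    rw [e, add_mul]
    exact (abs_sub _ _).trans (add_le_add (hpart z hz 0) (hpoly 1))
  · have e : graphY m φ z - graphY m φ z₀ =
        (fderiv ℝ φ z (EuclideanSpace.single 1 1) - fderiv ℝ φ z₀ (EuclideanSpace.single 1 1)) +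
        ((z 0 ^ 2 + z 1 ^ 2) ^ m * z 0 - (z₀ 0 ^ 2 + z₀ 1 ^ 2) ^ m * z₀ 0) := by
      simp only [graphY]
      ring
    rw [e, add_mul]
    exact (abs_add_le _ _).trans (add_le_add (hpart z hz 1) (hpoly 0))
  · set s := segment ℝ z₀ z with hs
    have hsub : s ⊆ Metric.ball z₀ (2 * r) := (convex_ball z₀ (2 * r)).segment_subset hz₀ hz
    have hd : ∀ w ∈ s, HasFDerivAt (fun w => φ w - fderiv ℝ φ z₀ w)
        (fderiv ℝ φ w - fderiv ℝ φ z₀) w := fun w hw =>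
      ((hφ w (hsub hw)).differentiableAt (by simp)).hasFDerivAt.sub
        (fderiv ℝ φ z₀).hasFDerivAt
    have hM0 : 0 ≤ M := (abs_nonneg _).trans (hM z₀ hz₀ 0 0)
    have := abs_sub_le_of_partials_le (convex_segment z₀ z)
      (fun w hw => (hd w hw).differentiableAt) (M := 2 * M * ‖z - z₀‖) (fun w hw i => by
        rw [(hd w hw).fderiv]
        refine (hpart w (hsub hw) i).trans ?_
        gcongr
        exact norm_sub_le_of_mem_segment hw) (left_mem_segment ℝ z₀ z) (right_mem_segment ℝ z₀ z)
    have e : heightAbove m (graphPoint φ z₀) (graphPoint φ z) -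
        (graphX m φ z₀ * (z 0 - z₀ 0) + graphY m φ z₀ * (z 1 - z₀ 1)) =
        φ z - fderiv ℝ φ z₀ z - (φ z₀ - fderiv ℝ φ z₀ z₀) := by
      have e1 : fderiv ℝ φ z₀ z - fderiv ℝ φ z₀ z₀ =
          (z 0 - z₀ 0) * fderiv ℝ φ z₀ (EuclideanSpace.single 0 1) +
          (z 1 - z₀ 1) * fderiv ℝ φ z₀ (EuclideanSpace.single 1 1) := by
        rw [← map_sub]
        conv_lhs => rw [plane_eq (z - z₀)]
        simp
      simp only [heightAbove, graphPoint, graphX, graphY]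
      simp
      linear_combination e1
    rw [e]
    refine this.trans (le_of_eq ?_)
    ring

end

/-! ### The horizontal gradient cannot be small on average -/

/-- Smooth cut-off functions adapted to balls, with the natural bound on the gradient. -/
theorem exists_cutoff : ∃ K : ℝ, 0 < K ∧ ∀ (z₀ : EuclideanSpace ℝ (Fin 2)) (ρ : ℝ), 0 < ρ →
    ∃ η : EuclideanSpace ℝ (Fin 2) → ℝ, ContDiff ℝ ∞ η ∧ (∀ z, 0 ≤ η z) ∧
      (∀ z ∈ Metric.ball z₀ (ρ / 2), η z = 1) ∧ HasCompactSupport η ∧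
      tsupport η ⊆ Metric.ball z₀ ρ ∧ ∀ z, ‖fderiv ℝ η z‖ ≤ K / ρ := by
  let b : ContDiffBump (0 : EuclideanSpace ℝ (Fin 2)) := ⟨1 / 2, 3 / 4, by norm_num, by norm_num⟩
  have hb : ContDiff ℝ ∞ b := b.contDiff
  obtain ⟨K, hK⟩ := (b.hasCompactSupport.fderiv ℝ).exists_bound_of_continuous
    (hb.continuous_fderiv (by simp))
  have hK0 : 0 ≤ K := (norm_nonneg _).trans (hK 0)
  refine ⟨K + 1, by linarith, fun z₀ ρ hρ => ?_⟩
  have hsupp : tsupport (fun z => b (ρ⁻¹ • (z - z₀))) ⊆ Metric.closedBall z₀ (3 / 4 * ρ) := by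
    refine closure_minimal (fun z hz => ?_) Metric.isClosed_closedBall
    have h1 : ρ⁻¹ • (z - z₀) ∈ Function.support b := hz
    rw [b.support_eq, mem_ball_zero_iff, norm_smul, norm_inv, Real.norm_of_nonneg hρ.le,
      inv_mul_lt_iff₀ hρ] at h1
    rw [Metric.mem_closedBall, dist_eq_norm, mul_comm]
    exact h1.le
  refine ⟨fun z => b (ρ⁻¹ • (z - z₀)), hb.comp (by fun_prop), fun z => b.nonneg, fun z hz => ?_,
    HasCompactSupport.of_support_subset_isCompact (isCompact_closedBall z₀ (3 / 4 * ρ))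
      (subset_closure.trans hsupp),
    hsupp.trans (Metric.closedBall_subset_ball (by linarith)), fun z => ?_⟩
  · apply b.one_of_mem_closedBall
    rw [mem_closedBall_zero_iff, norm_smul, norm_inv, Real.norm_of_nonneg hρ.le,
      inv_mul_le_iff₀ hρ, ← dist_eq_norm]
    have := Metric.mem_ball.1 hz
    change _ ≤ ρ * (1 / 2)
    linarith
  · have hd : HasFDerivAt (fun z => ρ⁻¹ • (z - z₀))
        (ρ⁻¹ • ContinuousLinearMap.id ℝ (EuclideanSpace ℝ (Fin 2))) z :=
      ((hasFDerivAt_id z).sub_const z₀).const_smul ρ⁻¹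
    have hbd := (hb.differentiable (by simp) (ρ⁻¹ • (z - z₀))).hasFDerivAt.comp z hd
    have e : fderiv ℝ (fun z => b (ρ⁻¹ • (z - z₀))) z = _ := hbd.fderiv
    rw [e]
    refine (ContinuousLinearMap.opNorm_comp_le _ _).trans ?_
    rw [norm_smul, norm_inv, Real.norm_of_nonneg hρ.le, div_eq_mul_inv]
    have h1 := hK (ρ⁻¹ • (z - z₀))
    have h2 : ρ⁻¹ * ‖ContinuousLinearMap.id ℝ (EuclideanSpace ℝ (Fin 2))‖ ≤ ρ⁻¹ * 1 := by
      gcongr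
      exact ContinuousLinearMap.norm_id_le
    rw [mul_one] at h2
    gcongr
    linarith

theorem Continuous.mul_of_tsupport_subset {f η : EuclideanSpace ℝ (Fin 2) → ℝ}
    {U : Set (EuclideanSpace ℝ (Fin 2))} (hη : Continuous η)
    (hsub : tsupport η ⊆ U) (hf : ∀ z ∈ U, ContinuousAt f z) :
    Continuous fun z => f z * η z :=
  continuous_of_tsupport fun z hz =>
    (hf z (hsub (closure_mono (fun _ hw => right_ne_zero_of_mul hw) hz))).mul hη.continuousAt

/-- Integration by parts against a function supported in a set where `f` is `C¹`. -/
theorem integral_mul_fderiv_of_tsupport_subset {f η : EuclideanSpace ℝ (Fin 2) → ℝ}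
    {U : Set (EuclideanSpace ℝ (Fin 2))} (hη : ContDiff ℝ ∞ η)
    (hc : HasCompactSupport η) (hsub : tsupport η ⊆ U)
    (hf : ∀ z ∈ U, DifferentiableAt ℝ f z) (v : EuclideanSpace ℝ (Fin 2))
    (hf' : ∀ z ∈ U, ContinuousAt (fun z => fderiv ℝ f z v) z) :
    Integrable (fun z => fderiv ℝ f z v * η z) ∧ Integrable (fun z => f z * fderiv ℝ η z v) ∧
      ∫ z, f z * fderiv ℝ η z v = -∫ z, fderiv ℝ f z v * η z := by
  have hη' : Continuous fun z => fderiv ℝ η z v :=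
    (hη.continuous_fderiv (by simp)).clm_apply continuous_const
  have hsub' : tsupport (fun z => fderiv ℝ η z v) ⊆ tsupport η :=
    tsupport_fderiv_apply_subset ℝ v
  have hc' : HasCompactSupport fun z => fderiv ℝ η z v := hc.of_isClosed_subset
    (isClosed_tsupport _) hsub'
  have i1 : Integrable (fun z => fderiv ℝ f z v * η z) :=
    (hη.continuous.mul_of_tsupport_subset hsub hf').integrable_of_hasCompactSupport hc.mul_left
  have i2 : Integrable (fun z => f z * fderiv ℝ η z v) :=
    (hη'.mul_of_tsupport_subset (hsub'.trans hsub) fun z hz =>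
      (hf z hz).continuousAt).integrable_of_hasCompactSupport hc'.mul_left
  have i3 : Integrable (fun z => f z * η z) :=
    (hη.continuous.mul_of_tsupport_subset hsub fun z hz =>
      (hf z hz).continuousAt).integrable_of_hasCompactSupport hc.mul_left
  exact ⟨i1, i2, integral_mul_fderiv_eq_neg_fderiv_mul_of_integrable i1 i2 i3
    (fun z hz => hf z (hsub hz)) (fun z _ => hη.differentiable (by simp) z)⟩

theorem contDiffAt_graphX {m : ℕ} {φ : EuclideanSpace ℝ (Fin 2) → ℝ}
    {z : EuclideanSpace ℝ (Fin 2)} (hφ : ContDiffAt ℝ ∞ φ z) : ContDiffAt ℝ 1 (graphX m φ) z := by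
  have h1 : ContDiffAt ℝ 1 (fun z => fderiv ℝ φ z (EuclideanSpace.single 0 1)) z :=
    (hφ.fderiv_right (m := 1) (by norm_cast)).clm_apply contDiffAt_const
  have h2 : ContDiffAt ℝ 1
      (fun z : EuclideanSpace ℝ (Fin 2) => (z 0 ^ 2 + z 1 ^ 2) ^ m * z 1) z := by fun_prop
  exact h1.sub h2

theorem contDiffAt_graphY {m : ℕ} {φ : EuclideanSpace ℝ (Fin 2) → ℝ}
    {z : EuclideanSpace ℝ (Fin 2)} (hφ : ContDiffAt ℝ ∞ φ z) : ContDiffAt ℝ 1 (graphY m φ) z := by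
  have h1 : ContDiffAt ℝ 1 (fun z => fderiv ℝ φ z (EuclideanSpace.single 1 1)) z :=
    (hφ.fderiv_right (m := 1) (by norm_cast)).clm_apply contDiffAt_const
  have h2 : ContDiffAt ℝ 1
      (fun z : EuclideanSpace ℝ (Fin 2) => (z 0 ^ 2 + z 1 ^ 2) ^ m * z 0) z := by fun_prop
  exact h1.add h2

/-- The integral of `|z|^{2m}` over a ball is comparable to its trivial upper bound, even when the
centre is near `0`. -/
theorem le_setIntegral_pow (m : ℕ) (z₀ : EuclideanSpace ℝ (Fin 2)) {ρ : ℝ} (hρ : 0 < ρ)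
    {η : EuclideanSpace ℝ (Fin 2) → ℝ} (hη : ∀ z, 0 ≤ η z)
    (h1 : ∀ z ∈ Metric.ball z₀ (ρ / 2), η z = 1)
    (hint : Integrable fun z : EuclideanSpace ℝ (Fin 2) => (z 0 ^ 2 + z 1 ^ 2) ^ m * η z) :
    Real.pi * (ρ / 8) ^ 2 * ((‖z₀‖ + ρ) / 4) ^ (2 * m) ≤
      ∫ z : EuclideanSpace ℝ (Fin 2), (z 0 ^ 2 + z 1 ^ 2) ^ m * η z := by
  have hpi := Real.pi_pos
  obtain ⟨u, hu, hzu⟩ : ∃ u : EuclideanSpace ℝ (Fin 2), ‖u‖ = 1 ∧ z₀ = ‖z₀‖ • u := by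
    by_cases h0 : z₀ = 0
    · exact ⟨EuclideanSpace.single 0 1, by simp, by simp [h0]⟩
    · have : ‖z₀‖ ≠ 0 := norm_ne_zero_iff.2 h0
      exact ⟨‖z₀‖⁻¹ • z₀, by simp [norm_smul, this], by rw [smul_smul, mul_inv_cancel₀ this, one_smul]⟩
  set z₁ := z₀ + (3 / 8 * ρ) • u with hz₁
  have hn1 : ‖z₁‖ = ‖z₀‖ + 3 / 8 * ρ := by
    rw [hz₁]
    conv_lhs => rw [hzu]
    rw [← add_smul, norm_smul, hu, mul_one, Real.norm_of_nonneg (by positivity)]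
  have hd : dist z₁ z₀ = 3 / 8 * ρ := by
    rw [dist_eq_norm, hz₁, add_sub_cancel_left, norm_smul, hu, mul_one,
      Real.norm_of_nonneg (by positivity)]
  have hvol : volume.real (Metric.ball z₁ (ρ / 8)) = Real.pi * (ρ / 8) ^ 2 := by
    rw [measureReal_def, EuclideanSpace.volume_ball_fin_two, ENNReal.toReal_mul,
      ENNReal.toReal_pow, ENNReal.toReal_ofReal (by positivity)]
    simp [mul_comm, hpi.le]
  have hnn : ∀ z : EuclideanSpace ℝ (Fin 2), 0 ≤ (z 0 ^ 2 + z 1 ^ 2) ^ m * η z := fun z =>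
    mul_nonneg (by positivity) (hη z)
  calc Real.pi * (ρ / 8) ^ 2 * ((‖z₀‖ + ρ) / 4) ^ (2 * m)
      = ∫ z in Metric.ball z₁ (ρ / 8), ((‖z₀‖ + ρ) / 4) ^ (2 * m) := by
        rw [setIntegral_const, hvol, smul_eq_mul]
    _ ≤ ∫ z in Metric.ball z₁ (ρ / 8), (z 0 ^ 2 + z 1 ^ 2) ^ m * η z := by
        refine setIntegral_mono_on (integrableOn_const (by
          rw [EuclideanSpace.volume_ball_fin_two]
          finiteness)) hint.integrableOn measurableSet_ball fun z hz => ?_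
        rw [h1 z (by
          have := dist_triangle z z₁ z₀
          rw [Metric.mem_ball] at hz ⊢
          linarith), mul_one, pow_mul, ← norm_sq_plane]
        have : ‖z₁‖ ≤ ‖z‖ + dist z z₁ := by
          rw [dist_eq_norm, norm_sub_rev]
          have := norm_add_le z (z₁ - z)
          rwa [add_sub_cancel] at this
        rw [Metric.mem_ball] at hz
        have := norm_nonneg z₀
        gcongr
        linarith
    _ ≤ _ := setIntegral_le_integral hint (Eventually.of_forall hnn)

/-- The horizontal gradient along a graph has curl `(2m + 2) |z|^{2m}`, so by integration by parts
its mean over a ball of radius `ρ` is at least of order `ρ (|z₀| + ρ)^{2m}`. -/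
theorem exists_le_lintegral_graph (m : ℕ) : ∃ c : ℝ, 0 < c ∧
    ∀ (φ : EuclideanSpace ℝ (Fin 2) → ℝ) (z₀ : EuclideanSpace ℝ (Fin 2)) (ρ : ℝ), 0 < ρ →
      (∀ z ∈ Metric.ball z₀ ρ, ContDiffAt ℝ ∞ φ z) →
      ENNReal.ofReal (c * ρ ^ 3 * (‖z₀‖ + ρ) ^ (2 * m)) ≤
        ∫⁻ z in Metric.ball z₀ ρ, ENNReal.ofReal √(graphX m φ z ^ 2 + graphY m φ z ^ 2) := by
  obtain ⟨K, hK0, hK⟩ := exists_cutoff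
  have hpi := Real.pi_pos
  refine ⟨(2 * m + 2) * (Real.pi * (1 / 8) ^ 2 * (1 / 4) ^ (2 * m)) / (2 * K), by positivity,
    fun φ z₀ ρ hρ hφ => ?_⟩
  obtain ⟨η, hη, hη0, hη1, hηc, hηs, hηK⟩ := hK z₀ ρ hρ
  set e₀ : EuclideanSpace ℝ (Fin 2) := EuclideanSpace.single 0 1
  set e₁ : EuclideanSpace ℝ (Fin 2) := EuclideanSpace.single 1 1
  obtain ⟨iX, jX, kX⟩ := integral_mul_fderiv_of_tsupport_subset (f := graphX m φ) hη hηc hηs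
    (fun z hz => differentiableAt_graphX (hφ z hz)) e₁ fun z hz =>
      (((contDiffAt_graphX (hφ z hz)).fderiv_right (m := 0) (by norm_num)).clm_apply
        contDiffAt_const).continuousAt
  obtain ⟨iY, jY, kY⟩ := integral_mul_fderiv_of_tsupport_subset (f := graphY m φ) hη hηc hηs
    (fun z hz => differentiableAt_graphY (hφ z hz)) e₀ fun z hz =>
      (((contDiffAt_graphY (hφ z hz)).fderiv_right (m := 0) (by norm_num)).clm_apply
        contDiffAt_const).continuousAt
  have hcurl : ∀ z, fderiv ℝ (graphY m φ) z e₀ * η z - fderiv ℝ (graphX m φ) z e₁ * η z =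
      (2 * m + 2) * ((z 0 ^ 2 + z 1 ^ 2) ^ m * η z) := by
    intro z
    by_cases hz : z ∈ tsupport η
    · rw [← sub_mul, fderiv_graphY_sub_fderiv_graphX (hφ z (hηs hz))]
      ring
    · simp [image_eq_zero_of_notMem_tsupport hz]
  have hint : Integrable fun z : EuclideanSpace ℝ (Fin 2) => (z 0 ^ 2 + z 1 ^ 2) ^ m * η z := by
    refine Continuous.integrable_of_hasCompactSupport ?_ hηc.mul_left
    have := hη.continuous
    fun_prop
  have hmain : ∫ z, (graphX m φ z * fderiv ℝ η z e₁ - graphY m φ z * fderiv ℝ η z e₀) =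
      (2 * m + 2) * ∫ z : EuclideanSpace ℝ (Fin 2), (z 0 ^ 2 + z 1 ^ 2) ^ m * η z := by
    rw [integral_sub jX jY, kX, kY, ← integral_const_mul, ← integral_congr_ae
      (Eventually.of_forall hcurl), integral_sub iY iX]
    ring
  have hlow := le_setIntegral_pow m z₀ hρ hη0 hη1 hint
  have hpt : ∀ z, ‖graphX m φ z * fderiv ℝ η z e₁ - graphY m φ z * fderiv ℝ η z e₀‖ₑ ≤
      (Metric.ball z₀ ρ).indicator (fun z => ENNReal.ofReal (2 * K / ρ) *
        ENNReal.ofReal √(graphX m φ z ^ 2 + graphY m φ z ^ 2)) z := by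
    intro z
    by_cases hz : z ∈ Metric.ball z₀ ρ
    · rw [indicator_of_mem hz, ← ENNReal.ofReal_mul (by positivity), Real.enorm_eq_ofReal_abs]
      refine ENNReal.ofReal_le_ofReal ?_
      have b : ∀ i : Fin 2, |fderiv ℝ η z (EuclideanSpace.single i 1)| ≤ K / ρ := fun i => by
        refine ((fderiv ℝ η z).le_opNorm _).trans ?_
        simpa using hηK z
      have s0 : |graphX m φ z| ≤ √(graphX m φ z ^ 2 + graphY m φ z ^ 2) :=
        Real.abs_le_sqrt (by nlinarith [sq_nonneg (graphY m φ z)])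
      have s1 : |graphY m φ z| ≤ √(graphX m φ z ^ 2 + graphY m φ z ^ 2) :=
        Real.abs_le_sqrt (by nlinarith [sq_nonneg (graphX m φ z)])
      refine (abs_sub _ _).trans ?_
      rw [abs_mul, abs_mul]
      have t0 := mul_le_mul s0 (b 1) (abs_nonneg _) (Real.sqrt_nonneg _)
      have t1 := mul_le_mul s1 (b 0) (abs_nonneg _) (Real.sqrt_nonneg _)
      calc _ ≤ _ := add_le_add t0 t1
        _ = _ := by ring
    · have : fderiv ℝ η z = 0 := by
        by_contra hne
        exact hz (hηs (support_fderiv_subset ℝ hne))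
      simp [this]
  have hfin : ENNReal.ofReal ((2 * m + 2) * (Real.pi * (ρ / 8) ^ 2 * ((‖z₀‖ + ρ) / 4) ^ (2 * m))) ≤
      ENNReal.ofReal (2 * K / ρ) * ∫⁻ z in Metric.ball z₀ ρ,
        ENNReal.ofReal √(graphX m φ z ^ 2 + graphY m φ z ^ 2) := by
    calc _ ≤ ENNReal.ofReal
          |∫ z, (graphX m φ z * fderiv ℝ η z e₁ - graphY m φ z * fderiv ℝ η z e₀)| := by
          refine ENNReal.ofReal_le_ofReal (le_trans ?_ (le_abs_self _))
          rw [hmain]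
          gcongr
      _ ≤ ∫⁻ z, ‖graphX m φ z * fderiv ℝ η z e₁ - graphY m φ z * fderiv ℝ η z e₀‖ₑ := by
          rw [← Real.enorm_eq_ofReal_abs]
          exact enorm_integral_le_lintegral_enorm _
      _ ≤ ∫⁻ z, _ := lintegral_mono hpt
      _ = _ := by
          rw [lintegral_indicator measurableSet_ball, lintegral_const_mul' _ _ (by finiteness)]
  have hKρ : 0 < 2 * K / ρ := by positivity
  replace hfin := ENNReal.div_le_of_le_mul' hfin
  rw [← ENNReal.ofReal_div_of_pos hKρ] at hfin
  refine le_trans (ENNReal.ofReal_le_ofReal (le_of_eq ?_)) hfin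
  rw [div_pow (‖z₀‖ + ρ), one_div_pow 4 (2 * m)]
  field_simp

/-! ### The part of a graph inside a model box -/

theorem sqrt_sq_add_sq_le_add (a b a₀ b₀ : ℝ) :
    √(a ^ 2 + b ^ 2) ≤ √(a₀ ^ 2 + b₀ ^ 2) + (|a - a₀| + |b - b₀|) := by
  have h : ∀ x y : ℝ, √(x ^ 2 + y ^ 2) = ‖(!₂[x, y] : EuclideanSpace ℝ (Fin 2))‖ := fun x y => by
    simp [EuclideanSpace.norm_eq]
  have e : (!₂[a, b] : EuclideanSpace ℝ (Fin 2)) = !₂[a₀, b₀] + !₂[a - a₀, b - b₀] := by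
    ext i
    fin_cases i <;> simp
  rw [h, h, e]
  refine (norm_add_le _ _).trans ?_
  gcongr
  simpa using norm_plane_le !₂[a - a₀, b - b₀]

theorem abs_mul_add_mul_le (v w : ℝ) (d : EuclideanSpace ℝ (Fin 2)) :
    |v * d 0 + w * d 1| ≤ √(v ^ 2 + w ^ 2) * ‖d‖ := by
  refine abs_le_of_sq_le_sq ?_ (by positivity)
  rw [mul_pow, Real.sq_sqrt (by positivity), norm_sq_plane]
  nlinarith [sq_nonneg (v * d 1 - w * d 0)]

theorem axisDist_graphPoint (φ : EuclideanSpace ℝ (Fin 2) → ℝ) (z : EuclideanSpace ℝ (Fin 2)) :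
    axisDist (graphPoint φ z) = ‖z‖ := by
  rw [axisDist, ← Real.sqrt_sq (norm_nonneg z), norm_sq_plane]
  rfl

/-- The bound `|D²φ| ≤ C |z|^{2m}` on a ball of radius `2 r` about `z₀`, as it enters the
estimates at scale `r`. -/
def HessianBound (m : ℕ) (C : ℝ) (φ : EuclideanSpace ℝ (Fin 2) → ℝ)
    (z₀ : EuclideanSpace ℝ (Fin 2)) (r : ℝ) : Prop :=
  ∀ z ∈ Metric.ball z₀ (2 * r), ContDiffAt ℝ ∞ φ z ∧ ∀ i j : Fin 2,
    |fderiv ℝ (fderiv ℝ φ) z (EuclideanSpace.single i 1) (EuclideanSpace.single j 1)| ≤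
      C * (‖z₀‖ + 2 * r) ^ (2 * m)

/-- `graph_estimates` at scale `r`, with a constant that depends only on `m` and `C`. -/
theorem HessianBound.exists_estimates (m : ℕ) {C : ℝ} (hC : 0 ≤ C) : ∃ L : ℝ, 1 ≤ L ∧
    ∀ φ z₀ r, 0 < r → HessianBound m C φ z₀ r → ∀ z ∈ Metric.ball z₀ (2 * r),
      |graphX m φ z - graphX m φ z₀| ≤ L * (‖z₀‖ + r) ^ (2 * m) * ‖z - z₀‖ ∧
      |graphY m φ z - graphY m φ z₀| ≤ L * (‖z₀‖ + r) ^ (2 * m) * ‖z - z₀‖ ∧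
      |heightAbove m (graphPoint φ z₀) (graphPoint φ z) -
        (graphX m φ z₀ * (z 0 - z₀ 0) + graphY m φ z₀ * (z 1 - z₀ 1))| ≤
          2 * L * (‖z₀‖ + r) ^ (2 * m) * ‖z - z₀‖ ^ 2 := by
  have h4 : (1 : ℝ) ≤ 4 ^ m := one_le_pow₀ (by norm_num)
  have hK : (1 : ℝ) ≤ (4 * m + 1) * 4 ^ m := by nlinarith [(Nat.cast_nonneg m : (0 : ℝ) ≤ m)]
  set K : ℝ := (4 * m + 1) * 4 ^ m
  refine ⟨(2 * C + K) * 4 ^ m, by nlinarith, fun φ z₀ r hr h z hz => ?_⟩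
  obtain ⟨h1, h2, h3⟩ := graph_estimates (m := m) hr (fun z hz => (h z hz).1)
    (fun z hz => (h z hz).2) hz
  set l := (‖z₀‖ + r) ^ (2 * m)
  set l' := (‖z₀‖ + 2 * r) ^ (2 * m)
  have hl : l' ≤ 4 ^ m * l := by
    calc l' ≤ (2 * (‖z₀‖ + r)) ^ (2 * m) := by
          have := norm_nonneg z₀
          simp only [l']
          gcongr
          linarith
      _ = 4 ^ m * l := by
          rw [mul_pow, pow_mul 2 2 m]
          norm_num [l]
  have hl0 : 0 ≤ l := by positivity
  have hn := norm_nonneg (z - z₀)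
  have e1 : 2 * (C * l') + K * l' ≤ (2 * C + K) * 4 ^ m * l := by
    rw [mul_assoc _ _ l]
    nlinarith
  refine ⟨h1.trans (by gcongr), h2.trans (by gcongr), h3.trans ?_⟩
  have : 4 * (C * l') ≤ 2 * ((2 * C + K) * 4 ^ m) * l := by
    have : 0 ≤ K * l' := by positivity
    linarith
  gcongr

/-- The supremum `S` of the horizontal gradient on the ball times the area `T` of the part of the
graph in the model box is `O(r κ)`, with `κ` the height of the box: the graph lies over a strip
whose width is inversely proportional to the horizontal gradient at `z₀`, unless that gradient is
so small that the trivial bound `4 r²` for the area is enough. -/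
theorem HessianBound.exists_upper (m : ℕ) {C : ℝ} (hC : 0 ≤ C) : ∃ C' : ℝ, 0 < C' ∧
    ∀ φ z₀ r, 0 < r → HessianBound m C φ z₀ r → ∃ S T : ℝ, 0 ≤ S ∧ 0 ≤ T ∧
      S * T ≤ C' * (r * boxHeight m (graphPoint φ z₀) r) ∧
      volume {z | z ∈ Metric.ball z₀ (2 * r) ∧
        graphPoint φ z ∈ modelBox m (graphPoint φ z₀) r} ≤ ENNReal.ofReal T ∧
      ∀ z ∈ Metric.ball z₀ (2 * r), √(graphX m φ z ^ 2 + graphY m φ z ^ 2) ≤ S := by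
  obtain ⟨L, hL1, hL⟩ := HessianBound.exists_estimates m hC
  refine ⟨(1 + 4 * L) * (8 * (2 + 8 * L)), by positivity, fun φ z₀ r hr h => ?_⟩
  have hest := hL φ z₀ r hr h
  set δ := √(graphX m φ z₀ ^ 2 + graphY m φ z₀ ^ 2) with hδ
  have hδ0 : 0 ≤ δ := Real.sqrt_nonneg _
  have hbox : boxHeight m (graphPoint φ z₀) r = r ^ 2 * (‖z₀‖ + r) ^ (2 * m) := by
    rw [boxHeight, axisDist_graphPoint]
  set κ := boxHeight m (graphPoint φ z₀) r with hκ
  have hκ0 : 0 < κ := boxHeight_pos m _ hr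
  set l := (‖z₀‖ + r) ^ (2 * m) with hl
  have hl0 : 0 < l := by
    have := norm_nonneg z₀
    positivity
  have hnorm : ∀ z ∈ Metric.ball z₀ (2 * r), ‖z - z₀‖ < 2 * r := fun z hz => by
    rw [← dist_eq_norm]
    exact hz
  have hS : ∀ z ∈ Metric.ball z₀ (2 * r), √(graphX m φ z ^ 2 + graphY m φ z ^ 2) ≤
      δ + 4 * L * (r * l) := by
    intro z hz
    obtain ⟨h1, h2, -⟩ := hest z hz
    refine (sqrt_sq_add_sq_le_add _ _ (graphX m φ z₀) (graphY m φ z₀)).trans ?_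
    have : L * l * ‖z - z₀‖ ≤ L * l * (2 * r) := by
      gcongr
      exact (hnorm z hz).le
    linarith
  rcases le_or_gt δ (r * l) with hle | hgt
  · refine ⟨(1 + 4 * L) * (r * l), 4 * r * r, by positivity, by positivity, ?_, ?_,
      fun z hz => (hS z hz).trans (by linarith)⟩
    · rw [hbox]
      have : 0 ≤ (1 + 4 * L) * (r * (r ^ 2 * l)) := by positivity
      nlinarith
    · rw [← volume_rectangle z₀ hr.le hr.le]
      exact measure_mono fun z hz => ⟨hz.2.1, hz.2.2.1⟩
  · have hδpos : 0 < δ := lt_of_le_of_lt (by positivity) hgt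
    have hδsq : graphX m φ z₀ ^ 2 + graphY m φ z₀ ^ 2 = δ ^ 2 := (Real.sq_sqrt (by positivity)).symm
    refine ⟨(1 + 4 * L) * δ, 4 * ((2 + 8 * L) * κ) * (2 * r * δ) / δ ^ 2, by positivity,
      by positivity, ?_, ?_, fun z hz => (hS z hz).trans (by nlinarith)⟩
    · refine le_of_eq ?_
      field_simp
      ring
    · rw [← hδsq, ← volume_rotated_rectangle (graphX m φ z₀) (graphY m φ z₀)
        (by rw [hδsq]; positivity) z₀ (by positivity) (by positivity)]
      refine measure_mono fun z hz => ⟨?_, ?_⟩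
      · obtain ⟨-, -, h3⟩ := hest z hz.1
        have hh := hz.2.2.2
        rw [← hκ] at hh
        have : 2 * L * l * ‖z - z₀‖ ^ 2 ≤ 2 * L * l * (2 * r) ^ 2 := by
          gcongr
          exact (hnorm z hz.1).le
        have e : 2 * L * l * (2 * r) ^ 2 = 8 * L * κ := by
          rw [hbox]
          ring
        rw [abs_lt] at hh ⊢
        rw [abs_le] at h3
        constructor <;> nlinarith
      · have := abs_mul_add_mul_le (-graphY m φ z₀) (graphX m φ z₀) (z - z₀)
        rw [neg_sq, add_comm (graphY m φ z₀ ^ 2), ← hδ] at this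
        refine lt_of_le_of_lt this ?_
        rw [mul_comm]
        exact mul_lt_mul_of_pos_right (hnorm z hz.1) hδpos

/-- The horizontal gradient has integral at least of order `r κ` over a set above which the graph
lies in the model box: a rectangle in the strip where the height is small if the gradient is large
at `z₀`, and a ball, by `exists_le_lintegral_graph`, if it is small there. -/
theorem HessianBound.exists_lower (m : ℕ) {C : ℝ} (hC : 0 ≤ C) : ∃ c : ℝ, 0 < c ∧
    ∀ φ z₀ r, 0 < r → HessianBound m C φ z₀ r → ∃ D : Set (EuclideanSpace ℝ (Fin 2)),
      MeasurableSet D ∧ D ⊆ Metric.ball z₀ r ∧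
      (∀ z ∈ D, graphPoint φ z ∈ modelBox m (graphPoint φ z₀) r) ∧
      ENNReal.ofReal (c * (r * boxHeight m (graphPoint φ z₀) r)) ≤
        ∫⁻ z in D, ENNReal.ofReal √(graphX m φ z ^ 2 + graphY m φ z ^ 2) := by
  obtain ⟨L, hL1, hL⟩ := HessianBound.exists_estimates m hC
  obtain ⟨c₁, hc₁, hcurl⟩ := exists_le_lintegral_graph m
  obtain ⟨ε, hε⟩ : ∃ ε, ε = 1 / (4 * L) := ⟨_, rfl⟩
  have hε0 : 0 < ε := by rw [hε]; positivity
  have hLε : L * ε = 1 / 4 := by rw [hε]; field_simp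
  have hε1 : ε ≤ 1 / 4 := by nlinarith
  refine ⟨min (ε ^ 2 / 2) (c₁ * ε ^ 3 * ε ^ (2 * m)), by positivity, fun φ z₀ r hr h => ?_⟩
  have hest := hL φ z₀ r hr h
  set δ := √(graphX m φ z₀ ^ 2 + graphY m φ z₀ ^ 2) with hδ
  have hδ0 : 0 ≤ δ := Real.sqrt_nonneg _
  have hbox : boxHeight m (graphPoint φ z₀) r = r ^ 2 * (‖z₀‖ + r) ^ (2 * m) := by
    rw [boxHeight, axisDist_graphPoint]
  set κ := boxHeight m (graphPoint φ z₀) r with hκ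
  have hκ0 : 0 < κ := boxHeight_pos m _ hr
  set l := (‖z₀‖ + r) ^ (2 * m) with hl
  have hz₀ := norm_nonneg z₀
  have hl0 : 0 < l := by positivity
  have hεr : ε * r ≤ r / 4 := by nlinarith
  -- Within distance `ε r` of `z₀` the graph stays in the box where the linear part is small.
  have hmem : ∀ z, ‖z - z₀‖ < ε * r →
      |graphX m φ z₀ * (z 0 - z₀ 0) + graphY m φ z₀ * (z 1 - z₀ 1)| ≤ κ / 2 →
      graphPoint φ z ∈ modelBox m (graphPoint φ z₀) r := by
    intro z hz hlin
    obtain ⟨-, -, h3⟩ := hest z (by rw [Metric.mem_ball, dist_eq_norm]; linarith)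
    have h0 : |z 0 - z₀ 0| ≤ ‖z - z₀‖ := abs_apply_le_norm (z - z₀) 0
    have h1 : |z 1 - z₀ 1| ≤ ‖z - z₀‖ := abs_apply_le_norm (z - z₀) 1
    refine ⟨lt_of_le_of_lt h0 (by linarith), lt_of_le_of_lt h1 (by linarith), ?_⟩
    have : 2 * L * l * ‖z - z₀‖ ^ 2 ≤ 2 * L * l * (ε * r) ^ 2 := by gcongr
    have e : 2 * L * l * (ε * r) ^ 2 = ε / 2 * κ := by
      rw [hbox]
      linear_combination 2 * l * ε * r ^ 2 * hLε
    have : ε / 2 * κ ≤ κ / 8 := by nlinarith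
    rw [← hκ]
    rw [abs_le] at h3 hlin
    rw [abs_lt]
    constructor <;> linarith
  rcases le_or_gt (r * l) δ with hge | hlt
  · have hδpos : 0 < δ := lt_of_lt_of_le (by positivity) hge
    have hδsq : graphX m φ z₀ ^ 2 + graphY m φ z₀ ^ 2 = δ ^ 2 := (Real.sq_sqrt (by positivity)).symm
    have hκδ : κ ≤ r * δ := by
      rw [hbox]
      nlinarith
    set D := {z : EuclideanSpace ℝ (Fin 2) |
        |graphX m φ z₀ * (z 0 - z₀ 0) + graphY m φ z₀ * (z 1 - z₀ 1)| < ε * κ / 2 ∧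
        |-graphY m φ z₀ * (z 0 - z₀ 0) + graphX m φ z₀ * (z 1 - z₀ 1)| < ε * r * δ / 2} with hD
    have hvol := volume_rotated_rectangle (graphX m φ z₀) (graphY m φ z₀)
      (by rw [hδsq]; positivity) z₀ (a := ε * κ / 2) (b := ε * r * δ / 2) (by positivity)
      (by positivity)
    have hDm : MeasurableSet D := by
      refine IsOpen.measurableSet (IsOpen.and ?_ ?_) <;>
      exact isOpen_lt (by fun_prop) continuous_const
    have hDn : ∀ z ∈ D, ‖z - z₀‖ < ε * r := by
      intro z hz
      have s1 := sq_lt_sq' (abs_lt.1 hz.1).1 (abs_lt.1 hz.1).2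
      have s2 := sq_lt_sq' (abs_lt.1 hz.2).1 (abs_lt.1 hz.2).2
      have s3 : (ε * κ / 2) ^ 2 ≤ (ε * r * δ / 2) ^ 2 := by
        gcongr ?_ ^ 2
        nlinarith
      have e : δ ^ 2 * ‖z - z₀‖ ^ 2 =
          (graphX m φ z₀ * (z 0 - z₀ 0) + graphY m φ z₀ * (z 1 - z₀ 1)) ^ 2 +
          (-graphY m φ z₀ * (z 0 - z₀ 0) + graphX m φ z₀ * (z 1 - z₀ 1)) ^ 2 := by
        rw [norm_sq_plane, ← hδsq]
        simp only [PiLp.sub_apply]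
        ring
      refine lt_of_pow_lt_pow_left₀ 2 (by positivity) ?_
      have : δ ^ 2 * ‖z - z₀‖ ^ 2 < δ ^ 2 * (ε * r) ^ 2 := by
        have : 0 < (ε * r * δ) ^ 2 := by positivity
        nlinarith
      exact lt_of_mul_lt_mul_left this (by positivity)
    refine ⟨D, hDm, fun z hz => ?_, fun z hz => hmem z (hDn z hz) ?_, ?_⟩
    · rw [Metric.mem_ball, dist_eq_norm]
      linarith [hDn z hz]
    · have := hz.1.le
      nlinarith
    · calc ENNReal.ofReal _ ≤ ENNReal.ofReal (δ / 2) * volume D := by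
            rw [hvol, hδsq, ← ENNReal.ofReal_mul (by positivity)]
            refine ENNReal.ofReal_le_ofReal ?_
            calc _ ≤ ε ^ 2 / 2 * (r * κ) := by
                  gcongr
                  exact min_le_left _ _
              _ = _ := by field_simp; ring
        _ = ∫⁻ z in D, ENNReal.ofReal (δ / 2) := by rw [setLIntegral_const]
        _ ≤ _ := by
            refine setLIntegral_mono' hDm fun z hz => ENNReal.ofReal_le_ofReal ?_
            have hzn := hDn z hz
            obtain ⟨h1, h2, -⟩ := hest z (by rw [Metric.mem_ball, dist_eq_norm]; linarith)
            have := sqrt_sq_add_sq_le_add (graphX m φ z₀) (graphY m φ z₀) (graphX m φ z)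
              (graphY m φ z)
            rw [abs_sub_comm (graphX m φ z₀), abs_sub_comm (graphY m φ z₀), ← hδ] at this
            have b : L * l * ‖z - z₀‖ ≤ L * l * (ε * r) := by gcongr
            have e : L * l * (ε * r) = r * l / 4 := by linear_combination l * r * hLε
            linarith
  · refine ⟨Metric.ball z₀ (ε * r), measurableSet_ball,
      Metric.ball_subset_ball (by linarith), fun z hz => ?_, ?_⟩
    · rw [Metric.mem_ball, dist_eq_norm] at hz
      refine hmem z hz ((abs_mul_add_mul_le _ _ (z - z₀)).trans ?_)
      rw [← hδ]
      calc δ * ‖z - z₀‖ ≤ r * l * (ε * r) := by gcongr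
        _ = ε * κ := by rw [hbox]; ring
        _ ≤ κ / 2 := by nlinarith
    · refine le_trans (ENNReal.ofReal_le_ofReal ?_) (hcurl φ z₀ (ε * r) (by positivity)
        fun z hz => (h z (Metric.ball_subset_ball (by linarith) hz)).1)
      have hlow : ε ^ (2 * m) * l ≤ (‖z₀‖ + ε * r) ^ (2 * m) := by
        rw [hl, ← mul_pow]
        gcongr
        nlinarith
      calc _ ≤ c₁ * ε ^ 3 * ε ^ (2 * m) * (r * κ) := by
            gcongr
            exact min_le_right _ _
        _ = c₁ * (ε * r) ^ 3 * (ε ^ (2 * m) * l) := by rw [hbox]; ring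
        _ ≤ _ := by gcongr

/-! ### The density of the horizontal perimeter -/

/-- The density `√(⟨N, X⟩² + ⟨N, Y⟩²)` of the horizontal perimeter. -/
noncomputable def perimeterDensity (m : ℕ) (Ω : Set (EuclideanSpace ℝ (Fin 3)))
    (p : EuclideanSpace ℝ (Fin 3)) : ℝ :=
  √(inner ℝ (unitNormal Ω p) (fieldX m p) ^ 2 + inner ℝ (unitNormal Ω p) (fieldY m p) ^ 2)

theorem IsLocalDefiningFunction.perimeterDensity_eq {Ω U : Set (EuclideanSpace ℝ (Fin 3))}
    {p : EuclideanSpace ℝ (Fin 3)} {F : EuclideanSpace ℝ (Fin 3) → ℝ}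
    (h : IsLocalDefiningFunction Ω p U F) (m : ℕ) : perimeterDensity m Ω p =
      ‖gradient F p‖⁻¹ * √(fderiv ℝ F p (fieldX m p) ^ 2 + fderiv ℝ F p (fieldY m p) ^ 2) := by
  have e : ∀ v, inner ℝ (gradient F p) v = fderiv ℝ F p v := fun v => by simp [gradient]
  rw [perimeterDensity, h.unitNormal_eq, real_inner_smul_left, real_inner_smul_left, e, e,
    mul_pow, mul_pow, ← mul_add, Real.sqrt_mul (by positivity), Real.sqrt_sq (by positivity)]

theorem horizontalPerimeter_le {m : ℕ} {Ω S : Set (EuclideanSpace ℝ (Fin 3))}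
    (hS : MeasurableSet S) {M : ℝ} (h : ∀ q ∈ frontier Ω ∩ S, perimeterDensity m Ω q ≤ M) :
    horizontalPerimeter m Ω S ≤
      ENNReal.ofReal M * (μHE[2] : Measure (EuclideanSpace ℝ (Fin 3))) (frontier Ω ∩ S) := by
  have hm : MeasurableSet (frontier Ω ∩ S) := isClosed_frontier.measurableSet.inter hS
  rw [horizontalPerimeter, withDensity_apply _ hS, Measure.restrict_restrict hS, inter_comm S,
    ← setLIntegral_const]
  exact setLIntegral_mono' hm fun q hq => ENNReal.ofReal_le_ofReal (h q hq)

/-- A lower bound for the horizontal perimeter by an integral over a planar Lipschitz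
projection. -/
theorem setLIntegral_le_horizontalPerimeter {m : ℕ} {Ω S : Set (EuclideanSpace ℝ (Fin 3))}
    (hS : MeasurableSet S) {P : EuclideanSpace ℝ (Fin 3) → EuclideanSpace ℝ (Fin 2)} {K : NNReal}
    (hP : LipschitzWith K P) {D : Set (EuclideanSpace ℝ (Fin 2))} (hD : MeasurableSet D)
    (hDP : D ⊆ P '' (frontier Ω ∩ S)) {g : EuclideanSpace ℝ (Fin 2) → ℝ≥0∞}
    (hg : ∀ q ∈ frontier Ω ∩ S, P q ∈ D → g (P q) ≤ ENNReal.ofReal (perimeterDensity m Ω q)) :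
    ∫⁻ z in D, g z ≤ (K : ℝ≥0∞) ^ 2 * horizontalPerimeter m Ω S := by
  set ν : Measure (EuclideanSpace ℝ (Fin 3)) := μHE[2]
  have hPm : Measurable P := hP.continuous.measurable
  have hFS : MeasurableSet (frontier Ω ∩ S) := isClosed_frontier.measurableSet.inter hS
  set T := frontier Ω ∩ S ∩ P ⁻¹' D with hT
  have hTm : MeasurableSet T := hFS.inter (hPm hD)
  have hle : (volume : Measure (EuclideanSpace ℝ (Fin 2))).restrict D ≤
      (K : ℝ≥0∞) ^ 2 • Measure.map P (ν.restrict T) := by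
    refine Measure.le_iff.2 fun B hB => ?_
    rw [Measure.restrict_apply hB, Measure.smul_apply, Measure.map_apply hPm hB,
      Measure.restrict_apply (hPm hB), smul_eq_mul]
    have hsub : B ∩ D ⊆ P '' (P ⁻¹' B ∩ T) := by
      rintro z ⟨hzB, hzD⟩
      obtain ⟨q, hq, rfl⟩ := hDP hzD
      exact ⟨q, ⟨hzB, hq, hzD⟩, rfl⟩
    calc volume (B ∩ D) ≤ volume (P '' (P ⁻¹' B ∩ T)) := measure_mono hsub
      _ ≤ _ := by
        rw [← EuclideanSpace.euclideanHausdorffMeasure_eq_volume]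
        exact (hP.lipschitzOnWith (s := P ⁻¹' B ∩ T)).euclideanHausdorffMeasure_image_le
  calc ∫⁻ z in D, g z ≤ ∫⁻ z, g z ∂((K : ℝ≥0∞) ^ 2 • Measure.map P (ν.restrict T)) :=
        lintegral_mono' hle le_rfl
    _ = (K : ℝ≥0∞) ^ 2 * ∫⁻ z, g z ∂(Measure.map P (ν.restrict T)) := by
        rw [lintegral_smul_measure, smul_eq_mul]
    _ ≤ (K : ℝ≥0∞) ^ 2 * ∫⁻ q in T, g (P q) ∂ν := by
        gcongr
        exact lintegral_map_le _ _
    _ ≤ (K : ℝ≥0∞) ^ 2 * ∫⁻ q in T, ENNReal.ofReal (perimeterDensity m Ω q) ∂ν := by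
        gcongr 1
        exact setLIntegral_mono' hTm fun q hq => hg q hq.1 hq.2
    _ ≤ (K : ℝ≥0∞) ^ 2 * ∫⁻ q in frontier Ω ∩ S, ENNReal.ofReal (perimeterDensity m Ω q) ∂ν := by
        gcongr
        exact inter_subset_left
    _ = _ := by
        rw [horizontalPerimeter, withDensity_apply _ hS, Measure.restrict_restrict hS,
          inter_comm S]
        rfl

theorem isOpen_modelBox (m : ℕ) (p : EuclideanSpace ℝ (Fin 3)) (r : ℝ) :
    IsOpen (modelBox m p r) := by
  unfold modelBox heightAbove
  refine IsOpen.and ?_ (IsOpen.and ?_ ?_) <;> exact isOpen_lt (by fun_prop) continuous_const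

theorem space_eq (v : EuclideanSpace ℝ (Fin 3)) :
    v = v 0 • EuclideanSpace.single 0 (1 : ℝ) + v 1 • EuclideanSpace.single 1 (1 : ℝ) +
      v 2 • EuclideanSpace.single 2 (1 : ℝ) := by
  ext i
  fin_cases i <;> simp

theorem norm_space_le (v : EuclideanSpace ℝ (Fin 3)) : ‖v‖ ≤ |v 0| + |v 1| + |v 2| := by
  conv_lhs => rw [space_eq v]
  refine (norm_add₃_le).trans (le_of_eq ?_)
  simp [norm_smul]

theorem axisDist_le_norm (p : EuclideanSpace ℝ (Fin 3)) : axisDist p ≤ ‖p‖ := by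
  rw [axisDist, EuclideanSpace.norm_eq]
  refine Real.sqrt_le_sqrt ?_
  simp [Fin.sum_univ_succ]
  positivity

/-- Model boxes have Euclidean diameter `O(r)`, locally uniformly in the centre. -/
theorem norm_sub_le_of_mem_modelBox {m : ℕ} {p q : EuclideanSpace ℝ (Fin 3)} {r B : ℝ}
    (hr1 : r ≤ 1) (hB : 0 ≤ B) (hp : ‖p‖ ≤ B) (hq : q ∈ modelBox m p r) :
    ‖q - p‖ ≤ (2 + (B + 1) ^ (2 * m) + B ^ (2 * m) * (2 * B)) * r := by
  obtain ⟨h0, h1, h2⟩ := hq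
  have hr : 0 < r := (abs_nonneg _).trans_lt h0
  have hA := axisDist_nonneg p
  have hAB : axisDist p ≤ B := (axisDist_le_norm p).trans hp
  have hbox : boxHeight m p r ≤ (B + 1) ^ (2 * m) * r := by
    rw [boxHeight]
    calc r ^ 2 * (axisDist p + r) ^ (2 * m) ≤ r * (B + 1) ^ (2 * m) := by
          gcongr
          nlinarith
      _ = _ := mul_comm _ _
  have hl : (p 0 ^ 2 + p 1 ^ 2) ^ m ≤ B ^ (2 * m) := by
    rw [← axisDist_sq, ← pow_mul]
    gcongr
  have b0 := (abs_apply_le_norm p 0).trans hp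
  have b1 := (abs_apply_le_norm p 1).trans hp
  have e : q 2 - p 2 = heightAbove m p q +
      (p 0 ^ 2 + p 1 ^ 2) ^ m * (p 1 * (q 0 - p 0) - p 0 * (q 1 - p 1)) := by
    rw [heightAbove]
    ring
  have h3 : |p 1 * (q 0 - p 0) - p 0 * (q 1 - p 1)| ≤ 2 * B * r := by
    refine (abs_sub _ _).trans ?_
    rw [abs_mul, abs_mul]
    have := mul_le_mul b1 h0.le (abs_nonneg _) hB
    have := mul_le_mul b0 h1.le (abs_nonneg _) hB
    linarith
  have h4 : |q 2 - p 2| ≤ (B + 1) ^ (2 * m) * r + B ^ (2 * m) * (2 * B * r) := by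
    rw [e]
    refine (abs_add_le _ _).trans (add_le_add (h2.le.trans hbox) ?_)
    rw [abs_mul, abs_of_nonneg (by positivity)]
    gcongr
  refine (norm_space_le _).trans ?_
  simp only [PiLp.sub_apply]
  linarith

theorem eventually_modelBox_subset (m : ℕ) {p : EuclideanSpace ℝ (Fin 3)}
    {U : Set (EuclideanSpace ℝ (Fin 3))} (hU : U ∈ 𝓝 p) : ∃ r₀ : ℝ, 0 < r₀ ∧ ∃ W ∈ 𝓝 p,
      ∀ q ∈ W, ∀ r, r ≤ r₀ → modelBox m q r ⊆ U := by
  obtain ⟨ε, hε, hball⟩ := Metric.mem_nhds_iff.1 hU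
  set B := ‖p‖ + 1 with hB
  have hB0 : 0 ≤ B := by positivity
  set K := 2 + (B + 1) ^ (2 * m) + B ^ (2 * m) * (2 * B) with hK
  have hK0 : 0 < K := by positivity
  refine ⟨min 1 (ε / (2 * K)), by positivity, Metric.ball p (min 1 (ε / 2)),
    Metric.ball_mem_nhds _ (by positivity), fun q hq r hr x hx => hball ?_⟩
  rw [Metric.mem_ball] at hq ⊢
  have hq1 := hq.trans_le (min_le_left _ _)
  have hq2 := hq.trans_le (min_le_right _ _)
  have hqB : ‖q‖ ≤ B := by
    have := norm_sub_norm_le q p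
    rw [← dist_eq_norm] at this
    linarith
  have h1 := norm_sub_le_of_mem_modelBox (hr.trans (min_le_left _ _)) hB0 hqB hx
  have h2 : K * r ≤ ε / 2 := by
    have := hr.trans (min_le_right _ _)
    rw [le_div_iff₀ (by positivity)] at this
    linarith
  have := dist_triangle x q p
  rw [dist_eq_norm x q] at this
  linarith

/-- The horizontal perimeter of model boxes of radius `r` at boundary points near `p` is
comparable to `r · r² (|z| + r)^{2m}`. -/
def PerimeterEstimateNear (m : ℕ) (Ω : Set (EuclideanSpace ℝ (Fin 3)))
    (p : EuclideanSpace ℝ (Fin 3)) : Prop :=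
  ∃ C : ℝ, 0 < C ∧ ∃ r₀ : ℝ, 0 < r₀ ∧ ∃ W ∈ 𝓝 p, ∀ q ∈ frontier Ω ∩ W, ∀ r, 0 < r → r ≤ r₀ →
    ENNReal.ofReal (C⁻¹ * (r * boxHeight m q r)) ≤ horizontalPerimeter m Ω (modelBox m q r) ∧
    horizontalPerimeter m Ω (modelBox m q r) ≤ ENNReal.ofReal (C * (r * boxHeight m q r))

theorem perimeterEstimateNear_of_bounds {m : ℕ} {Ω : Set (EuclideanSpace ℝ (Fin 3))}
    {p : EuclideanSpace ℝ (Fin 3)} {c C r₀ : ℝ} (hc : 0 < c) (hC : 0 < C) (hr₀ : 0 < r₀)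
    {W : Set (EuclideanSpace ℝ (Fin 3))} (hW : W ∈ 𝓝 p)
    (h : ∀ q ∈ frontier Ω ∩ W, ∀ r, 0 < r → r ≤ r₀ →
      ENNReal.ofReal (c * (r * boxHeight m q r)) ≤ horizontalPerimeter m Ω (modelBox m q r) ∧
      horizontalPerimeter m Ω (modelBox m q r) ≤ ENNReal.ofReal (C * (r * boxHeight m q r))) :
    PerimeterEstimateNear m Ω p := by
  refine ⟨max C c⁻¹, by positivity, r₀, hr₀, W, hW, fun q hq r hr hr' => ?_⟩
  have hpos := (boxHeight_pos m q hr).le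
  obtain ⟨h1, h2⟩ := h q hq r hr hr'
  refine ⟨le_trans (ENNReal.ofReal_le_ofReal ?_) h1, h2.trans (ENNReal.ofReal_le_ofReal ?_)⟩
  · gcongr
    exact inv_le_of_inv_le₀ hc (le_max_right _ _)
  · gcongr
    exact le_max_left _ _

/-! ### Boundary points near which the boundary is an admissible graph -/

theorem fieldX_eq (m : ℕ) (p : EuclideanSpace ℝ (Fin 3)) : fieldX m p =
    EuclideanSpace.single 0 (1 : ℝ) +
      ((p 0 ^ 2 + p 1 ^ 2) ^ m * p 1) • EuclideanSpace.single 2 (1 : ℝ) := by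
  ext i
  fin_cases i <;> simp [fieldX]

theorem fieldY_eq (m : ℕ) (p : EuclideanSpace ℝ (Fin 3)) : fieldY m p =
    EuclideanSpace.single 1 (1 : ℝ) -
      ((p 0 ^ 2 + p 1 ^ 2) ^ m * p 0) • EuclideanSpace.single 2 (1 : ℝ) := by
  ext i
  fin_cases i <;> simp [fieldY]

theorem graphPoint_eq (φ : EuclideanSpace ℝ (Fin 2) → ℝ) (z : EuclideanSpace ℝ (Fin 2)) :
    graphPoint φ z = z 0 • EuclideanSpace.single 0 (1 : ℝ) +
      z 1 • EuclideanSpace.single 1 (1 : ℝ) + φ z • EuclideanSpace.single 2 (1 : ℝ) :=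
  space_eq _

/-- At a boundary point in the graph of `φ`, the density is the length of the horizontal gradient
of `φ(z) - t` divided by that of its Euclidean gradient. -/
theorem perimeterDensity_graphPoint {m : ℕ} {Ω : Set (EuclideanSpace ℝ (Fin 3))}
    (hΩ : HasSmoothBoundary Ω) {φ : EuclideanSpace ℝ (Fin 2) → ℝ} {z : EuclideanSpace ℝ (Fin 2)}
    (hφ : DifferentiableAt ℝ φ z) (hg : ∀ᶠ w in 𝓝 z, graphPoint φ w ∈ frontier Ω) :
    perimeterDensity m Ω (graphPoint φ z) =
      √(graphX m φ z ^ 2 + graphY m φ z ^ 2) /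
        √(1 + fderiv ℝ φ z (EuclideanSpace.single 0 1) ^ 2 +
          fderiv ℝ φ z (EuclideanSpace.single 1 1) ^ 2) := by
  obtain ⟨U, F, hF⟩ := hΩ _ hg.self_of_nhds
  rw [hF.perimeterDensity_eq]
  set q := graphPoint φ z with hq
  have hFd : HasFDerivAt F (fderiv ℝ F q) q :=
    ((hF.smooth.contDiffAt (hF.isOpen.mem_nhds hF.mem)).differentiableAt (by simp)).hasFDerivAt
  set G : Fin 3 → ℝ := fun j => fderiv ℝ F q (EuclideanSpace.single j 1) with hG
  -- Differentiating `F(z, φ(z)) = 0` gives the tangency relations.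
  have htan : ∀ v : EuclideanSpace ℝ (Fin 2),
      v 0 * G 0 + v 1 * G 1 + fderiv ℝ φ z v * G 2 = 0 := by
    intro v
    have hz : HasDerivAt (fun s : ℝ => z + s • v) v 0 := by
      simpa using ((hasDerivAt_id (0 : ℝ)).smul_const v).const_add z
    have hz0 : z + (0 : ℝ) • v = z := by simp
    have hc : ∀ i : Fin 2, HasDerivAt (fun s : ℝ => (z + s • v) i) (v i) 0 := fun i =>
      (EuclideanSpace.proj i : EuclideanSpace ℝ (Fin 2) →L[ℝ] ℝ).hasFDerivAt.comp_hasDerivAt 0 hz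
    have hφ' : HasDerivAt (fun s : ℝ => φ (z + s • v)) (fderiv ℝ φ z v) 0 := by
      have : HasFDerivAt φ (fderiv ℝ φ z) (z + (0 : ℝ) • v) := by rw [hz0]; exact hφ.hasFDerivAt
      exact this.comp_hasDerivAt 0 hz
    have hgr : HasDerivAt (fun s : ℝ => graphPoint φ (z + s • v))
        (v 0 • EuclideanSpace.single 0 (1 : ℝ) + v 1 • EuclideanSpace.single 1 (1 : ℝ) +
          fderiv ℝ φ z v • EuclideanSpace.single 2 (1 : ℝ)) 0 := by
      simp only [graphPoint_eq]
      exact (((hc 0).smul_const _).add ((hc 1).smul_const _)).add (hφ'.smul_const _)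
    have hFd' : HasFDerivAt F (fderiv ℝ F q) (graphPoint φ (z + (0 : ℝ) • v)) := by
      rw [hz0]; exact hFd
    have hcomp := hFd'.comp_hasDerivAt 0 hgr
    have hzero : HasDerivAt (F ∘ fun s : ℝ => graphPoint φ (z + s • v)) 0 0 := by
      refine (hasDerivAt_const (0 : ℝ) (0 : ℝ)).congr_of_eventuallyEq ?_
      have t1 : Tendsto (fun s : ℝ => z + s • v) (𝓝 0) (𝓝 z) := by
        simpa [hz0] using hz.continuousAt.tendsto
      have t2 : Tendsto (fun s : ℝ => graphPoint φ (z + s • v)) (𝓝 0) (𝓝 q) := by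
        simpa [hz0] using hgr.continuousAt.tendsto
      filter_upwards [t1.eventually hg, t2.eventually (hF.isOpen.mem_nhds hF.mem)] with s h1 h2
      exact (hF.boundary _ h2).1 h1
    have := hcomp.unique hzero
    simpa [hG] using this
  set a := fderiv ℝ φ z (EuclideanSpace.single 0 1) with ha
  set b := fderiv ℝ φ z (EuclideanSpace.single 1 1) with hb
  have g0 : G 0 = -(a * G 2) := by
    have := htan (EuclideanSpace.single 0 1)
    simp at this
    linarith
  have g1 : G 1 = -(b * G 2) := by
    have := htan (EuclideanSpace.single 1 1)
    simp at this
    linarith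
  have hgrad : ∀ i, gradient F q i = G i := by
    intro i
    have : inner ℝ (gradient F q) (EuclideanSpace.single i (1 : ℝ)) =
      fderiv ℝ F q (EuclideanSpace.single i 1) := by simp [gradient]
    rw [EuclideanSpace.inner_single_right] at this
    simpa using this
  have hnorm : ‖gradient F q‖ = |G 2| * √(1 + a ^ 2 + b ^ 2) := by
    rw [EuclideanSpace.norm_eq, ← Real.sqrt_sq_eq_abs, ← Real.sqrt_mul (sq_nonneg _)]
    congr 1
    simp only [Fin.sum_univ_three, hgrad, Real.norm_eq_abs, sq_abs, g0, g1]
    ring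
  have hG2 : G 2 ≠ 0 := by
    intro h0
    have := norm_pos_iff.2 (hF.gradient_ne_zero q hF.mem)
    rw [hnorm, h0] at this
    simp at this
  have hX : fderiv ℝ F q (fieldX m q) = -G 2 * graphX m φ z := by
    rw [fieldX_eq, map_add, map_smul]
    change G 0 + ((q 0 ^ 2 + q 1 ^ 2) ^ m * q 1) * G 2 = _
    rw [g0]
    change -(a * G 2) + ((z 0 ^ 2 + z 1 ^ 2) ^ m * z 1) * G 2 =
      -G 2 * (a - (z 0 ^ 2 + z 1 ^ 2) ^ m * z 1)
    ring
  have hY : fderiv ℝ F q (fieldY m q) = -G 2 * graphY m φ z := by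
    rw [fieldY_eq, map_sub, map_smul]
    change G 1 - ((q 0 ^ 2 + q 1 ^ 2) ^ m * q 0) * G 2 = _
    rw [g1]
    change -(b * G 2) - ((z 0 ^ 2 + z 1 ^ 2) ^ m * z 0) * G 2 =
      -G 2 * (b + (z 0 ^ 2 + z 1 ^ 2) ^ m * z 0)
    ring
  have habs : 0 < |G 2| := abs_pos.2 hG2
  rw [hnorm, hX, hY, mul_pow, mul_pow, ← mul_add, Real.sqrt_mul (sq_nonneg _),
    Real.sqrt_sq_eq_abs, abs_neg]
  have : 0 < √(1 + a ^ 2 + b ^ 2) := by positivity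
  field_simp

theorem lipschitzOnWith_graphPoint {φ : EuclideanSpace ℝ (Fin 2) → ℝ}
    {s : Set (EuclideanSpace ℝ (Fin 2))} {K : ℝ} (hK : 0 ≤ K)
    (h : ∀ z ∈ s, ∀ w ∈ s, |φ z - φ w| ≤ K * ‖z - w‖) :
    LipschitzOnWith (2 + K).toNNReal (graphPoint φ) s := by
  rw [lipschitzOnWith_iff_dist_le_mul]
  intro z hz w hw
  rw [Real.coe_toNNReal _ (by positivity), dist_eq_norm, dist_eq_norm]
  refine (norm_space_le _).trans ?_
  have h0 := abs_apply_le_norm (z - w) 0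
  have h1 := abs_apply_le_norm (z - w) 1
  have h2 := h z hz w hw
  have e : ∀ i, (graphPoint φ z - graphPoint φ w) i = ![z 0 - w 0, z 1 - w 1, φ z - φ w] i := by
    intro i
    fin_cases i <;> simp [graphPoint]
  rw [e, e, e]
  change |z 0 - w 0| + |z 1 - w 1| + |φ z - φ w| ≤ _
  simp only [PiLp.sub_apply] at h0 h1
  linarith

/-- The projection `(z, t) ↦ z`. -/
def planeProjection (p : EuclideanSpace ℝ (Fin 3)) : EuclideanSpace ℝ (Fin 2) := !₂[p 0, p 1]

theorem lipschitzWith_planeProjection : LipschitzWith 1 planeProjection := by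
  refine LipschitzWith.of_dist_le_mul fun p q => ?_
  rw [NNReal.coe_one, one_mul, dist_eq_norm, dist_eq_norm, EuclideanSpace.norm_eq,
    EuclideanSpace.norm_eq]
  refine Real.sqrt_le_sqrt ?_
  simp [planeProjection, Fin.sum_univ_succ]
  positivity

theorem planeProjection_graphPoint (φ : EuclideanSpace ℝ (Fin 2) → ℝ)
    (z : EuclideanSpace ℝ (Fin 2)) : planeProjection (graphPoint φ z) = z := by
  ext i
  fin_cases i <;> rfl

/-- The plane estimates `HessianBound.exists_upper` and `HessianBound.exists_lower`, carried to the
boundary by the bi-Lipschitz map `z ↦ (z, φ(z))`. -/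
theorem PerimeterEstimateNear.of_isAdmissibleGraph {m : ℕ} {Ω : Set (EuclideanSpace ℝ (Fin 3))}
    (hΩ : HasSmoothBoundary Ω) {p : EuclideanSpace ℝ (Fin 3)} (hp : p ∈ frontier Ω)
    {U : Set (EuclideanSpace ℝ (Fin 3))} (hU : U ∈ 𝓝 p)
    (hgraph : IsAdmissibleGraph m (frontier Ω ∩ U)) : PerimeterEstimateNear m Ω p := by
  obtain ⟨A, φ, hA, hφ, hS, C, hC, hbd⟩ := hgraph
  have hmem : ∀ q, q ∈ frontier Ω ∩ U ↔ ∃ z ∈ A, graphPoint φ z = q := by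
    intro q
    rw [hS]
    rfl
  obtain ⟨w, hwA, hwp⟩ := (hmem p).1 ⟨hp, mem_of_mem_nhds hU⟩
  obtain ⟨ρ, hρ, hρA⟩ := Metric.isOpen_iff.1 hA w hwA
  have hdiff : ∀ z ∈ A, ContDiffAt ℝ ∞ φ z := fun z hz => hφ.contDiffAt (hA.mem_nhds hz)
  set B : ℝ := C * (‖w‖ + ρ) ^ (2 * m + 1) with hB
  have hB0 : 0 < B := by positivity
  have hpart : ∀ z ∈ Metric.ball w ρ, ∀ i, |fderiv ℝ φ z (EuclideanSpace.single i 1)| ≤ B := by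
    intro z hz i
    have := (hbd z (hρA hz)).2.2 fun _ => i
    rw [iteratedFDeriv_one_apply] at this
    refine this.trans ?_
    have hzn : ‖z‖ ≤ ‖w‖ + ρ := by
      have h1 := norm_sub_norm_le z w
      have h2 := Metric.mem_ball.1 hz
      rw [dist_eq_norm] at h2
      linarith
    rw [hB]
    gcongr
  have hhess : ∀ z r, 0 < r → Metric.ball z (2 * r) ⊆ A → HessianBound m C φ z r := by
    intro z r hr hsub u hu
    refine ⟨hdiff u (hsub hu), fun i j => ?_⟩
    have := (hbd u (hsub hu)).2.1 ![i, j]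
    rw [iteratedFDeriv_two_apply] at this
    refine le_trans (by simpa using this) ?_
    have hun : ‖u‖ ≤ ‖z‖ + 2 * r := by
      have h1 := norm_sub_norm_le u z
      have h2 := Metric.mem_ball.1 hu
      rw [dist_eq_norm] at h2
      linarith
    gcongr
  have hdens : ∀ z ∈ A, perimeterDensity m Ω (graphPoint φ z) =
      √(graphX m φ z ^ 2 + graphY m φ z ^ 2) /
        √(1 + fderiv ℝ φ z (EuclideanSpace.single 0 1) ^ 2 +
          fderiv ℝ φ z (EuclideanSpace.single 1 1) ^ 2) := by
    intro z hz
    refine perimeterDensity_graphPoint hΩ ((hdiff z hz).differentiableAt (by simp)) ?_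
    filter_upwards [hA.mem_nhds hz] with u hu
    exact ((hmem _).2 ⟨u, hu, rfl⟩).1
  have hlip : LipschitzOnWith (2 + 2 * B).toNNReal (graphPoint φ) (Metric.ball w ρ) :=
    lipschitzOnWith_graphPoint (by positivity) fun z hz u hu =>
      abs_sub_le_of_partials_le (convex_ball w ρ)
        (fun v hv => (hdiff v (hρA hv)).differentiableAt (by simp)) hpart hu hz
  obtain ⟨C', hC', hup⟩ := HessianBound.exists_upper m hC.le
  obtain ⟨c', hc', hlo⟩ := HessianBound.exists_lower m hC.le
  obtain ⟨r₁, hr₁, W, hW, hWU⟩ := eventually_modelBox_subset m hU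
  refine perimeterEstimateNear_of_bounds (c := c' / (1 + 2 * B)) (C := (2 + 2 * B) ^ 2 * C')
    (r₀ := min r₁ (ρ / 4)) (W := W ∩ (U ∩ Metric.ball p (ρ / 2))) (by positivity) (by positivity)
    (by positivity) (inter_mem hW (inter_mem hU (Metric.ball_mem_nhds _ (by positivity)))) ?_
  rintro q ⟨hqΩ, hqW, hqU, hqb⟩ r hr hr'
  obtain ⟨z, hzA, rfl⟩ := (hmem q).1 ⟨hqΩ, hqU⟩
  have hzw : dist z w < ρ / 2 := by
    have := lipschitzWith_planeProjection.dist_le_mul (graphPoint φ z) p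
    rw [← hwp, planeProjection_graphPoint, planeProjection_graphPoint, hwp] at this
    rw [NNReal.coe_one, one_mul] at this
    exact this.trans_lt hqb
  have hsubρ : Metric.ball z (2 * r) ⊆ Metric.ball w ρ := by
    refine Metric.ball_subset_ball' ?_
    have := hr'.trans (min_le_right _ _)
    linarith
  have hH := hhess z r hr (hsubρ.trans hρA)
  have hboxU : modelBox m (graphPoint φ z) r ⊆ U := hWU _ hqW r (hr'.trans (min_le_left _ _))
  have hin : ∀ x ∈ frontier Ω ∩ modelBox m (graphPoint φ z) r,
      ∃ u ∈ Metric.ball z (2 * r), graphPoint φ u = x := by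
    rintro x ⟨hx, hxb⟩
    obtain ⟨u, -, rfl⟩ := (hmem x).1 ⟨hx, hboxU hxb⟩
    refine ⟨u, ?_, rfl⟩
    rw [Metric.mem_ball, dist_eq_norm]
    have h0 : |u 0 - z 0| < r := hxb.1
    have h1 : |u 1 - z 1| < r := hxb.2.1
    have := norm_plane_le (u - z)
    simp only [PiLp.sub_apply] at this
    linarith
  have hbm : MeasurableSet (modelBox m (graphPoint φ z) r) := (isOpen_modelBox m _ r).measurableSet
  constructor
  · obtain ⟨D, hD, hDb, hDbox, hDint⟩ := hlo φ z r hr hH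
    have hDA : D ⊆ A := fun u hu =>
      hρA (hsubρ (Metric.ball_subset_ball (by linarith) (hDb hu)))
    have := setLIntegral_le_horizontalPerimeter (m := m) (Ω := Ω) hbm
      lipschitzWith_planeProjection hD
      (fun u hu => ⟨graphPoint φ u, ⟨((hmem _).2 ⟨u, hDA hu, rfl⟩).1, hDbox u hu⟩,
        planeProjection_graphPoint φ u⟩)
      (g := fun u => ENNReal.ofReal (1 + 2 * B)⁻¹ *
        ENNReal.ofReal √(graphX m φ u ^ 2 + graphY m φ u ^ 2)) (by
        rintro x hx -
        obtain ⟨u, hu, rfl⟩ := hin x hx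
        rw [planeProjection_graphPoint, hdens u (hρA (hsubρ hu)),
          ← ENNReal.ofReal_mul (by positivity), inv_mul_eq_div]
        refine ENNReal.ofReal_le_ofReal ?_
        gcongr
        rw [Real.sqrt_le_left (by positivity)]
        have b0 := sq_le_sq' (abs_le.1 (hpart u (hsubρ hu) 0)).1 (abs_le.1 (hpart u (hsubρ hu) 0)).2
        have b1 := sq_le_sq' (abs_le.1 (hpart u (hsubρ hu) 1)).1 (abs_le.1 (hpart u (hsubρ hu) 1)).2
        nlinarith)
    rw [ENNReal.coe_one, one_pow, one_mul, lintegral_const_mul' _ _ (by finiteness)] at this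
    refine le_trans ?_ this
    rw [div_eq_inv_mul, mul_assoc, ENNReal.ofReal_mul (by positivity)]
    gcongr
  · obtain ⟨S, T, hS0, hT0, hST, hvol, hdS⟩ := hup φ z r hr hH
    refine (horizontalPerimeter_le hbm (M := S) fun x hx => ?_).trans ?_
    · obtain ⟨u, hu, rfl⟩ := hin x hx
      rw [hdens u (hρA (hsubρ hu))]
      refine (div_le_self (Real.sqrt_nonneg _) ?_).trans (hdS u hu)
      rw [Real.one_le_sqrt]
      nlinarith [sq_nonneg (fderiv ℝ φ u (EuclideanSpace.single 0 1)),
        sq_nonneg (fderiv ℝ φ u (EuclideanSpace.single 1 1))]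
    · set E := {u | u ∈ Metric.ball z (2 * r) ∧
        graphPoint φ u ∈ modelBox m (graphPoint φ z) r} with hE
      have hsub : frontier Ω ∩ modelBox m (graphPoint φ z) r ⊆ graphPoint φ '' E := by
        intro x hx
        obtain ⟨u, hu, rfl⟩ := hin x hx
        exact ⟨u, ⟨hu, hx.2⟩, rfl⟩
      have himg := (hlip.mono (fun u (hu : u ∈ E) => hsubρ hu.1)).euclideanHausdorffMeasure_image_le
      rw [EuclideanSpace.euclideanHausdorffMeasure_eq_volume] at himg
      calc _ ≤ ENNReal.ofReal S * (((2 + 2 * B).toNNReal : ℝ≥0∞) ^ 2 * ENNReal.ofReal T) := by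
            gcongr
            exact (measure_mono hsub).trans (himg.trans (by gcongr))
        _ = ENNReal.ofReal ((2 + 2 * B) ^ 2 * (S * T)) := by
            change ENNReal.ofReal S * (ENNReal.ofReal (2 + 2 * B) ^ 2 * ENNReal.ofReal T) = _
            rw [← ENNReal.ofReal_pow (by positivity), ← ENNReal.ofReal_mul (by positivity),
              ← ENNReal.ofReal_mul hS0]
            congr 1
            ring
        _ ≤ _ := by
            refine ENNReal.ofReal_le_ofReal ?_
            rw [mul_assoc]
            gcongr

/-! ### Non-characteristic boundary points -/

/-- A map that does not contract distances by more than a factor `K` on `s` does not shrink the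
Hausdorff measure of `s` by more than `K ^ 2`. -/
theorem euclideanHausdorffMeasure_le_of_dist_le {X Y : Type*} [MetricSpace X]
    [MeasurableSpace X] [BorelSpace X] [MetricSpace Y] [MeasurableSpace Y] [BorelSpace Y]
    {f : X → Y} {s : Set X} {K : ℝ} (hK : 0 ≤ K)
    (h : ∀ x ∈ s, ∀ y ∈ s, dist x y ≤ K * dist (f x) (f y)) :
    μHE[2] s ≤ ENNReal.ofReal K ^ 2 * μHE[2] (f '' s) := by
  rcases s.eq_empty_or_nonempty with rfl | ⟨x₀, hx₀⟩
  · simp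
  have : Nonempty X := ⟨x₀⟩
  have hinj : InjOn f s := fun x hx y hy hxy => by
    have := h x hx y hy
    rw [hxy, dist_self, mul_zero] at this
    exact dist_le_zero.1 this
  have hg : LipschitzOnWith K.toNNReal (Function.invFunOn f s) (f '' s) := by
    rw [lipschitzOnWith_iff_dist_le_mul]
    rintro _ ⟨x, hx, rfl⟩ _ ⟨y, hy, rfl⟩
    rw [hinj.leftInvOn_invFunOn hx, hinj.leftInvOn_invFunOn hy, Real.coe_toNNReal _ hK]
    exact h x hx y hy
  have := hg.euclideanHausdorffMeasure_image_le
  rwa [hinj.leftInvOn_invFunOn.image_image] at this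

/-- The coordinates on `ℝ³` along `-β X(p) + α Y(p)` and `∂ₜ`, that is the projection along
`α X(p) + β Y(p)`. -/
noncomputable def transverseProjection (m : ℕ) (α β : ℝ) (p x : EuclideanSpace ℝ (Fin 3)) :
    EuclideanSpace ℝ (Fin 2) :=
  !₂[-β * (x 0 - p 0) + α * (x 1 - p 1), heightAbove m p x]

/-- Displacements in the frame `α X(p) + β Y(p)`, `-β X(p) + α Y(p)`, `∂ₜ`. -/
theorem eq_add_frame (m : ℕ) {α β : ℝ} (h : α ^ 2 + β ^ 2 = 1) (p x y : EuclideanSpace ℝ (Fin 3)) :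
    x - y = (α * (x 0 - y 0) + β * (x 1 - y 1)) • (α • fieldX m p + β • fieldY m p) +
      (transverseProjection m α β p x - transverseProjection m α β p y) 0 •
        (-β • fieldX m p + α • fieldY m p) +
      (transverseProjection m α β p x - transverseProjection m α β p y) 1 •
        EuclideanSpace.single 2 (1 : ℝ) := by
  ext i
  fin_cases i
  · simp [fieldX, fieldY, transverseProjection]
    linear_combination -(x 0 - y 0) * h
  · simp [fieldX, fieldY, transverseProjection]
    linear_combination -(x 1 - y 1) * h
  · simp [fieldX, fieldY, transverseProjection, heightAbove]
    linear_combination (-(x 0 - y 0) * (p 0 ^ 2 + p 1 ^ 2) ^ m * p 1 +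
      (x 1 - y 1) * (p 0 ^ 2 + p 1 ^ 2) ^ m * p 0) * h

theorem norm_fieldX_le (m : ℕ) {p : EuclideanSpace ℝ (Fin 3)} {R : ℝ} (h : ‖p‖ ≤ R) :
    ‖fieldX m p‖ ≤ 1 + R ^ (2 * m) * R := by
  have hl : (p 0 ^ 2 + p 1 ^ 2) ^ m ≤ R ^ (2 * m) := by
    rw [← axisDist_sq, ← pow_mul]
    have := axisDist_nonneg p
    gcongr
    exact (axisDist_le_norm p).trans h
  have h1 := (abs_apply_le_norm p 1).trans h
  rw [fieldX_eq]
  refine (norm_add_le _ _).trans ?_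
  simp only [norm_smul, PiLp.norm_single, norm_one, mul_one, Real.norm_eq_abs, abs_mul]
  rw [abs_of_nonneg (by positivity : 0 ≤ (p 0 ^ 2 + p 1 ^ 2) ^ m)]
  have : 0 ≤ R := (norm_nonneg p).trans h
  gcongr

theorem norm_fieldY_le (m : ℕ) {p : EuclideanSpace ℝ (Fin 3)} {R : ℝ} (h : ‖p‖ ≤ R) :
    ‖fieldY m p‖ ≤ 1 + R ^ (2 * m) * R := by
  have hl : (p 0 ^ 2 + p 1 ^ 2) ^ m ≤ R ^ (2 * m) := by
    rw [← axisDist_sq, ← pow_mul]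
    have := axisDist_nonneg p
    gcongr
    exact (axisDist_le_norm p).trans h
  have h1 := (abs_apply_le_norm p 0).trans h
  rw [fieldY_eq]
  refine (norm_sub_le _ _).trans ?_
  simp only [norm_smul, PiLp.norm_single, norm_one, mul_one, Real.norm_eq_abs, abs_mul]
  rw [abs_of_nonneg (by positivity : 0 ≤ (p 0 ^ 2 + p 1 ^ 2) ^ m)]
  have : 0 ≤ R := (norm_nonneg p).trans h
  gcongr

theorem continuous_fieldX (m : ℕ) : Continuous (fieldX m) := by
  have : fieldX m = fun p => EuclideanSpace.single 0 (1 : ℝ) +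
      ((p 0 ^ 2 + p 1 ^ 2) ^ m * p 1) • EuclideanSpace.single 2 (1 : ℝ) := funext (fieldX_eq m)
  rw [this]
  fun_prop

theorem continuous_fieldY (m : ℕ) : Continuous (fieldY m) := by
  have : fieldY m = fun p => EuclideanSpace.single 1 (1 : ℝ) -
      ((p 0 ^ 2 + p 1 ^ 2) ^ m * p 0) • EuclideanSpace.single 2 (1 : ℝ) := funext (fieldY_eq m)
  rw [this]
  fun_prop

/-- `F` is a local defining function on a ball on which its derivative along the horizontal
direction with coefficients `(α, β)`, frozen at any point of the ball, is at least `c`; `G`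
bounds `dF` and `B` the fields `X` and `Y`. -/
structure IsTransverse (m : ℕ) (Ω : Set (EuclideanSpace ℝ (Fin 3))) (a : EuclideanSpace ℝ (Fin 3))
    (F : EuclideanSpace ℝ (Fin 3) → ℝ) (ρ α β c G B : ℝ) : Prop where
  sq_add_sq : α ^ 2 + β ^ 2 = 1
  c_pos : 0 < c
  G_pos : 0 < G
  B_ge : 1 ≤ B
  isLocalDefiningFunction : ∀ q ∈ frontier Ω ∩ Metric.ball a ρ, ∃ U,
    IsLocalDefiningFunction Ω q U F
  eq_zero_iff : ∀ q ∈ Metric.ball a ρ, q ∈ frontier Ω ↔ F q = 0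
  differentiableAt : ∀ q ∈ Metric.ball a ρ, DifferentiableAt ℝ F q
  le_fderiv : ∀ q ∈ Metric.ball a ρ, ∀ p ∈ Metric.ball a ρ,
    c ≤ fderiv ℝ F q (α • fieldX m p + β • fieldY m p)
  norm_fderiv_le : ∀ q ∈ Metric.ball a ρ, ‖fderiv ℝ F q‖ ≤ G
  norm_le : ∀ q ∈ Metric.ball a ρ, ‖q‖ ≤ B
  norm_X_le : ∀ q ∈ Metric.ball a ρ, ‖fieldX m q‖ ≤ B
  norm_Y_le : ∀ q ∈ Metric.ball a ρ, ‖fieldY m q‖ ≤ B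

/-- At a non-characteristic point, `(α, β)` is the normalized horizontal gradient of a defining
function at that point. -/
theorem exists_isTransverse {m : ℕ} {Ω : Set (EuclideanSpace ℝ (Fin 3))}
    (hΩ : HasSmoothBoundary Ω) {a : EuclideanSpace ℝ (Fin 3)} (ha : a ∈ frontier Ω)
    (hchar : ¬IsCharacteristicPoint m Ω a) :
    ∃ F ρ α β c G B, 0 < ρ ∧ IsTransverse m Ω a F ρ α β c G B := by
  obtain ⟨U, F, hF⟩ := hΩ a ha
  set n := √(fderiv ℝ F a (fieldX m a) ^ 2 + fderiv ℝ F a (fieldY m a) ^ 2) with hn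
  have hn0 : 0 < n := by
    have e : ∀ v, inner ℝ (gradient F a) v = fderiv ℝ F a v := fun v => by simp [gradient]
    rw [hn, Real.sqrt_pos]
    by_contra hcon
    have h1 : fderiv ℝ F a (fieldX m a) = 0 := by
      nlinarith [sq_nonneg (fderiv ℝ F a (fieldX m a)), sq_nonneg (fderiv ℝ F a (fieldY m a))]
    have h2 : fderiv ℝ F a (fieldY m a) = 0 := by
      nlinarith [sq_nonneg (fderiv ℝ F a (fieldX m a)), sq_nonneg (fderiv ℝ F a (fieldY m a))]
    refine hchar ⟨ha, ?_, ?_⟩ <;> rw [hF.unitNormal_eq, real_inner_smul_left, e] <;> simp [h1, h2]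
  have hnsq : n ^ 2 = fderiv ℝ F a (fieldX m a) ^ 2 + fderiv ℝ F a (fieldY m a) ^ 2 :=
    Real.sq_sqrt (by positivity)
  set α := fderiv ℝ F a (fieldX m a) / n with hα
  set β := fderiv ℝ F a (fieldY m a) / n with hβ
  have hU : U ∈ 𝓝 a := hF.isOpen.mem_nhds hF.mem
  have hcF : ContinuousAt (fderiv ℝ F) a :=
    ((hF.smooth.contDiffAt hU).fderiv_right (m := 0) (by norm_num)).continuousAt
  have hval : fderiv ℝ F a (α • fieldX m a + β • fieldY m a) = n := by
    rw [map_add, map_smul, map_smul, smul_eq_mul, smul_eq_mul, hα, hβ]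
    field_simp
    rw [hnsq]
  have hcont : ContinuousAt (fun x : EuclideanSpace ℝ (Fin 3) × EuclideanSpace ℝ (Fin 3) =>
      fderiv ℝ F x.1 (α • fieldX m x.2 + β • fieldY m x.2)) (a, a) := by
    refine ContinuousAt.clm_apply (hcF.comp (f := Prod.fst) (x := (a, a)) continuousAt_fst) ?_
    have := continuous_fieldX m
    have := continuous_fieldY m
    exact Continuous.continuousAt (by fun_prop)
  have hev : ∀ᶠ x in 𝓝 (a, a), n / 2 < fderiv ℝ F x.1 (α • fieldX m x.2 + β • fieldY m x.2) :=
    hcont.eventually (lt_mem_nhds (by simp only [hval]; linarith))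
  obtain ⟨ρ₁, hρ₁, h₁⟩ := Metric.mem_nhds_iff.1 hev
  have hev2 : ∀ᶠ q in 𝓝 a, ‖fderiv ℝ F q‖ < ‖fderiv ℝ F a‖ + 1 :=
    hcF.norm.eventually (gt_mem_nhds (by linarith))
  obtain ⟨ρ₂, hρ₂, h₂⟩ := Metric.mem_nhds_iff.1 (hev2.and hU)
  set R := ‖a‖ + 1 with hR
  have hsub : ∀ q ∈ Metric.ball a (min (min ρ₁ ρ₂) 1), q ∈ Metric.ball a ρ₁ ∧
      q ∈ Metric.ball a ρ₂ ∧ ‖q‖ ≤ R := by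
    intro q hq
    refine ⟨Metric.ball_subset_ball ((min_le_left _ _).trans (min_le_left _ _)) hq,
      Metric.ball_subset_ball ((min_le_left _ _).trans (min_le_right _ _)) hq, ?_⟩
    have h1 := norm_sub_norm_le q a
    have h2 := (Metric.mem_ball.1 hq).trans_le (min_le_right _ _)
    rw [dist_eq_norm] at h2
    linarith
  have hR0 : 0 ≤ R := by positivity
  have hRm : 0 ≤ R ^ (2 * m) * R := by positivity
  refine ⟨F, min (min ρ₁ ρ₂) 1, α, β, n / 2, ‖fderiv ℝ F a‖ + 1, 1 + R + R ^ (2 * m) * R,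
    by positivity, ?_, by positivity, by positivity, by linarith, fun q hq => ⟨U, ?_⟩, fun q hq => ?_,
    fun q hq => ?_, fun q hq p hp => ?_, fun q hq => ?_, fun q hq => ?_, fun q hq => ?_,
    fun q hq => ?_⟩
  · rw [hα, hβ, div_pow, div_pow, ← add_div, ← hnsq, div_self (by positivity)]
  · exact ⟨hq.1, hF.isOpen, (h₂ (hsub q hq.2).2.1).2, hF.smooth, hF.gradient_ne_zero, hF.inside,
      hF.boundary⟩
  · exact hF.boundary q (h₂ (hsub q hq).2.1).2
  · exact (hF.smooth.contDiffAt (hF.isOpen.mem_nhds (h₂ (hsub q hq).2.1).2)).differentiableAt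
      (by simp)
  · have : (q, p) ∈ Metric.ball (a, a) ρ₁ := by
      rw [← ball_prod_same]
      exact ⟨(hsub q hq).1, (hsub p hp).1⟩
    exact (h₁ this).le
  · exact (h₂ (hsub q hq).2.1).1.le
  · linarith [(hsub q hq).2.2]
  · linarith [norm_fieldX_le m (hsub q hq).2.2]
  · linarith [norm_fieldY_le m (hsub q hq).2.2]

namespace IsTransverse

variable {m : ℕ} {Ω : Set (EuclideanSpace ℝ (Fin 3))} {a : EuclideanSpace ℝ (Fin 3)}
  {F : EuclideanSpace ℝ (Fin 3) → ℝ} {ρ α β c G B : ℝ}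

theorem abs_le_one (h : IsTransverse m Ω a F ρ α β c G B) : |α| ≤ 1 ∧ |β| ≤ 1 := by
  have := h.sq_add_sq
  exact ⟨abs_le_of_sq_le_sq (by nlinarith [sq_nonneg β]) zero_le_one,
    abs_le_of_sq_le_sq (by nlinarith [sq_nonneg α]) zero_le_one⟩

theorem norm_frame_le (h : IsTransverse m Ω a F ρ α β c G B) {p : EuclideanSpace ℝ (Fin 3)}
    (hp : p ∈ Metric.ball a ρ) : ‖α • fieldX m p + β • fieldY m p‖ ≤ 2 * B ∧
      ‖-β • fieldX m p + α • fieldY m p‖ ≤ 2 * B := by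
  obtain ⟨hα, hβ⟩ := h.abs_le_one
  have hX := h.norm_X_le p hp
  have hY := h.norm_Y_le p hp
  have key : ∀ s t : ℝ, |s| ≤ 1 → |t| ≤ 1 → ‖s • fieldX m p + t • fieldY m p‖ ≤ 2 * B := by
    intro s t hs ht
    refine (norm_add_le _ _).trans ?_
    rw [norm_smul, norm_smul, Real.norm_eq_abs, Real.norm_eq_abs]
    have := mul_le_mul hs hX (norm_nonneg _) zero_le_one
    have := mul_le_mul ht hY (norm_nonneg _) zero_le_one
    linarith
  exact ⟨key α β hα hβ, key (-β) α (by rwa [abs_neg]) hα⟩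

theorem density_bounds (h : IsTransverse m Ω a F ρ α β c G B) {q : EuclideanSpace ℝ (Fin 3)}
    (hq : q ∈ frontier Ω ∩ Metric.ball a ρ) :
    c / G ≤ perimeterDensity m Ω q ∧ perimeterDensity m Ω q ≤ 2 * B := by
  obtain ⟨U, hF⟩ := h.isLocalDefiningFunction q hq
  have hc := h.c_pos
  have hG := h.G_pos
  have hn : ‖gradient F q‖ = ‖fderiv ℝ F q‖ := by simp [gradient]
  have hpos : 0 < ‖fderiv ℝ F q‖ := by
    rw [← hn]
    exact norm_pos_iff.2 (hF.gradient_ne_zero q hF.mem)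
  rw [hF.perimeterDensity_eq, hn, inv_mul_eq_div]
  constructor
  · gcongr
    · refine (h.le_fderiv q hq.2 q hq.2).trans ?_
      rw [map_add, map_smul, map_smul, smul_eq_mul, smul_eq_mul]
      refine Real.le_sqrt_of_sq_le ?_
      nlinarith [sq_nonneg (α * fderiv ℝ F q (fieldY m q) - β * fderiv ℝ F q (fieldX m q)),
        h.sq_add_sq]
    · exact h.norm_fderiv_le q hq.2
  · rw [div_le_iff₀ hpos]
    have h0 := sqrt_sq_add_sq_le_add (fderiv ℝ F q (fieldX m q)) (fderiv ℝ F q (fieldY m q)) 0 0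
    have hX := (fderiv ℝ F q).le_opNorm (fieldX m q)
    have hY := (fderiv ℝ F q).le_opNorm (fieldY m q)
    have hX' := h.norm_X_le q hq.2
    have hY' := h.norm_Y_le q hq.2
    simp only [Real.norm_eq_abs] at hX hY
    simp at h0
    nlinarith

/-- On the boundary the projection along a transverse horizontal direction is bi-Lipschitz. -/
theorem dist_le (h : IsTransverse m Ω a F ρ α β c G B) {p : EuclideanSpace ℝ (Fin 3)}
    (hp : p ∈ Metric.ball a ρ) {x y : EuclideanSpace ℝ (Fin 3)}
    (hx : x ∈ frontier Ω ∩ Metric.ball a ρ) (hy : y ∈ frontier Ω ∩ Metric.ball a ρ) :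
    dist x y ≤ (8 * B ^ 2 * G / c + 4 * B) *
      dist (transverseProjection m α β p x) (transverseProjection m α β p y) := by
  have hc := h.c_pos
  have hG := h.G_pos
  have hB := h.B_ge
  set W := α • fieldX m p + β • fieldY m p with hW
  set W' := -β • fieldX m p + α • fieldY m p with hW'
  obtain ⟨hWn, hWn'⟩ := h.norm_frame_le hp
  set w := α * (x 0 - y 0) + β * (x 1 - y 1)
  set d := transverseProjection m α β p x - transverseProjection m α β p y with hd
  have hdec := eq_add_frame m h.sq_add_sq p x y
  rw [← hd, ← hW, ← hW'] at hdec
  change x - y = w • W + d 0 • W' + d 1 • EuclideanSpace.single 2 (1 : ℝ) at hdec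
  have hline : ∀ s ∈ Icc (0 : ℝ) 1, y + s • (x - y) ∈ Metric.ball a ρ := fun s hs =>
    (convex_ball a ρ).add_smul_sub_mem hy.2 hx.2 hs
  have hderiv : ∀ s ∈ Icc (0 : ℝ) 1, HasDerivAt (fun s : ℝ => F (y + s • (x - y)))
      (fderiv ℝ F (y + s • (x - y)) (x - y)) s := fun s hs => by
    have h1 : HasDerivAt (fun s : ℝ => y + s • (x - y)) (x - y) s := by
      simpa using ((hasDerivAt_id s).smul_const (x - y)).const_add y
    exact (h.differentiableAt _ (hline s hs)).hasFDerivAt.comp_hasDerivAt s h1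
  obtain ⟨s, hs, hs0⟩ := exists_hasDerivAt_eq_zero (f := fun s : ℝ => F (y + s • (x - y)))
    (f' := fun s => fderiv ℝ F (y + s • (x - y)) (x - y)) zero_lt_one
    (fun s hs => (hderiv s hs).continuousAt.continuousWithinAt)
    (by simp [(h.eq_zero_iff y hy.2).1 hy.1, (h.eq_zero_iff x hx.2).1 hx.1])
    (fun s hs => hderiv s (Ioo_subset_Icc_self hs))
  set ξ := y + s • (x - y)
  have hξ : ξ ∈ Metric.ball a ρ := hline s (Ioo_subset_Icc_self hs)
  have hcW := h.le_fderiv ξ hξ p hp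
  rw [← hW] at hcW
  have hGξ := h.norm_fderiv_le ξ hξ
  rw [hdec, map_add, map_add, map_smul, map_smul, map_smul, smul_eq_mul, smul_eq_mul,
    smul_eq_mul] at hs0
  have hF' : |fderiv ℝ F ξ W'| ≤ G * (2 * B) :=
    ((fderiv ℝ F ξ).le_opNorm W').trans (mul_le_mul hGξ hWn' (norm_nonneg _) hG.le)
  have hFe : |fderiv ℝ F ξ (EuclideanSpace.single 2 (1 : ℝ))| ≤ G * (2 * B) := by
    refine ((fderiv ℝ F ξ).le_opNorm _).trans ?_
    rw [PiLp.norm_single, norm_one]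
    exact mul_le_mul hGξ (by linarith) zero_le_one hG.le
  have d0 := abs_apply_le_norm d 0
  have d1 := abs_apply_le_norm d 1
  have hdn := norm_nonneg d
  have hw : |w| * c ≤ 4 * (B * G) * ‖d‖ := by
    have e : w * fderiv ℝ F ξ W =
        -(d 0 * fderiv ℝ F ξ W' + d 1 * fderiv ℝ F ξ (EuclideanSpace.single 2 (1 : ℝ))) := by
      linarith
    calc |w| * c ≤ |w| * |fderiv ℝ F ξ W| := by
          gcongr
          exact hcW.trans (le_abs_self _)
      _ = |d 0 * fderiv ℝ F ξ W' + d 1 * fderiv ℝ F ξ (EuclideanSpace.single 2 (1 : ℝ))| := by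
          rw [← abs_mul, e, abs_neg]
      _ ≤ |d 0| * |fderiv ℝ F ξ W'| + |d 1| * |fderiv ℝ F ξ (EuclideanSpace.single 2 (1 : ℝ))| := by
          rw [← abs_mul, ← abs_mul]
          exact abs_add_le _ _
      _ ≤ ‖d‖ * (G * (2 * B)) + ‖d‖ * (G * (2 * B)) := by gcongr
      _ = _ := by ring
  have hw' : |w| ≤ 4 * (B * G) / c * ‖d‖ := by
    rw [div_mul_eq_mul_div, le_div_iff₀ hc]
    exact hw
  rw [dist_eq_norm, dist_eq_norm, ← hd, hdec]
  refine norm_add₃_le.trans ?_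
  rw [norm_smul, norm_smul, norm_smul, PiLp.norm_single, norm_one, mul_one,
    Real.norm_eq_abs, Real.norm_eq_abs, Real.norm_eq_abs]
  calc |w| * ‖W‖ + |d 0| * ‖W'‖ + |d 1| ≤
        4 * (B * G) / c * ‖d‖ * (2 * B) + ‖d‖ * (2 * B) + ‖d‖ * (2 * B) := by
        have : |d 1| ≤ ‖d‖ * (2 * B) := by nlinarith
        gcongr
    _ = _ := by ring

end IsTransverse

theorem lipschitzWith_transverseProjection (m : ℕ) {α β B : ℝ} (hα : |α| ≤ 1) (hβ : |β| ≤ 1)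
    {p : EuclideanSpace ℝ (Fin 3)} (hp : ‖p‖ ≤ B) :
    LipschitzWith (3 + B ^ (2 * m) * (2 * B)).toNNReal (transverseProjection m α β p) := by
  have hB : 0 ≤ B := (norm_nonneg p).trans hp
  refine LipschitzWith.of_dist_le_mul fun x y => ?_
  rw [Real.coe_toNNReal _ (by positivity), dist_eq_norm, dist_eq_norm]
  refine (norm_plane_le _).trans ?_
  have h0 := abs_apply_le_norm (x - y) 0
  have h1 := abs_apply_le_norm (x - y) 1
  have h2 := abs_apply_le_norm (x - y) 2
  have hn := norm_nonneg (x - y)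
  have hl : (p 0 ^ 2 + p 1 ^ 2) ^ m ≤ B ^ (2 * m) := by
    rw [← axisDist_sq, ← pow_mul]
    have := axisDist_nonneg p
    gcongr
    exact (axisDist_le_norm p).trans hp
  have e0 : (transverseProjection m α β p x - transverseProjection m α β p y) 0 =
      -β * (x - y) 0 + α * (x - y) 1 := by
    simp [transverseProjection]
    ring
  have e1 : (transverseProjection m α β p x - transverseProjection m α β p y) 1 =
      (x - y) 2 - (p 0 ^ 2 + p 1 ^ 2) ^ m * (p 1 * (x - y) 0 - p 0 * (x - y) 1) := by
    simp [transverseProjection, heightAbove]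
    ring
  have b0 : |-β * (x - y) 0 + α * (x - y) 1| ≤ 1 * ‖x - y‖ + 1 * ‖x - y‖ := by
    refine (abs_add_le _ _).trans ?_
    rw [abs_mul, abs_mul, abs_neg]
    gcongr
  have b1 : |p 1 * (x - y) 0 - p 0 * (x - y) 1| ≤ B * ‖x - y‖ + B * ‖x - y‖ := by
    refine (abs_sub _ _).trans ?_
    rw [abs_mul, abs_mul]
    gcongr
    · exact (abs_apply_le_norm p 1).trans hp
    · exact (abs_apply_le_norm p 0).trans hp
  have b2 : |(x - y) 2 - (p 0 ^ 2 + p 1 ^ 2) ^ m * (p 1 * (x - y) 0 - p 0 * (x - y) 1)| ≤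
      ‖x - y‖ + B ^ (2 * m) * (B * ‖x - y‖ + B * ‖x - y‖) := by
    refine (abs_sub _ _).trans ?_
    rw [abs_mul, abs_of_nonneg (by positivity : 0 ≤ (p 0 ^ 2 + p 1 ^ 2) ^ m)]
    gcongr
  rw [e0, e1]
  linarith

namespace IsTransverse

variable {m : ℕ} {Ω : Set (EuclideanSpace ℝ (Fin 3))} {a : EuclideanSpace ℝ (Fin 3)}
  {F : EuclideanSpace ℝ (Fin 3) → ℝ} {ρ α β c G B : ℝ}

/-- Every point of a small rectangle is the projection of a boundary point in the model box: the
intermediate value theorem along the direction of projection. -/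
theorem exists_mem_frontier (h : IsTransverse m Ω a F ρ α β c G B)
    {p : EuclideanSpace ℝ (Fin 3)} (hp : p ∈ frontier Ω) (hpa : dist p a < ρ / 2)
    {r ε : ℝ} (hr : 0 < r) (hε : ε ≤ 1 / 4) {H : ℝ} (hH : 0 ≤ H)
    (hbox : boxHeight m p r ≤ H * r) (hrρ : (2 * B + H) * r ≤ ρ / 2)
    (hεc : G * (ε * (2 * B + H)) ≤ c / 2) {z : EuclideanSpace ℝ (Fin 2)}
    (hz0 : |z 0| < ε * r) (hz1 : |z 1| < ε * boxHeight m p r) :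
    ∃ x ∈ frontier Ω ∩ modelBox m p r, transverseProjection m α β p x = z := by
  have hc := h.c_pos
  have hG := h.G_pos
  have hB := h.B_ge
  have hρ : 0 < ρ := by linarith [dist_nonneg (x := p) (y := a)]
  have hpb : p ∈ Metric.ball a ρ := by
    rw [Metric.mem_ball]
    linarith
  have hκ := boxHeight_pos m p hr
  have hε0 : 0 < ε := by
    by_contra hcon
    have := abs_nonneg (z 0)
    nlinarith
  obtain ⟨hα, hβ⟩ := h.abs_le_one
  obtain ⟨hWn, hWn'⟩ := h.norm_frame_le hpb
  set W := α • fieldX m p + β • fieldY m p with hW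
  set W' := -β • fieldX m p + α • fieldY m p with hW'
  set v := z 0 • W' + z 1 • EuclideanSpace.single 2 (1 : ℝ) with hv
  have hvn : ‖v‖ ≤ ε * (2 * B + H) * r := by
    refine (norm_add_le _ _).trans ?_
    rw [norm_smul, norm_smul, PiLp.norm_single, norm_one, mul_one, Real.norm_eq_abs,
      Real.norm_eq_abs]
    have := mul_le_mul hz0.le hWn' (norm_nonneg _) (by positivity)
    nlinarith
  have hball : ∀ s ∈ Icc (-(r / 2)) (r / 2), p + v + s • W ∈ Metric.ball a ρ := by
    intro s hs
    have hsW : ‖s • W‖ ≤ B * r := by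
      rw [norm_smul, Real.norm_eq_abs]
      have := mul_le_mul (abs_le.2 ⟨hs.1, hs.2⟩) hWn (norm_nonneg _) (by positivity)
      linarith
    have h1 : dist (p + v + s • W) p ≤ ε * (2 * B + H) * r + B * r := by
      rw [dist_eq_norm, add_assoc, add_sub_cancel_left]
      exact (norm_add_le _ _).trans (add_le_add hvn hsW)
    have h2 := dist_triangle (p + v + s • W) p a
    have h3 : ε * (2 * B + H) * r + B * r ≤ (2 * B + H) * r := by
      have : ε * (2 * B + H) ≤ 1 / 4 * (2 * B + H) := by gcongr
      nlinarith
    rw [Metric.mem_ball]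
    linarith
  set g : ℝ → ℝ := fun s => F (p + v + s • W) with hg
  have hgd : ∀ s ∈ Icc (-(r / 2)) (r / 2),
      HasDerivAt g (fderiv ℝ F (p + v + s • W) W) s := fun s hs => by
    have h1 : HasDerivAt (fun s : ℝ => p + v + s • W) W s := by
      simpa using ((hasDerivAt_id s).smul_const W).const_add (p + v)
    exact (h.differentiableAt _ (hball s hs)).hasFDerivAt.comp_hasDerivAt s h1
  have hgc : ContinuousOn g (Icc (-(r / 2)) (r / 2)) := fun s hs =>
    (hgd s hs).continuousAt.continuousWithinAt
  have hgrow : ∀ s ∈ Icc (-(r / 2)) (r / 2), ∀ t ∈ Icc (-(r / 2)) (r / 2), s ≤ t →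
      c * (t - s) ≤ g t - g s := by
    refine (convex_Icc _ _).mul_sub_le_image_sub_of_le_deriv hgc (fun s hs => ?_) fun s hs => ?_
    · exact (hgd s (interior_subset hs)).differentiableAt.differentiableWithinAt
    · rw [(hgd s (interior_subset hs)).deriv]
      exact h.le_fderiv _ (hball s (interior_subset hs)) p hpb
  have hg0 : |g 0| ≤ c / 2 * r := by
    have h0 := hball 0 (by constructor <;> linarith)
    simp only [zero_smul, add_zero] at h0
    have := (convex_ball a ρ).norm_image_sub_le_of_norm_fderiv_le (𝕜 := ℝ) (f := F)
      h.differentiableAt h.norm_fderiv_le hpb h0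
    rw [(h.eq_zero_iff p hpb).1 hp, sub_zero, add_sub_cancel_left, Real.norm_eq_abs] at this
    simp only [hg, zero_smul, add_zero]
    calc _ ≤ G * ‖v‖ := this
      _ ≤ G * (ε * (2 * B + H) * r) := by gcongr
      _ = G * (ε * (2 * B + H)) * r := by ring
      _ ≤ _ := by gcongr
  have h0mem : (0 : ℝ) ∈ Icc (-(r / 2)) (r / 2) := by constructor <;> linarith
  have hlmem : -(r / 2) ∈ Icc (-(r / 2)) (r / 2) := by constructor <;> linarith
  have hrmem : r / 2 ∈ Icc (-(r / 2)) (r / 2) := by constructor <;> linarith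
  have k1 := hgrow _ hlmem _ h0mem (by linarith)
  have k2 := hgrow _ h0mem _ hrmem (by linarith)
  rw [abs_le] at hg0
  obtain ⟨s, hs, hs0⟩ := intermediate_value_Icc (by linarith : -(r / 2) ≤ r / 2) hgc
    (⟨by linarith, by linarith⟩ : (0 : ℝ) ∈ Icc (g (-(r / 2))) (g (r / 2)))
  have hsabs : |s| ≤ r / 2 := abs_le.2 ⟨hs.1, hs.2⟩
  have hx0 : (p + v + s • W) 0 - p 0 = -β * z 0 + α * s := by
    simp [hv, hW, hW', fieldX, fieldY]
    ring
  have hx1 : (p + v + s • W) 1 - p 1 = α * z 0 + β * s := by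
    simp [hv, hW, hW', fieldX, fieldY]
    ring
  have hx2 : heightAbove m p (p + v + s • W) = z 1 := by
    simp [heightAbove, hv, hW, hW', fieldX, fieldY]
    ring
  have hlin : ∀ σ τ : ℝ, |σ| ≤ 1 → |τ| ≤ 1 → |σ * z 0 + τ * s| < r := by
    intro σ τ hσ hτ
    refine (abs_add_le _ _).trans_lt ?_
    rw [abs_mul, abs_mul]
    have := mul_le_mul hσ le_rfl (abs_nonneg (z 0)) zero_le_one
    have := mul_le_mul hτ le_rfl (abs_nonneg s) zero_le_one
    nlinarith
  refine ⟨p + v + s • W, ⟨(h.eq_zero_iff _ (hball s hs)).2 hs0, ?_, ?_, ?_⟩, ?_⟩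
  · rw [hx0]
    exact hlin _ _ (by rwa [abs_neg]) hα
  · rw [hx1]
    exact hlin _ _ hα hβ
  · rw [hx2]
    nlinarith
  · ext i
    fin_cases i
    · simp only [transverseProjection, hx0, hx1]
      change -β * (-β * z 0 + α * s) + α * (α * z 0 + β * s) = z 0
      linear_combination z 0 * h.sq_add_sq
    · exact hx2

/-- The density is bounded above and below, and the projection of the part of the boundary in the
model box is contained in a rectangle of area `8 r κ` and contains one of area `4 ε² r κ`. -/
theorem perimeterEstimateNear (h : IsTransverse m Ω a F ρ α β c G B) (hρ : 0 < ρ) :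
    PerimeterEstimateNear m Ω a := by
  have hc := h.c_pos
  have hG := h.G_pos
  have hB := h.B_ge
  obtain ⟨hα, hβ⟩ := h.abs_le_one
  set H : ℝ := (B + 1) ^ (2 * m) with hH
  have hH0 : 0 < H := by positivity
  set ε : ℝ := min (1 / 4) (c / (2 * G * (2 * B + H))) with hε
  have hε0 : 0 < ε := by positivity
  have hεc : G * (ε * (2 * B + H)) ≤ c / 2 := by
    have : ε ≤ c / (2 * G * (2 * B + H)) := min_le_right _ _
    rw [le_div_iff₀ (by positivity)] at this
    linarith
  set K := 3 + B ^ (2 * m) * (2 * B) with hK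
  have hK0 : 0 < K := by positivity
  set K' := 8 * B ^ 2 * G / c + 4 * B with hK'
  have hK'0 : 0 < K' := by positivity
  obtain ⟨r₁, hr₁, W, hW, hWball⟩ :=
    eventually_modelBox_subset m (Metric.ball_mem_nhds a hρ)
  refine perimeterEstimateNear_of_bounds (c := c / G * (4 * ε ^ 2) / K ^ 2)
    (C := 2 * B * (K' ^ 2 * 8))
    (r₀ := min r₁ (min 1 (ρ / (2 * (2 * B + H))))) (W := W ∩ Metric.ball a (ρ / 2))
    (by positivity) (by positivity) (by positivity)
    (inter_mem hW (Metric.ball_mem_nhds _ (by positivity))) ?_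
  rintro p ⟨hp, hpW, hpb⟩ r hr hr'
  have hpa : p ∈ Metric.ball a ρ := Metric.ball_subset_ball (by linarith) hpb
  have hboxsub : modelBox m p r ⊆ Metric.ball a ρ := hWball p hpW r (hr'.trans (min_le_left _ _))
  have hr1 : r ≤ 1 := hr'.trans ((min_le_right _ _).trans (min_le_left _ _))
  have hκ := boxHeight_pos m p hr
  have hbox : boxHeight m p r ≤ H * r := by
    have hA := axisDist_nonneg p
    have hAB := (axisDist_le_norm p).trans (h.norm_le p hpa)
    rw [boxHeight, hH]
    calc r ^ 2 * (axisDist p + r) ^ (2 * m) ≤ r * (B + 1) ^ (2 * m) := by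
          gcongr
          nlinarith
      _ = _ := mul_comm _ _
  have hrρ : (2 * B + H) * r ≤ ρ / 2 := by
    have := hr'.trans ((min_le_right _ _).trans (min_le_right _ _))
    rw [le_div_iff₀ (by positivity)] at this
    linarith
  have hbm : MeasurableSet (modelBox m p r) := (isOpen_modelBox m p r).measurableSet
  set P := transverseProjection m α β p with hP
  constructor
  · set D := {z : EuclideanSpace ℝ (Fin 2) | |z 0 - (0 : EuclideanSpace ℝ (Fin 2)) 0| < ε * r ∧
      |z 1 - (0 : EuclideanSpace ℝ (Fin 2)) 1| < ε * boxHeight m p r} with hD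
    have hvol : volume D = _ := volume_rectangle (0 : EuclideanSpace ℝ (Fin 2)) (a := ε * r)
      (b := ε * boxHeight m p r) (by positivity) (by positivity)
    have hDm : MeasurableSet D := by
      refine IsOpen.measurableSet (IsOpen.and ?_ ?_) <;>
      exact isOpen_lt (by fun_prop) continuous_const
    have hDP : D ⊆ P '' (frontier Ω ∩ modelBox m p r) := by
      rintro z ⟨hz0, hz1⟩
      simp only [PiLp.zero_apply, sub_zero] at hz0 hz1
      exact h.exists_mem_frontier hp hpb hr (min_le_left _ _) hH0.le hbox hrρ hεc hz0 hz1
    have := setLIntegral_le_horizontalPerimeter (m := m) (Ω := Ω) hbm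
      (lipschitzWith_transverseProjection m hα hβ (h.norm_le p hpa)) hDm hDP
      (g := fun _ => ENNReal.ofReal (c / G)) fun q hq _ =>
        ENNReal.ofReal_le_ofReal (h.density_bounds ⟨hq.1, hboxsub hq.2⟩).1
    rw [setLIntegral_const, hvol, ← ENNReal.ofReal_mul (by positivity)] at this
    replace this := ENNReal.div_le_of_le_mul' this
    change _ / ENNReal.ofReal K ^ 2 ≤ _ at this
    rw [← ENNReal.ofReal_pow hK0.le, ← ENNReal.ofReal_div_of_pos (by positivity)] at this
    refine le_trans (ENNReal.ofReal_le_ofReal (le_of_eq ?_)) this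
    ring
  · refine (horizontalPerimeter_le hbm (M := 2 * B) fun x hx =>
      (h.density_bounds ⟨hx.1, hboxsub hx.2⟩).2).trans ?_
    have hle := euclideanHausdorffMeasure_le_of_dist_le (f := P)
      (s := frontier Ω ∩ modelBox m p r) hK'0.le fun x hx y hy =>
        h.dist_le hpa ⟨hx.1, hboxsub hx.2⟩ ⟨hy.1, hboxsub hy.2⟩
    rw [EuclideanSpace.euclideanHausdorffMeasure_eq_volume] at hle
    have himg : P '' (frontier Ω ∩ modelBox m p r) ⊆ {z : EuclideanSpace ℝ (Fin 2) |
        |z 0 - (0 : EuclideanSpace ℝ (Fin 2)) 0| < 2 * r ∧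
        |z 1 - (0 : EuclideanSpace ℝ (Fin 2)) 1| < boxHeight m p r} := by
      rintro _ ⟨x, ⟨-, hx0, hx1, hx2⟩, rfl⟩
      simp only [PiLp.zero_apply, sub_zero, mem_ofPred_eq]
      refine ⟨?_, hx2⟩
      change |-β * (x 0 - p 0) + α * (x 1 - p 1)| < 2 * r
      refine (abs_add_le _ _).trans_lt ?_
      rw [abs_mul, abs_mul, abs_neg]
      have := mul_le_mul hβ le_rfl (abs_nonneg (x 0 - p 0)) zero_le_one
      have := mul_le_mul hα le_rfl (abs_nonneg (x 1 - p 1)) zero_le_one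
      linarith
    have hvol := volume_rectangle (0 : EuclideanSpace ℝ (Fin 2)) (a := 2 * r)
      (b := boxHeight m p r) (by positivity) (by positivity)
    calc _ ≤ ENNReal.ofReal (2 * B) * (ENNReal.ofReal K' ^ 2 *
          ENNReal.ofReal (4 * (2 * r) * boxHeight m p r)) := by
          gcongr
          refine hle.trans ?_
          gcongr
          rw [← hvol]
          exact measure_mono himg
      _ = _ := by
          rw [← ENNReal.ofReal_pow hK'0.le, ← ENNReal.ofReal_mul (by positivity),
            ← ENNReal.ofReal_mul (by positivity)]
          congr 1
          ring

end IsTransverse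

/-! ### Comparison of perimeter and volume -/

theorem IsAdmissibleDomain.perimeterEstimateNear {m : ℕ} {Ω : Set (EuclideanSpace ℝ (Fin 3))}
    (hΩ : IsAdmissibleDomain m Ω) {p : EuclideanSpace ℝ (Fin 3)} (hp : p ∈ frontier Ω) :
    PerimeterEstimateNear m Ω p := by
  by_cases hchar : IsCharacteristicPoint m Ω p
  · obtain ⟨U, hU, hgraph⟩ := hΩ.admissible p hchar
    exact PerimeterEstimateNear.of_isAdmissibleGraph hΩ.smoothBoundary hp hU hgraph
  · obtain ⟨F, ρ, α, β, c, G, B, hρ, h⟩ := exists_isTransverse hΩ.smoothBoundary hp hchar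
    exact h.perimeterEstimateNear hρ

/-- The perimeter estimate holds with constants uniform in the boundary point, the boundary being
compact. -/
theorem IsAdmissibleDomain.exists_perimeter_estimate {m : ℕ}
    {Ω : Set (EuclideanSpace ℝ (Fin 3))} (hΩ : IsAdmissibleDomain m Ω) :
    ∃ C : ℝ, 0 < C ∧ ∃ r₀ : ℝ, 0 < r₀ ∧ ∀ q ∈ frontier Ω, ∀ r, 0 < r → r ≤ r₀ →
      ENNReal.ofReal (C⁻¹ * (r * boxHeight m q r)) ≤ horizontalPerimeter m Ω (modelBox m q r) ∧
      horizontalPerimeter m Ω (modelBox m q r) ≤ ENNReal.ofReal (C * (r * boxHeight m q r)) := by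
  have hcompact : IsCompact (frontier Ω) :=
    Metric.isCompact_of_isClosed_isBounded isClosed_frontier
      (hΩ.isBounded.closure.subset frontier_subset_closure)
  have key : ∃ C : ℝ, 0 < C ∧ ∃ r₀ : ℝ, 0 < r₀ ∧ ∀ q ∈ frontier Ω, q ∈ frontier Ω → ∀ r, 0 < r →
      r ≤ r₀ →
      ENNReal.ofReal (C⁻¹ * (r * boxHeight m q r)) ≤ horizontalPerimeter m Ω (modelBox m q r) ∧
      horizontalPerimeter m Ω (modelBox m q r) ≤ ENNReal.ofReal (C * (r * boxHeight m q r)) := by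
    refine hcompact.induction_on (p := fun s => ∃ C : ℝ, 0 < C ∧ ∃ r₀ : ℝ, 0 < r₀ ∧ ∀ q ∈ s,
      q ∈ frontier Ω → ∀ r, 0 < r → r ≤ r₀ →
      ENNReal.ofReal (C⁻¹ * (r * boxHeight m q r)) ≤ horizontalPerimeter m Ω (modelBox m q r) ∧
      horizontalPerimeter m Ω (modelBox m q r) ≤ ENNReal.ofReal (C * (r * boxHeight m q r)))
      ⟨1, one_pos, 1, one_pos, fun q hq => hq.elim⟩ ?_ ?_ ?_
    · rintro s t hst ⟨C, hC, r₀, hr₀, h⟩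
      exact ⟨C, hC, r₀, hr₀, fun q hq => h q (hst hq)⟩
    · rintro s t ⟨C, hC, r₀, hr₀, h⟩ ⟨C', hC', r₀', hr₀', h'⟩
      have mono : ∀ {A : ℝ} (q : EuclideanSpace ℝ (Fin 3)) (r : ℝ), 0 < A → 0 < r →
          A ≤ max C C' →
          (ENNReal.ofReal (A⁻¹ * (r * boxHeight m q r)) ≤
              horizontalPerimeter m Ω (modelBox m q r) ∧
            horizontalPerimeter m Ω (modelBox m q r) ≤
              ENNReal.ofReal (A * (r * boxHeight m q r))) →
          ENNReal.ofReal ((max C C')⁻¹ * (r * boxHeight m q r)) ≤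
              horizontalPerimeter m Ω (modelBox m q r) ∧
            horizontalPerimeter m Ω (modelBox m q r) ≤
              ENNReal.ofReal (max C C' * (r * boxHeight m q r)) := by
        intro A q r hA hr hAC hq
        have hpos := (boxHeight_pos m q hr).le
        exact ⟨le_trans (ENNReal.ofReal_le_ofReal (by gcongr)) hq.1,
          hq.2.trans (ENNReal.ofReal_le_ofReal (by gcongr))⟩
      refine ⟨max C C', by positivity, min r₀ r₀', by positivity, ?_⟩
      rintro q (hq | hq) hqΩ r hr hr'
      · exact mono q r hC hr (le_max_left _ _) (h q hq hqΩ r hr (hr'.trans (min_le_left _ _)))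
      · exact mono q r hC' hr (le_max_right _ _) (h' q hq hqΩ r hr (hr'.trans (min_le_right _ _)))
    · intro p hp
      obtain ⟨C, hC, r₀, hr₀, W, hW, h⟩ := hΩ.perimeterEstimateNear hp
      exact ⟨W, mem_nhdsWithin_of_mem_nhds hW, C, hC, r₀, hr₀, fun q hq hqΩ => h q ⟨hqΩ, hq⟩⟩
  obtain ⟨C, hC, r₀, hr₀, h⟩ := key
  exact ⟨C, hC, r₀, hr₀, fun q hq => h q hq hq⟩

/-- The doubling property of model boxes. -/
theorem boxHeight_le_of_scale (m : ℕ) (p : EuclideanSpace ℝ (Fin 3)) {r A : ℝ} (hr : 0 < r)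
    (hA : 1 ≤ A) : boxHeight m p (A * r) ≤ A ^ (2 * m + 2) * boxHeight m p r := by
  have hR := axisDist_nonneg p
  rw [boxHeight, boxHeight]
  calc (A * r) ^ 2 * (axisDist p + A * r) ^ (2 * m)
      ≤ (A * r) ^ 2 * (A * (axisDist p + r)) ^ (2 * m) := by
        gcongr
        nlinarith
    _ = _ := by
        rw [mul_pow A (axisDist p + r)]
        ring

theorem theorem1p2 (m : ℕ) (hm : 1 ≤ m) (Ω : Set (EuclideanSpace ℝ (Fin 3)))
    (hΩ : IsAdmissibleDomain m Ω) :
    ∃ C : ℝ, 0 < C ∧ ∃ r₀ : ℝ, 0 < r₀ ∧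
      ∀ p ∈ frontier Ω, ∀ r : ℝ, 0 < r → r ≤ r₀ →
        ENNReal.ofReal C⁻¹ * (volume (ccBall m p r) / ENNReal.ofReal r)
            ≤ horizontalPerimeter m Ω (ccBall m p r) ∧
        horizontalPerimeter m Ω (ccBall m p r)
            ≤ ENNReal.ofReal C * (volume (ccBall m p r) / ENNReal.ofReal r) := by
  obtain ⟨A, hA1, hA⟩ := exists_ccBall_subset_modelBox m
  obtain ⟨b, hb0, hb1, hb⟩ := exists_modelBox_subset_ccBall m
  obtain ⟨C, hC, r₀, hr₀, hest⟩ := hΩ.exists_perimeter_estimate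
  have hA0 : 0 < A := by linarith
  -- The ratio of the heights of the outer and the inner box.
  set Q := (A / b) ^ (2 * m + 2) with hQ
  have hAb : 1 ≤ A / b := by
    rw [le_div_iff₀ hb0]
    linarith
  have hQ0 : 0 < Q := by positivity
  set M := max (8 * A ^ 2 * Q * C / b) (C * A * Q / (8 * b ^ 2)) with hM
  have hM0 : 0 < M := by positivity
  refine ⟨M, hM0, r₀ / A, by positivity, fun p hp r hr hr' => ?_⟩
  have hbr : 0 < b * r := by positivity
  have hAr : 0 < A * r := by positivity
  have hAr' : A * r ≤ r₀ := by
    rw [le_div_iff₀ hA0] at hr'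
    linarith
  have hbr' : b * r ≤ r₀ := by nlinarith
  have hout := hA p r hr
  have hin := hb p r hr
  set κ := boxHeight m p (b * r) with hκ
  have hκ0 : 0 < κ := boxHeight_pos m p hbr
  have hκA : boxHeight m p (A * r) ≤ Q * κ := by
    have := boxHeight_le_of_scale m p hbr hAb
    rwa [← mul_assoc, div_mul_cancel₀ _ hb0.ne'] at this
  have vup : volume (ccBall m p r) / ENNReal.ofReal r ≤
      ENNReal.ofReal (8 * A ^ 2 * Q * (r * κ)) := by
    refine ENNReal.div_le_of_le_mul' ((measure_mono hout).trans ?_)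
    rw [volume_modelBox m p hAr, ← ENNReal.ofReal_mul hr.le]
    refine ENNReal.ofReal_le_ofReal ?_
    calc 8 * (A * r) ^ 2 * boxHeight m p (A * r) ≤ 8 * (A * r) ^ 2 * (Q * κ) := by gcongr
      _ = _ := by ring
  have vlow : ENNReal.ofReal (8 * b ^ 2 * (r * κ)) ≤
      volume (ccBall m p r) / ENNReal.ofReal r := by
    rw [ENNReal.le_div_iff_mul_le (by simp [hr]) (by simp), ← ENNReal.ofReal_mul (by positivity)]
    refine le_trans (le_of_eq ?_) (measure_mono hin)
    rw [volume_modelBox m p hbr]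
    congr 1
    ring
  constructor
  · calc ENNReal.ofReal M⁻¹ * (volume (ccBall m p r) / ENNReal.ofReal r)
        ≤ ENNReal.ofReal M⁻¹ * ENNReal.ofReal (8 * A ^ 2 * Q * (r * κ)) := by gcongr
      _ = ENNReal.ofReal (M⁻¹ * (8 * A ^ 2 * Q * (r * κ))) := by
          rw [ENNReal.ofReal_mul (p := M⁻¹) (by positivity)]
      _ ≤ ENNReal.ofReal (C⁻¹ * (b * r * κ)) := by
          refine ENNReal.ofReal_le_ofReal ?_
          calc M⁻¹ * (8 * A ^ 2 * Q * (r * κ))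
              ≤ (8 * A ^ 2 * Q * C / b)⁻¹ * (8 * A ^ 2 * Q * (r * κ)) := by
                gcongr
                exact le_max_left _ _
            _ = _ := by field_simp
      _ ≤ horizontalPerimeter m Ω (modelBox m p (b * r)) := (hest p hp _ hbr hbr').1
      _ ≤ _ := measure_mono hin
  · calc horizontalPerimeter m Ω (ccBall m p r)
        ≤ horizontalPerimeter m Ω (modelBox m p (A * r)) := measure_mono hout
      _ ≤ ENNReal.ofReal (C * (A * r * boxHeight m p (A * r))) := (hest p hp _ hAr hAr').2
      _ ≤ ENNReal.ofReal (M * (8 * b ^ 2 * (r * κ))) := by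
          refine ENNReal.ofReal_le_ofReal ?_
          calc C * (A * r * boxHeight m p (A * r)) ≤ C * (A * r * (Q * κ)) := by gcongr
            _ = C * A * Q / (8 * b ^ 2) * (8 * b ^ 2 * (r * κ)) := by field_simp
            _ ≤ _ := by
                gcongr
                exact le_max_right _ _
      _ = ENNReal.ofReal M * ENNReal.ofReal (8 * b ^ 2 * (r * κ)) := by
          rw [ENNReal.ofReal_mul hM0.le]
      _ ≤ _ := by gcongr
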